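/- Let $N\in\mathbb N$ and let $f:\mathbb C^N\to\mathbb C^N$ be a complex entire vector field which is real on real arguments, i.e. $f(\mathbb R^N)\subseteq\mathbb R^N$. Let $v^-,v^+\in\mathbb R^N$ be hyperbolic equilibria of $\dot z=f(z)$ (that is, $f(v^\pm)=0$ and $f'(v^\pm)$ has no eigenvalue on the imaginary axis), where $v^-=v^+$ is allowed. Let $\Gamma:\mathbb R\to\mathbb R^N$ be a nonstationary real solution of $\dot\Gamma=f(\Gamma)$ with $\Gamma(\sigma)\to v^-$ for $\sigma\to-\infty$ and $\Gamma(\sigma)\to v^+$ for $\sigma\to+\infty$; i.e. $\Gamma$ is homoclinic if $v^-=v^+$, and heteroclinic otherwise. Let $A^+$ denote the unstable block of $f'(v^-)$, i.e. its restriction to the sum of the generalized eigenspaces of all eigenvalues with positive real part, and let $A^-$ denote the stable block of $f'(v^+)$, i.e. its restriction to the sum of the generalized eigenspaces of all eigenvalues with negative real part. Assume that $A^+$ and $A^-$ are diagonalizable, that all eigenvalues of $A^+$ and of $A^-$ are real, and that $A^+$ and $A^-$ are, separately, nonresonant: if $\mu_1,\mu_2,\dots$ are the eigenvalues of $A^+$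 (respectively, of $A^-$), then $$\mu_{j_0}\neq\sum_j n_j\,\mu_j$$ for every index $j_0$ and all nonnegative integers $n_j$ with $\sum_j n_j\ge 2$. Then there exist a real $\sigma_0$ and a real $\tau^*>0$ such that $\Gamma$ extends to a holomorphic solution of $\dot z=f(z)$, in complex time, on a connected open set $U\subseteq\mathbb C$ which contains the real axis and the imaginary segment $\{\sigma_0+i\tau:\ |\tau|<\tau^*\}$, and such that this extension blows up at the imaginary times $\tau=\pm\tau^*$: $$|\Gamma(\sigma_0+i\tau)|\to\infty\quad\text{as }\tau\nearrow\tau^*\text{ and as }\tau\searrow-\tau^*.$$ -/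

import Mathlib

open Filter Topology

namespace ConnectingOrbit

/-- The complex phase space `ℂ^N`. (All norms on it are equivalent, so that limits, derivatives and
blow-up do not depend on the choice of the norm.) -/
abbrev Phase (N : ℕ) : Type := Fin N → ℂ

/-- A point of `ℝ^N ⊆ ℂ^N`. -/
def IsRealPoint {N : ℕ} (z : Phase N) : Prop := ∀ i, (z i).im = 0

section Linear

variable {V : Type*} [AddCommGroup V] [Module ℂ V]

/-- The sum of the generalized eigenspaces of `A` over all eigenvalues in `S`. -/
def spectralSubspace (A : Module.End ℂ V) (S : Set ℂ) : Submodule ℂ V :=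
  ⨆ μ ∈ S, A.maxGenEigenspace μ

theorem mapsTo_spectralSubspace (A : Module.End ℂ V) (S : Set ℂ) :
    ∀ x ∈ spectralSubspace A S, A x ∈ spectralSubspace A S := by
  intro x hx
  have h : spectralSubspace A S ≤ (spectralSubspace A S).comap A := by
    refine iSup₂_le fun μ hμ y hy => ?_
    exact (le_iSup₂ (f := fun μ (_ : μ ∈ S) => A.maxGenEigenspace μ) μ hμ)
      (Module.End.mapsTo_maxGenEigenspace_of_comm (Commute.refl A) μ hy)
  exact h hx

/-- The block of `A` which carries the eigenvalues in `S`. -/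
def spectralBlock (A : Module.End ℂ V) (S : Set ℂ) : Module.End ℂ (spectralSubspace A S) :=
  A.restrict (mapsTo_spectralSubspace A S)

/-- The stable block `A⁻`: all eigenvalues with negative real part. -/
abbrev stableBlock (A : Module.End ℂ V) := spectralBlock A {μ : ℂ | μ.re < 0}

/-- The unstable block `A⁺`: all eigenvalues with positive real part. -/
abbrev unstableBlock (A : Module.End ℂ V) := spectralBlock A {μ : ℂ | 0 < μ.re}

/-- No eigenvalue lies on the imaginary axis. -/
def IsHyperbolic (A : Module.End ℂ V) : Prop :=
  ∀ μ : ℂ, A.HasEigenvalue μ → μ.re ≠ 0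

/-- There is a basis of eigenvectors. -/
def IsDiagonalizable (A : Module.End ℂ V) : Prop :=
  ∃ (ι : Type) (b : Module.Basis ι ℂ V) (μ : ι → ℂ), ∀ i, A (b i) = μ i • b i

/-- All eigenvalues are real. -/
def HasRealSpectrum (A : Module.End ℂ V) : Prop :=
  ∀ μ : ℂ, A.HasEigenvalue μ → μ.im = 0

/-- Nonresonance: no eigenvalue `μ₀` is a sum `∑ n_μ μ` of eigenvalues with nonnegative integer
coefficients of order `∑ n_μ ≥ 2`. The exponents are indexed by the distinct eigenvalues, which
gives the same sums as an indexing with multiplicities. -/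
def IsNonresonant (A : Module.End ℂ V) : Prop :=
  ∀ μ₀ : ℂ, A.HasEigenvalue μ₀ →
    ∀ n : ℂ →₀ ℕ, (∀ μ ∈ n.support, A.HasEigenvalue μ) → 2 ≤ (n.sum fun _ k => k) →
      μ₀ ≠ n.sum fun μ k => (k : ℂ) * μ

end Linear

/-- The linearization `f'(v)`. -/
noncomputable def linearization {N : ℕ} (f : Phase N → Phase N) (v : Phase N) :
    Module.End ℂ (Phase N) :=
  (fderiv ℂ f v : Phase N →L[ℂ] Phase N)

/-- A hyperbolic equilibrium of `ż = f(z)`. -/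
def IsHyperbolicEquilibrium {N : ℕ} (f : Phase N → Phase N) (v : Phase N) : Prop :=
  f v = 0 ∧ IsHyperbolic (linearization f v)

/-- `Γ` is a real nonstationary orbit of `ż = f(z)`, in real time, which converges to `vminus` at
`-∞` and to `vplus` at `+∞`. It is homoclinic if `vminus = vplus`, and heteroclinic otherwise. -/
structure IsRealConnectingOrbit {N : ℕ} (f : Phase N → Phase N) (vminus vplus : Phase N)
    (Γ : ℝ → Phase N) : Prop where
  real : ∀ σ, IsRealPoint (Γ σ)
  solution : ∀ σ, HasDerivAt Γ (f (Γ σ)) σ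
  nonstationary : ∃ σ, Γ σ ≠ Γ 0
  tendsto_bot : Tendsto Γ atBot (𝓝 vminus)
  tendsto_top : Tendsto Γ atTop (𝓝 vplus)

/-- `G` is an analytic extension of the real-time solution `Γ` of `ż = f(z)` to a connected open
set `U` of complex times which contains the real axis, and `G` solves the equation in complex time.
By the identity theorem, `U` and `Γ` determine `G` on `U`. -/
structure IsComplexTimeExtension {N : ℕ} (f : Phase N → Phase N) (Γ : ℝ → Phase N)
    (U : Set ℂ) (G : ℂ → Phase N) : Prop where
  isOpen : IsOpen U
  isConnected : IsConnected U
  real_mem : ∀ σ : ℝ, (σ : ℂ) ∈ U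
  eq_on_real : ∀ σ : ℝ, G (σ : ℂ) = Γ σ
  solution : ∀ t ∈ U, HasDerivAt G (f (G t)) t

/-- The extension of `Γ` to complex time exists on the imaginary segment
`{σ₀ + iτ : |τ| < T}`, and `|Γ(σ₀ + iτ)| → ∞` as `τ ↗ T` and as `τ ↘ -T`. -/
def BlowsUpInImaginaryTime {N : ℕ} (f : Phase N → Phase N) (Γ : ℝ → Phase N)
    (σ₀ T : ℝ) : Prop :=
  ∃ (U : Set ℂ) (G : ℂ → Phase N), IsComplexTimeExtension f Γ U G ∧
    (∀ τ : ℝ, |τ| < T → (σ₀ : ℂ) + τ * Complex.I ∈ U) ∧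
    Tendsto (fun τ : ℝ => ‖G ((σ₀ : ℂ) + τ * Complex.I)‖) (𝓝[<] T) atTop ∧
    Tendsto (fun τ : ℝ => ‖G ((σ₀ : ℂ) + τ * Complex.I)‖) (𝓝[>] (-T)) atTop

end ConnectingOrbit

/-! Assume that the orbit never blows up in imaginary time. It then continues to an entire function
of complex time. The argument shows that this function is bounded, so that it is constant by
Liouville's theorem, which contradicts nonstationarity.

Near the equilibrium at `-∞` the unstable eigenvalues `λ_j` are positive and no sum `∑ k_j λ_j` of
order at least two is an eigenvalue. Poincaré's series therefore converges: every solution near the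
equilibrium with suitable unstable data is a power series in the functions `e^{λ_j t}`, that is, an
absolutely convergent Dirichlet series (`exists_dirichlet_solution`). A maximum argument for nearly
diagonal systems shows that `Γ` itself is such a series (`exists_dirichlet_eq`). Hence `Γ` extends
boundedly to a left half-plane. Since the `λ_j` are real, the extension is quasi-periodic on
vertical lines and so returns arbitrarily close to its real value at arbitrarily large imaginary
times (`dirichlet_recurrent`). Time reversal gives a bounded extension to a right half-plane. This
exhausts the role of the spectral hypotheses.

Suppose a continuation `G` to all horizontal strips exists. Choose a large `τ` at which `G(σ₁ + iτ)`
is close to `Γ(σ₁)`. By continuous dependence in real time, `G(· + iτ)` is bounded on a fixed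
interval `[σ₁, σ₂]`, uniformly in such `τ`; the line at height `-τ` follows by Schwarz reflection.
The vertical sides of the resulting rectangle lie in the two half-planes. The maximum principle
bounds `G` on the rectangle, and these rectangles exhaust the region between the ends
(`eq_of_entire`).

So the half-widths of the strips of continuation have a finite supremum `T`. If no vertical segment
blew up at height `T`, then local existence, with a radius depending only on a bound for the initial
value, compactness and the end estimates would bound the continuation on the strip
(`exists_bound_of_no_blowup`). A bounded solution on a convex set extends to a uniform neighborhood
(`exists_extension_of_bounded`), which contradicts the choice of `T`. Reflection gives the blow-up
at `-T`. -/

namespace ConnectingOrbit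

set_option linter.unusedSectionVars false

/-! ### Power series in Banach algebras and their derivative at the origin. -/

section PowerSeries

/-- A power series in several variables, evaluated in a commutative Banach algebra. -/
noncomputable def pseries {𝒜 : Type*} [NormedCommRing 𝒜] [NormedAlgebra ℂ 𝒜] {N : ℕ}
    (c : (Fin N → ℕ) → ℂ) (u : Fin N → 𝒜) : 𝒜 :=
  ∑' k, c k • ∏ i, u i ^ k i

variable {𝒜 : Type*} [NormedCommRing 𝒜] [NormedAlgebra ℂ 𝒜] [CompleteSpace 𝒜] [NormOneClass 𝒜]
  {N : ℕ}

theorem norm_monomial_le (u : Fin N → 𝒜) (hu : ‖u‖ ≤ 1) (k : Fin N → ℕ) :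
    ‖∏ i, u i ^ k i‖ ≤ 1 := by
  refine (Finset.norm_prod_le _ _).trans ?_
  refine Finset.prod_le_one (fun _ _ => norm_nonneg _) fun i _ => ?_
  exact (norm_pow_le _ _).trans (pow_le_one₀ (norm_nonneg _) ((norm_le_pi_norm u i).trans hu))

theorem summable_pseries {c : (Fin N → ℕ) → ℂ} (hc : Summable fun k => ‖c k‖) (u : Fin N → 𝒜)
    (hu : ‖u‖ ≤ 1) : Summable fun k => c k • ∏ i, u i ^ k i := by
  refine Summable.of_norm_bounded hc fun k => ?_
  rw [norm_smul]
  exact mul_le_of_le_one_right (norm_nonneg _) (norm_monomial_le u hu k)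

/-- Continuous algebra homomorphisms commute with absolutely convergent series. Applied to point
evaluations of the Wiener algebra, this identifies substitution in the algebra with pointwise
composition. -/
theorem map_pseries {ℬ : Type*} [NormedCommRing ℬ] [NormedAlgebra ℂ ℬ]
    {c : (Fin N → ℕ) → ℂ} (hc : Summable fun k => ‖c k‖) (u : Fin N → 𝒜) (hu : ‖u‖ ≤ 1)
    (χ : 𝒜 →A[ℂ] ℬ) : χ (pseries c u) = pseries c fun i => χ (u i) := by
  unfold pseries
  rw [Summable.map_tsum (summable_pseries hc u hu) χ (map_continuous χ)]
  simp [map_prod]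

/-- A monomial of degree `n` is the product map, multilinear of norm at most one, evaluated on `n`
repeated arguments; the bound is the Lipschitz estimate for multilinear maps. -/
theorem norm_monomial_sub_le (k : Fin N → ℕ) (u w : Fin N → 𝒜) {ρ : ℝ} (hu : ‖u‖ ≤ ρ)
    (hw : ‖w‖ ≤ ρ) :
    ‖∏ i, u i ^ k i - ∏ i, w i ^ k i‖ ≤ (∑ i, k i : ℕ) * ρ ^ ((∑ i, k i) - 1) * ‖u - w‖ := by
  have hρ : 0 ≤ ρ := (norm_nonneg _).trans hu
  have key := (ContinuousMultilinearMap.mkPiAlgebra ℂ (Σ i, Fin (k i)) 𝒜).norm_image_sub_le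
    (fun x => u x.1) (fun x => w x.1)
  have e : ∀ u : Fin N → 𝒜, ContinuousMultilinearMap.mkPiAlgebra ℂ (Σ i, Fin (k i)) 𝒜
      (fun x => u x.1) = ∏ i, u i ^ k i := by
    intro u
    rw [ContinuousMultilinearMap.mkPiAlgebra_apply, Fintype.prod_sigma]
    simp
  have hle : ∀ u : Fin N → 𝒜, ‖(fun x : (Σ i, Fin (k i)) => u x.1)‖ ≤ ‖u‖ := fun u =>
    (pi_norm_le_iff_of_nonneg (norm_nonneg _)).2 fun x => norm_le_pi_norm u x.1
  rw [e, e] at key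
  refine key.trans ?_
  have h1 : ‖ContinuousMultilinearMap.mkPiAlgebra ℂ (Σ i, Fin (k i)) 𝒜‖ ≤ 1 :=
    ContinuousMultilinearMap.norm_mkPiAlgebra.le
  have hcard : Fintype.card (Σ i, Fin (k i)) = ∑ i, k i := by simp
  rw [hcard]
  have h2 : ‖(fun x : (Σ i, Fin (k i)) => u x.1) - fun x => w x.1‖ ≤ ‖u - w‖ := hle (u - w)
  calc _ ≤ 1 * (∑ i, k i : ℕ) * ρ ^ ((∑ i, k i) - 1) * ‖u - w‖ := by
        gcongr
        exact max_le ((hle u).trans hu) ((hle w).trans hw)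
    _ = _ := by rw [one_mul]

/-- Degree zero contributes nothing and degree one cancels exactly. In degree `n ≥ 2` the Lipschitz
constant `n ρ^(n-1)` is at most `2ρ`, because `ρ ≤ 1/2`. The uniformity in `k` allows summation
against the coefficients. -/
theorem monomial_sub_linear_le (k : Fin N → ℕ) (u w : Fin N → 𝒜) {ρ : ℝ} (hρ : ρ ≤ 1 / 2)
    (hu : ‖u‖ ≤ ρ) (hw : ‖w‖ ≤ ρ) :
    ‖∏ i, u i ^ k i - ∏ i, w i ^ k i
      - ∑ i, if k = Pi.single i 1 then u i - w i else 0‖ ≤ 2 * ρ * ‖u - w‖ := by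
  have hρ0 : 0 ≤ ρ := (norm_nonneg _).trans hu
  by_cases h : ∃ i, k = Pi.single i 1
  · obtain ⟨j, rfl⟩ := h
    have h1 : ∀ u : Fin N → 𝒜, ∏ i, u i ^ (Pi.single j 1 : Fin N → ℕ) i = u j := by
      intro u
      rw [Finset.prod_eq_single j]
      · simp
      · intro b _ hb; simp [hb]
      · simp
    have h2 : ∑ i, (if (Pi.single j 1 : Fin N → ℕ) = Pi.single i 1 then u i - w i else 0)
        = u j - w j := by
      rw [Finset.sum_eq_single j]
      · simp
      · intro b _ hb
        rw [if_neg]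
        intro hh
        have := congrFun hh b
        simp [hb] at this
      · simp
    rw [h1, h1, h2]
    simp only [sub_self, norm_zero]
    positivity
  · have h2 : ∑ i, (if k = Pi.single i 1 then u i - w i else 0) = 0 :=
      Finset.sum_eq_zero fun i _ => if_neg fun hh => h ⟨i, hh⟩
    rw [h2, sub_zero]
    refine (norm_monomial_sub_le k u w hu hw).trans (mul_le_mul_of_nonneg_right ?_ (norm_nonneg _))
    set n := ∑ i, k i with hn
    rcases Nat.lt_or_ge n 2 with hlt | hge
    · have h0 : n ≠ 1 := by
        intro h1
        apply h
        have : ∃ i, k i ≠ 0 := by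
          by_contra! hk
          simp [hk] at hn
          omega
        obtain ⟨i, hi⟩ := this
        refine ⟨i, ?_⟩
        have hsum : k i + ∑ j ∈ Finset.univ.erase i, k j = n := by
          rw [hn, Finset.add_sum_erase _ _ (Finset.mem_univ i)]
        have hz : ∑ j ∈ Finset.univ.erase i, k j = 0 := by omega
        rw [Finset.sum_eq_zero_iff] at hz
        ext j
        by_cases hj : j = i
        · subst hj; simp; omega
        · simp [hj, hz j (by simp [hj])]
      have : n = 0 := by omega
      rw [this]; simp [hρ0]
    · obtain ⟨m, hm⟩ := Nat.exists_eq_add_of_le hge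
      rw [hm]
      have h3 : ((2 + m : ℕ) : ℝ) * ρ ^ (2 + m - 1) = (((2 + m : ℕ) : ℝ) * ρ ^ m) * ρ := by
        rw [show 2 + m - 1 = m + 1 by omega, pow_succ]; ring
      rw [h3]
      gcongr
      -- The factor `2 ^ m` is absorbed by `ρ ^ m ≤ (1 / 2) ^ m`.
      have h4 : ((2 + m : ℕ) : ℝ) ≤ 2 * 2 ^ m := by
        have : ∀ m : ℕ, 2 + m ≤ 2 * 2 ^ m := by
          intro m
          induction m with
          | zero => simp
          | succ m ih => rw [pow_succ]; omega
        exact_mod_cast this m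
      calc ((2 + m : ℕ) : ℝ) * ρ ^ m ≤ (2 * 2 ^ m) * (1 / 2) ^ m := by gcongr
        _ = 2 := by rw [mul_assoc, ← mul_pow]; norm_num

/-- The derivative at `0` of a power series is given by its coefficients of order one. -/
noncomputable def linearPart (𝒜 : Type*) [NormedCommRing 𝒜] [NormedAlgebra ℂ 𝒜]
    (c : (Fin N → ℕ) → ℂ) : (Fin N → 𝒜) →L[ℂ] 𝒜 :=
  ∑ i, c (Pi.single i 1) • ContinuousLinearMap.proj i

theorem hasStrictFDerivAt_pseries {c : (Fin N → ℕ) → ℂ} (hc : Summable fun k => ‖c k‖) :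
    HasStrictFDerivAt (pseries c) (linearPart 𝒜 c) (0 : Fin N → 𝒜) := by
  refine .of_isLittleO ?_
  rw [Asymptotics.isLittleO_iff]
  intro ε hε
  set S := ∑' k, ‖c k‖ with hS
  have hS0 : 0 ≤ S := tsum_nonneg fun _ => norm_nonneg _
  obtain ⟨ρ, hρ, hρ1, hρ2⟩ : ∃ ρ : ℝ, 0 < ρ ∧ ρ ≤ 1 / 2 ∧ S * (2 * ρ) ≤ ε := by
    refine ⟨min (1 / 2) (ε / (2 * (S + 1))), by positivity, min_le_left _ _, ?_⟩
    calc S * (2 * min (1 / 2) (ε / (2 * (S + 1)))) ≤ (S + 1) * (2 * (ε / (2 * (S + 1)))) := by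
          gcongr
          · linarith
          · exact min_le_right _ _
      _ = ε := by field_simp
  have hnb : Metric.closedBall (0 : Fin N → 𝒜) ρ ×ˢ Metric.closedBall (0 : Fin N → 𝒜) ρ ∈
      𝓝 ((0 : Fin N → 𝒜), (0 : Fin N → 𝒜)) :=
    prod_mem_nhds (Metric.closedBall_mem_nhds _ hρ) (Metric.closedBall_mem_nhds _ hρ)
  filter_upwards [hnb] with p hp
  obtain ⟨u, w⟩ := p
  simp only [Set.mem_prod, mem_closedBall_zero_iff] at hp
  obtain ⟨hu, hw⟩ := hp
  have hlin : HasSum (fun k => c k • ∑ i, if k = Pi.single i 1 then u i - w i else 0)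
      (linearPart 𝒜 c (u - w)) := by
    have : (fun k => c k • ∑ i, if k = Pi.single i 1 then u i - w i else 0)
        = fun k => ∑ i, if k = Pi.single i 1 then c k • (u i - w i) else 0 := by
      ext k
      rw [Finset.smul_sum]
      simp [smul_ite]
    rw [this]
    simp only [linearPart, sum_apply]
    refine hasSum_sum fun i _ => ?_
    have h0 := hasSum_ite_eq (Pi.single i 1 : Fin N → ℕ) (c (Pi.single i 1) • (u i - w i))
    refine h0.congr_fun fun k => ?_
    split_ifs with h
    · rw [h]
    · rfl
  have hsum := ((summable_pseries hc u (hu.trans (by linarith))).hasSum.sub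
    (summable_pseries hc w (hw.trans (by linarith))).hasSum).sub hlin
  have : pseries c u - pseries c w - linearPart 𝒜 c (u - w) = ∑' k, (c k • ∏ i, u i ^ k i
      - c k • ∏ i, w i ^ k i - c k • ∑ i, if k = Pi.single i 1 then u i - w i else 0) :=
    hsum.tsum_eq.symm
  change ‖pseries c u - pseries c w - linearPart 𝒜 c (u - w)‖ ≤ ε * ‖u - w‖
  rw [this]
  have hb : ∀ k, ‖c k • ∏ i, u i ^ k i - c k • ∏ i, w i ^ k i
      - c k • ∑ i, if k = Pi.single i 1 then u i - w i else 0‖ ≤ ‖c k‖ * (2 * ρ * ‖u - w‖) := by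
    intro k
    rw [← smul_sub, ← smul_sub, norm_smul]
    gcongr
    exact monomial_sub_linear_le k u w hρ1 hu hw
  refine (tsum_of_norm_bounded ((hc.hasSum).mul_right _) hb).trans ?_
  calc S * (2 * ρ * ‖u - w‖) = S * (2 * ρ) * ‖u - w‖ := by ring
    _ ≤ _ := by gcongr

end PowerSeries

/-! ### Cauchy's formula on a polydisc and the expansion of entire functions. -/

section CauchyTorus

open MeasureTheory

theorem hasSum_pi_prod {N : ℕ} (g : Fin N → ℕ → ℂ) (hg : ∀ i, Summable fun n => ‖g i n‖) :
    Summable (fun k : Fin N → ℕ => ‖∏ i, g i (k i)‖) ∧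
      HasSum (fun k : Fin N → ℕ => ∏ i, g i (k i)) (∏ i, ∑' n, g i n) := by
  induction N with
  | zero =>
    constructor
    · exact (hasSum_fintype _).summable
    · simp
  | succ N ih =>
    obtain ⟨h1, h2⟩ := ih (fun i => g i.succ) (fun i => hg _)
    have e := (Fin.consEquiv fun _ : Fin (N + 1) => ℕ)
    have key := (hg 0).mul_norm h1
    constructor
    · rw [← (Fin.consEquiv fun _ : Fin (N + 1) => ℕ).summable_iff]
      refine key.congr fun x => ?_
      simp [Fin.prod_univ_succ, Fin.consEquiv]
    · rw [← (Fin.consEquiv fun _ : Fin (N + 1) => ℕ).hasSum_iff, Fin.prod_univ_succ]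
      have := (hg 0).of_norm.hasSum.mul h2 key.of_norm
      refine this.congr_fun fun x => ?_
      simp [Fin.prod_univ_succ, Fin.consEquiv]

/-- Induction on the dimension: the inner torus integral is the formula for the remaining variables,
the outer one is the one-variable Cauchy formula. Radius two leaves room around the closed unit
polydisc. -/
theorem cauchy_torus {N : ℕ} (f : (Fin N → ℂ) → ℂ) (hf : Differentiable ℂ f) (z : Fin N → ℂ)
    (hz : ∀ i, ‖z i‖ < 2) :
    torusIntegral (fun ζ => (∏ i, (ζ i - z i)⁻¹) * f ζ) 0 (fun _ => 2)
      = (2 * Real.pi * Complex.I) ^ N * f z := by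
  induction N with
  | zero =>
    rw [torusIntegral_dim0]
    simp
    congr 1
    exact Subsingleton.elim _ _
  | succ N ih =>
    have hne : ∀ (θ : Fin (N + 1) → ℝ) i, torusMap 0 (fun _ => 2) θ i - z i ≠ 0 := by
      intro θ i h
      have : z i = torusMap 0 (fun _ => 2) θ i := (sub_eq_zero.1 h).symm
      have h2 := hz i
      rw [this] at h2
      simp [torusMap] at h2
    have hcont : Continuous fun θ : Fin (N + 1) → ℝ => torusMap (0 : Fin (N + 1) → ℂ) (fun _ => 2) θ := by
      unfold torusMap; fun_prop
    have hint : TorusIntegrable (fun ζ => (∏ i, (ζ i - z i)⁻¹) * f ζ) 0 (fun _ => 2) := by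
      refine Continuous.integrableOn_Icc ?_
      refine Continuous.mul (continuous_finsetProd _ fun i _ => ?_) (hf.continuous.comp hcont)
      exact Continuous.inv₀ (((continuous_apply i).comp hcont).sub continuous_const)
        (fun θ => hne θ i)
    rw [torusIntegral_succ hint]
    have hin : ∀ x : ℂ, torusIntegral (fun y => (∏ i, ((Fin.cons x y : Fin (N + 1) → ℂ) i - z i)⁻¹)
        * f (Fin.cons x y)) ((0 : Fin (N + 1) → ℂ) ∘ Fin.succ) ((fun _ => 2) ∘ Fin.succ)
        = (x - z 0)⁻¹ * ((2 * Real.pi * Complex.I) ^ N * f (Fin.cons x (Fin.tail z))) := by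
      intro x
      have hd : Differentiable ℂ fun y : Fin N → ℂ => f (Fin.cons x y) := by
        refine hf.comp (differentiable_pi.2 fun i => ?_)
        refine Fin.cases ?_ (fun j => ?_) i
        · simp
        · simpa using differentiable_apply j
      have := ih (fun y => f (Fin.cons x y)) hd (Fin.tail z) (fun i => hz _)
      rw [← this, ← torusIntegral_const_mul]
      congr 1
      ext y
      simp only [Fin.prod_univ_succ, Fin.tail, Fin.cons_zero, Fin.cons_succ]
      ring
    have hd : Differentiable ℂ fun x : ℂ => f (Fin.cons x (Fin.tail z)) := by
      refine hf.comp (differentiable_pi.2 fun i => ?_)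
      refine Fin.cases ?_ (fun j => ?_) i
      · simp
      · simp
    simp only [hin]
    have hb : z 0 ∈ Metric.ball (0 : ℂ) 2 := by simpa using hz 0
    have := (hd.const_mul ((2 * Real.pi * Complex.I) ^ N)).diffContOnCl.circleIntegral_sub_inv_smul
      (c := 0) (R := 2) hb
    simp only [smul_eq_mul] at this
    rw [show ((0 : Fin (N + 1) → ℂ) 0) = 0 from rfl, this, Fin.cons_self_tail]
    ring

/-- An entire function of several variables is the sum of its power series. -/
theorem exists_pseries_eq {N : ℕ} (f : (Fin N → ℂ) → ℂ) (hf : Differentiable ℂ f) :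
    ∃ c : (Fin N → ℕ) → ℂ, (Summable fun k => ‖c k‖) ∧ ∀ z, ‖z‖ ≤ 1 → f z = pseries c z := by
  set τ : (Fin N → ℝ) → Fin N → ℂ := torusMap 0 (fun _ => 2) with hτ
  have hcont : Continuous τ := by
    rw [hτ]; unfold torusMap; fun_prop
  have hτn : ∀ θ i, ‖τ θ i‖ = 2 := by intro θ i; simp [hτ, torusMap]
  have hτ0 : ∀ θ i, τ θ i ≠ 0 := by
    intro θ i h
    have := hτn θ i
    rw [h] at this
    simp at this
  obtain ⟨C, hC⟩ : ∃ C, ∀ θ, ‖f (τ θ)‖ ≤ C := by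
    have hK : IsCompact (Metric.closedBall (0 : Fin N → ℂ) 2) := isCompact_closedBall _ _
    obtain ⟨C, hC⟩ := hK.exists_bound_of_continuousOn hf.continuous.continuousOn
    refine ⟨C, fun θ => hC _ ?_⟩
    rw [mem_closedBall_zero_iff, pi_norm_le_iff_of_nonneg (by norm_num)]
    exact fun i => (hτn θ i).le
  have hC0 : 0 ≤ C := (norm_nonneg _).trans (hC 0)
  -- The terms of the geometric expansion of the Cauchy kernel times `f`. Setting `z = 1` drops the
  -- factor `z^k` and leaves the integrand of the `k`-th coefficient. On the torus of radius two,
  -- with `‖z‖ ≤ 1`, they are at most `C 2^{-|k|}`, which gives both the summability of the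
  -- coefficients and the exchange of sum and integral.
  set W : (Fin N → ℂ) → (Fin N → ℕ) → (Fin N → ℂ) → ℂ := fun z k ζ =>
    (∏ i, z i ^ k i * (ζ i ^ (k i + 1))⁻¹) * f ζ with hW
  set d : (Fin N → ℕ) → ℂ := fun k => torusIntegral (W 1 k) 0 (fun _ => 2) with hd
  have hWb : ∀ z, ‖z‖ ≤ 1 → ∀ k θ, ‖W z k (τ θ)‖ ≤ (∏ i : Fin N, (1 / 2 : ℝ) ^ (k i)) * C := by
    intro z hz k θ
    simp only [hW, norm_mul, norm_prod, norm_inv, norm_pow, hτn]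
    refine mul_le_mul (Finset.prod_le_prod (fun i _ => by positivity) fun i _ => ?_) (hC θ)
      (norm_nonneg _) (Finset.prod_nonneg fun i _ => by positivity)
    calc ‖z i‖ ^ k i * (2 ^ (k i + 1))⁻¹ ≤ 1 ^ k i * (2 ^ (k i))⁻¹ := by
            gcongr
            · exact (norm_le_pi_norm z i).trans hz
            · norm_num
            · omega
        _ = (1 / 2) ^ k i := by simp
  have hgeo : Summable fun k : Fin N → ℕ => ∏ i : Fin N, (1 / 2 : ℝ) ^ (k i) := by
    have := (hasSum_pi_prod (N := N) (fun _ n => (1 / 2 : ℂ) ^ n) (fun i => by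
      simpa using summable_geometric_two)).1
    refine this.congr fun k => ?_
    simp [norm_prod]
  have hds : Summable fun k => ‖d k‖ := by
    refine Summable.of_nonneg_of_le (fun _ => norm_nonneg _) (fun k => ?_)
      ((hgeo.mul_right C).mul_left ((2 * Real.pi) ^ N * ∏ _i : Fin N, |(2 : ℝ)|))
    exact norm_torusIntegral_le_of_norm_le_const (hWb 1 (by
      rw [pi_norm_le_iff_of_nonneg zero_le_one]; simp) k)
  have hpi : (2 * Real.pi * Complex.I) ^ N ≠ 0 := by
    refine pow_ne_zero _ ?_
    simp [Real.pi_ne_zero]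
  refine ⟨fun k => ((2 * Real.pi * Complex.I) ^ N)⁻¹ * d k, ?_, fun z hz => ?_⟩
  · simpa [norm_mul] using hds.mul_left ‖((2 * Real.pi * Complex.I) ^ N)⁻¹‖
  have hzi : ∀ i, ‖z i‖ ≤ 1 := fun i => (norm_le_pi_norm z i).trans hz
  have hWc : ∀ k, Continuous fun θ => W z k (τ θ) := by
    intro k
    simp only [hW]
    refine Continuous.mul (continuous_finsetProd _ fun i _ => ?_) (hf.continuous.comp hcont)
    exact continuous_const.mul ((((continuous_apply i).comp hcont).pow _).inv₀
      fun θ => pow_ne_zero _ (hτ0 θ i))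
  have hsum : ∀ θ, HasSum (fun k => W z k (τ θ)) ((∏ i, (τ θ i - z i)⁻¹) * f (τ θ)) := by
    intro θ
    have hr : ∀ i, ‖z i * (τ θ i)⁻¹‖ < 1 := by
      intro i
      rw [norm_mul, norm_inv, hτn]
      have := hzi i
      linarith
    have h0 : ∀ i n, z i ^ n * (τ θ i ^ (n + 1))⁻¹ = (τ θ i)⁻¹ * (z i * (τ θ i)⁻¹) ^ n := by
      intro i n
      rw [mul_pow, pow_succ, mul_inv, inv_pow]; ring
    have h1 : ∀ i, HasSum (fun n => z i ^ n * (τ θ i ^ (n + 1))⁻¹) (τ θ i - z i)⁻¹ := by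
      intro i
      simp only [h0]
      have h3 := (hasSum_geometric_of_norm_lt_one (hr i)).mul_left (τ θ i)⁻¹
      rwa [← mul_inv, mul_sub, mul_one, mul_left_comm, mul_inv_cancel₀ (hτ0 θ i), mul_one] at h3
    have h2 := (hasSum_pi_prod (fun i n => z i ^ n * (τ θ i ^ (n + 1))⁻¹) (fun i => by
      simp only [h0, norm_mul, norm_pow]
      refine Summable.mul_left _ (summable_geometric_of_lt_one (by positivity) ?_)
      simpa using hr i)).2
    simp only [(h1 _).tsum_eq] at h2
    exact h2.mul_right _
  have hmain : HasSum (fun k => torusIntegral (W z k) 0 (fun _ => 2))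
      (torusIntegral (fun ζ => (∏ i, (ζ i - z i)⁻¹) * f ζ) 0 (fun _ => 2)) := by
    unfold torusIntegral
    refine hasSum_integral_of_dominated_convergence
      (bound := fun k _ => ‖∏ _i : Fin N, (2 : ℝ)‖ * ((∏ i : Fin N, (1 / 2 : ℝ) ^ (k i)) * C))
      (fun k => ?_) (fun k => ?_) ?_ ?_ ?_
    · refine Continuous.aestronglyMeasurable ?_
      have h1 : Continuous fun θ : Fin N → ℝ =>
          ∏ i, (((fun _ => 2 : Fin N → ℝ) i : ℂ) * Complex.exp (θ i * Complex.I) * Complex.I) :=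
        continuous_finsetProd _ fun i _ => by fun_prop
      exact h1.smul (hWc k)
    · refine ae_of_all _ fun θ => ?_
      rw [norm_smul]
      gcongr
      · simp [norm_prod]
      · exact hWb z hz k θ
    · exact ae_of_all _ fun θ => (hgeo.mul_right C).mul_left _
    · exact continuous_const.integrableOn_Icc
    · exact ae_of_all _ fun θ => (hsum θ).const_smul _
  rw [cauchy_torus f hf z (fun i => (hzi i).trans_lt (by norm_num))] at hmain
  have hWd : ∀ k, torusIntegral (W z k) 0 (fun _ => 2) = (∏ i, z i ^ k i) * d k := by
    intro k
    rw [hd, ← torusIntegral_const_mul]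
    congr 1
    ext ζ
    simp only [hW, Finset.prod_mul_distrib]
    simp [mul_assoc]
  simp only [hWd] at hmain
  have := hmain.mul_left ((2 * Real.pi * Complex.I) ^ N)⁻¹
  rw [← mul_assoc, inv_mul_cancel₀ hpi, one_mul] at this
  rw [← this.tsum_eq, pseries]
  congr 1
  ext k
  simp only [smul_eq_mul]
  ring

end CauchyTorus

/-! ### The Wiener algebra: absolutely summable power series under the `ℓ¹` norm. -/

section Wiener

variable (ι : Type*)

/-- The absolutely summable power series. -/
noncomputable def absSummable : Subalgebra ℂ (MvPowerSeries ι ℂ) where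
  carrier := {a | Summable fun k => ‖MvPowerSeries.coeff k a‖}
  mul_mem' {a b} ha hb := by
    classical
    have h := summable_sum_mul_antidiagonal_of_summable_mul (Summable.mul_of_nonneg ha hb
      (fun _ => norm_nonneg _) fun _ => norm_nonneg _)
    refine Summable.of_nonneg_of_le (fun _ => norm_nonneg _) (fun k => ?_) h
    rw [MvPowerSeries.coeff_mul]
    refine (norm_sum_le _ _).trans (Finset.sum_le_sum fun p _ => ?_)
    rw [norm_mul]
  add_mem' {a b} ha hb := by
    refine Summable.of_nonneg_of_le (fun _ => norm_nonneg _) (fun k => ?_) (ha.add hb)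
    rw [map_add]
    exact norm_add_le _ _
  algebraMap_mem' r := by
    classical
    refine summable_of_hasFiniteSupport ((Set.finite_singleton (0 : ι →₀ ℕ)).subset fun k hk => ?_)
    by_contra hne
    apply hk
    change ‖MvPowerSeries.coeff k (algebraMap ℂ (MvPowerSeries ι ℂ) r)‖ = 0
    rw [MvPowerSeries.algebraMap_apply, MvPowerSeries.coeff_C]
    simp [Set.mem_singleton_iff.not.1 hne]

/-- The Banach algebra of absolutely summable power series. -/
def Wiener : Type _ := absSummable ι

noncomputable instance : CommRing (Wiener ι) := inferInstanceAs (CommRing (absSummable ι))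
noncomputable instance : Algebra ℂ (Wiener ι) := inferInstanceAs (Algebra ℂ (absSummable ι))

variable {ι}

namespace Wiener

/-- The coefficients. -/
noncomputable def coeff (k : ι →₀ ℕ) : Wiener ι →ₗ[ℂ] ℂ :=
  (MvPowerSeries.coeff k).comp (absSummable ι).val.toLinearMap

theorem summable_coeff (a : Wiener ι) : Summable fun k => ‖coeff k a‖ := a.2

theorem ext_coeff {a b : Wiener ι} (h : ∀ k, coeff k a = coeff k b) : a = b :=
  Subtype.ext (MvPowerSeries.ext h)

/-- The series with given coefficients. -/
def ofCoeff (a : (ι →₀ ℕ) → ℂ) (ha : Summable fun k => ‖a k‖) : Wiener ι := ⟨a, ha⟩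

theorem coeff_one [DecidableEq ι] (k : ι →₀ ℕ) :
    coeff k (1 : Wiener ι) = if k = 0 then 1 else 0 :=
  MvPowerSeries.coeff_one k

theorem coeff_mul [DecidableEq ι] (k : ι →₀ ℕ) (a b : Wiener ι) :
    coeff k (a * b) = ∑ p ∈ Finset.HasAntidiagonal.antidiagonal k, coeff p.1 a * coeff p.2 b :=
  MvPowerSeries.coeff_mul k _ _

noncomputable instance : Norm (Wiener ι) := ⟨fun a => ∑' k, ‖coeff k a‖⟩

theorem norm_def (a : Wiener ι) : ‖a‖ = ∑' k, ‖coeff k a‖ := rfl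

theorem norm_coeff_le (k : ι →₀ ℕ) (a : Wiener ι) : ‖coeff k a‖ ≤ ‖a‖ :=
  (summable_coeff a).le_tsum k fun _ _ => norm_nonneg _

theorem normedSpaceCore : NormedSpace.Core ℂ (Wiener ι) where
  norm_nonneg a := tsum_nonneg fun _ => norm_nonneg _
  norm_smul c a := by
    simp only [norm_def, map_smul, norm_smul, tsum_mul_left]
  norm_triangle a b := by
    simp only [norm_def]
    rw [← (summable_coeff a).tsum_add (summable_coeff b)]
    refine (summable_coeff (a + b)).tsum_le_tsum (fun k => ?_)
      ((summable_coeff a).add (summable_coeff b))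
    rw [map_add]
    exact norm_add_le _ _
  norm_eq_zero_iff a := by
    constructor
    · intro h
      refine ext_coeff fun k => ?_
      rw [map_zero, ← norm_le_zero_iff, ← h]
      exact norm_coeff_le k a
    · rintro rfl
      simp [norm_def]

theorem norm_coeff_mul_le [DecidableEq ι] (a b : Wiener ι) (k : ι →₀ ℕ) : ‖coeff k (a * b)‖
    ≤ ∑ p ∈ Finset.HasAntidiagonal.antidiagonal k, ‖coeff p.1 a‖ * ‖coeff p.2 b‖ := by
  rw [coeff_mul]
  refine (norm_sum_le _ _).trans (Finset.sum_le_sum fun p _ => ?_)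
  rw [norm_mul]

theorem norm_mul_le' (a b : Wiener ι) : ‖a * b‖ ≤ ‖a‖ * ‖b‖ := by
  have : DecidableEq ι := Classical.decEq ι
  have hs := Summable.mul_of_nonneg (summable_coeff a) (summable_coeff b)
      (fun _ => norm_nonneg _) fun _ => norm_nonneg _
  have h1 := summable_sum_mul_antidiagonal_of_summable_mul (f := fun k => ‖coeff k a‖)
    (g := fun k => ‖coeff k b‖) hs
  have h2 := Summable.tsum_mul_tsum_eq_tsum_sum_antidiagonal (f := fun k => ‖coeff k a‖)
    (g := fun k => ‖coeff k b‖) (summable_coeff a) (summable_coeff b) hs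
  rw [norm_def, norm_def, norm_def, h2]
  exact (summable_coeff (a * b)).tsum_le_tsum (norm_coeff_mul_le a b) h1

noncomputable instance : NormedAddCommGroup (Wiener ι) := NormedAddCommGroup.ofCore normedSpaceCore

noncomputable instance : NormedCommRing (Wiener ι) :=
  { (inferInstance : NormedAddCommGroup (Wiener ι)), (inferInstance : CommRing (Wiener ι)) with
    norm_mul_le := norm_mul_le' }

noncomputable instance : NormedAlgebra ℂ (Wiener ι) :=
  { (inferInstance : Algebra ℂ (Wiener ι)) with
    norm_smul_le := fun c a => (normedSpaceCore.norm_smul c a).le }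

instance : NormOneClass (Wiener ι) where
  norm_one := by
    classical
    rw [norm_def, tsum_eq_single 0]
    · simp [coeff_one]
    · intro k hk
      simp [coeff_one, hk]

/-- The sequence of coefficients. -/
noncomputable def toLp : Wiener ι ≃ₗᵢ[ℂ] lp (fun _ : ι →₀ ℕ => ℂ) 1 where
  toFun a := ⟨fun k => coeff k a, memℓp_gen (by simpa using summable_coeff a)⟩
  invFun a := ofCoeff a (by simpa using (memℓp_gen_iff (by simp)).1 (lp.memℓp a))
  left_inv a := ext_coeff fun k => rfl
  right_inv a := rfl
  map_add' a b := by ext k; exact map_add _ _ _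
  map_smul' c a := by ext k; exact map_smul _ _ _
  norm_map' a := by
    rw [lp.norm_eq_tsum_rpow (by simp)]
    simp [norm_def]
    rfl

instance : CompleteSpace (Wiener ι) :=
  (completeSpace_congr (e := (toLp (ι := ι)).toEquiv) toLp.isometry.isUniformEmbedding).2 inferInstance

/-- The coefficients, as continuous functionals. -/
noncomputable def coeffL (k : ι →₀ ℕ) : Wiener ι →L[ℂ] ℂ :=
  (coeff k).mkContinuous 1 fun a => by simpa using norm_coeff_le k a

@[simp] theorem coeffL_apply (k : ι →₀ ℕ) (a : Wiener ι) : coeffL k a = coeff k a := rfl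

/-- The monomials at a point. -/
noncomputable def mono (x : ι → ℂ) (k : ι →₀ ℕ) : ℂ := k.prod fun i n => x i ^ n

theorem mono_add (x : ι → ℂ) (k l : ι →₀ ℕ) : mono x (k + l) = mono x k * mono x l :=
  Finsupp.prod_add_index' (by simp) (fun i m n => pow_add _ _ _)

@[simp] theorem mono_zero (x : ι → ℂ) : mono x 0 = 1 := Finsupp.prod_zero_index

theorem norm_mono_le {x : ι → ℂ} (hx : ∀ i, ‖x i‖ ≤ 1) (k : ι →₀ ℕ) : ‖mono x k‖ ≤ 1 := by
  rw [mono, Finsupp.prod, norm_prod]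
  refine Finset.prod_le_one (fun _ _ => norm_nonneg _) fun i _ => ?_
  rw [norm_pow]
  exact pow_le_one₀ (norm_nonneg _) (hx i)

theorem summable_eval {x : ι → ℂ} (hx : ∀ i, ‖x i‖ ≤ 1) (a : Wiener ι) :
    Summable fun k => coeff k a * mono x k := by
  refine Summable.of_norm_bounded (summable_coeff a) fun k => ?_
  rw [norm_mul]
  exact mul_le_of_le_one_right (norm_nonneg _) (norm_mono_le hx k)

theorem summable_norm_eval {x : ι → ℂ} (hx : ∀ i, ‖x i‖ ≤ 1) (a : Wiener ι) :
    Summable fun k => ‖coeff k a * mono x k‖ := by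
  refine Summable.of_nonneg_of_le (fun _ => norm_nonneg _) (fun k => ?_) (summable_coeff a)
  rw [norm_mul]
  exact mul_le_of_le_one_right (norm_nonneg _) (norm_mono_le hx k)

theorem tsum_eval_one (x : ι → ℂ) : ∑' k, coeff k (1 : Wiener ι) * mono x k = 1 := by
  have : DecidableEq ι := Classical.decEq ι
  rw [tsum_eq_single 0]
  · simp [coeff_one]
  · intro k hk
    simp [coeff_one, hk]

theorem tsum_eval_mul {x : ι → ℂ} (hx : ∀ i, ‖x i‖ ≤ 1) (a b : Wiener ι) :
    ∑' k, coeff k (a * b) * mono x k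
      = (∑' k, coeff k a * mono x k) * ∑' k, coeff k b * mono x k := by
  have : DecidableEq ι := Classical.decEq ι
  have hs := summable_mul_of_summable_norm (summable_norm_eval hx a) (summable_norm_eval hx b)
  have h := Summable.tsum_mul_tsum_eq_tsum_sum_antidiagonal (f := fun k => coeff k a * mono x k)
    (g := fun k => coeff k b * mono x k) (summable_eval hx a) (summable_eval hx b) hs
  rw [h]
  refine tsum_congr fun k => ?_
  rw [coeff_mul, Finset.sum_mul]
  refine Finset.sum_congr rfl fun p hp => ?_
  rw [← Finset.HasAntidiagonal.mem_antidiagonal.1 hp, mono_add]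
  ring

theorem norm_tsum_eval_le {x : ι → ℂ} (hx : ∀ i, ‖x i‖ ≤ 1) (a : Wiener ι) :
    ‖∑' k, coeff k a * mono x k‖ ≤ ‖a‖ := by
  refine (norm_tsum_le_tsum_norm (summable_norm_eval hx a)).trans ?_
  refine (summable_norm_eval hx a).tsum_le_tsum (fun k => ?_) (summable_coeff a)
  rw [norm_mul]
  exact mul_le_of_le_one_right (norm_nonneg _) (norm_mono_le hx k)

/-- Evaluation at a point of the closed unit polydisc, as a linear map. -/
noncomputable def evalLin (x : ι → ℂ) (hx : ∀ i, ‖x i‖ ≤ 1) : Wiener ι →ₗ[ℂ] ℂ where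
  toFun := fun a => ∑' k, coeff k a * mono x k
  map_add' := fun a b => by
    rw [← (summable_eval hx a).tsum_add (summable_eval hx b)]
    simp [add_mul]
  map_smul' := fun c a => by
    simp [mul_assoc, tsum_mul_left]

/-- Evaluation at a point of the closed unit polydisc. -/
noncomputable def eval (x : ι → ℂ) (hx : ∀ i, ‖x i‖ ≤ 1) : Wiener ι →A[ℂ] ℂ where
  toAlgHom := AlgHom.ofLinearMap (evalLin x hx) (tsum_eval_one x) (tsum_eval_mul hx)
  cont := ((evalLin x hx).mkContinuous 1 fun a => by
      rw [one_mul]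
      exact norm_tsum_eval_le hx a).continuous

theorem eval_apply (x : ι → ℂ) (hx : ∀ i, ‖x i‖ ≤ 1) (a : Wiener ι) :
    eval x hx a = ∑' k, coeff k a * mono x k := rfl

theorem norm_eval_le (x : ι → ℂ) (hx : ∀ i, ‖x i‖ ≤ 1) (a : Wiener ι) : ‖eval x hx a‖ ≤ ‖a‖ :=
  norm_tsum_eval_le hx a

variable {N : ℕ}

/-- The vector of the coefficients of order `k`. -/
noncomputable def vcoeff (k : ι →₀ ℕ) : (Fin N → Wiener ι) →L[ℂ] (Fin N → ℂ) :=
  ContinuousLinearMap.pi fun i => (coeffL k).comp (ContinuousLinearMap.proj i)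

@[simp] theorem vcoeff_apply (k : ι →₀ ℕ) (u : Fin N → Wiener ι) (i : Fin N) :
    vcoeff k u i = coeff k (u i) := rfl

theorem ext_vcoeff {u w : Fin N → Wiener ι} (h : ∀ k, vcoeff k u = vcoeff k w) : u = w :=
  funext fun i => ext_coeff fun k => congrFun (h k) i

theorem sum_norm_coeff_le (u : Fin N → Wiener ι) : ∑ i, ‖u i‖ ≤ N * ‖u‖ := by
  refine (Finset.sum_le_sum fun i _ => norm_le_pi_norm u i).trans ?_
  simp

theorem norm_vcoeff_le_sum (k : ι →₀ ℕ) (u : Fin N → Wiener ι) :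
    ‖vcoeff k u‖ ≤ ∑ i, ‖coeff k (u i)‖ := by
  refine (pi_norm_le_iff_of_nonneg (Finset.sum_nonneg fun _ _ => norm_nonneg _)).2 fun i => ?_
  exact Finset.single_le_sum (f := fun i => ‖coeff k (u i)‖) (fun _ _ => norm_nonneg _)
    (Finset.mem_univ i)

theorem summable_vcoeff (u : Fin N → Wiener ι) : Summable fun k => ‖vcoeff k u‖ :=
  Summable.of_nonneg_of_le (fun _ => norm_nonneg _) (fun k => norm_vcoeff_le_sum k u)
    (summable_sum fun i _ => summable_coeff (u i))

theorem tsum_norm_vcoeff_le (u : Fin N → Wiener ι) : ∑' k, ‖vcoeff k u‖ ≤ N * ‖u‖ := by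
  refine ((summable_vcoeff u).tsum_le_tsum (fun k => norm_vcoeff_le_sum k u)
    (summable_sum fun i _ => summable_coeff (u i))).trans ?_
  rw [Summable.tsum_finsetSum fun i _ => summable_coeff (u i)]
  exact sum_norm_coeff_le u

/-- The series with given vectors of coefficients. -/
noncomputable def ofVCoeff (a : (ι →₀ ℕ) → Fin N → ℂ) (ha : Summable fun k => ‖a k‖) :
    Fin N → Wiener ι :=
  fun i => ofCoeff (fun k => a k i)
    (Summable.of_nonneg_of_le (fun _ => norm_nonneg _) (fun k => norm_le_pi_norm (a k) i) ha)

@[simp] theorem vcoeff_ofVCoeff (a : (ι →₀ ℕ) → Fin N → ℂ) (ha : Summable fun k => ‖a k‖)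
    (k : ι →₀ ℕ) : vcoeff k (ofVCoeff a ha) = a k := rfl

theorem norm_ofVCoeff_le (a : (ι →₀ ℕ) → Fin N → ℂ) (ha : Summable fun k => ‖a k‖) :
    ‖ofVCoeff a ha‖ ≤ ∑' k, ‖a k‖ := by
  refine (pi_norm_le_iff_of_nonneg (tsum_nonneg fun _ => norm_nonneg _)).2 fun i => ?_
  rw [norm_def]
  exact (summable_coeff _).tsum_le_tsum (fun k => norm_le_pi_norm (a k) i) ha

/-- The operator which acts on the coefficients by `R`, and which is composed with the
re-indexing `s` of the coefficients. -/
theorem exists_multiplier (R : (ι →₀ ℕ) → (Fin N → ℂ) →ₗ[ℂ] (Fin N → ℂ)) (s : (ι →₀ ℕ) → (ι →₀ ℕ))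
    (C : ℝ) (hR : ∀ k z, ‖R k z‖ ≤ C * ‖z‖)
    (hs : ∀ k l, s k = s l → R k ≠ 0 → R l ≠ 0 → k = l) :
    ∃ L : (Fin N → Wiener ι) →L[ℂ] (Fin N → Wiener ι),
      ∀ u k, vcoeff k (L u) = R k (vcoeff (s k) u) := by
  -- Only indices with `R k ≠ 0` contribute, and `s` is injective on them. Each coefficient of `u`
  -- is thus used at most once, so the re-indexed sum is dominated by the full `ℓ¹` sum.
  -- Non-injectivity elsewhere is harmless, which matters for a truncated shift.
  set K := {k // R k ≠ 0} with hK
  have hinj : Function.Injective fun k : K => s k := fun k l h => Subtype.ext (hs _ _ h k.2 l.2)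
  have hsupp : ∀ u : Fin N → Wiener ι,
      (Function.support fun k => ‖R k (vcoeff (s k) u)‖) ⊆ {k | R k ≠ 0} := by
    intro u k hk h0
    apply hk
    simp [h0]
  have hle : ∀ (u : Fin N → Wiener ι) (k : K),
      ‖R k (vcoeff (s k) u)‖ ≤ C * ‖vcoeff (s k) u‖ := fun u k => hR _ _
  have hsk : ∀ u : Fin N → Wiener ι, Summable fun k : K => C * ‖vcoeff (s k) u‖ := fun u =>
    ((summable_vcoeff u).comp_injective hinj).mul_left C
  have hsum : ∀ u : Fin N → Wiener ι, Summable fun k => ‖R k (vcoeff (s k) u)‖ := by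
    intro u
    have h1 : Summable ((fun k => ‖R k (vcoeff (s k) u)‖) ∘ ((↑) : K → ι →₀ ℕ)) := Summable.of_nonneg_of_le (fun _ => norm_nonneg _) (hle u) (hsk u)
    have h2 := summable_subtype_iff_indicator.1 h1
    exact (Set.indicator_eq_self.2 (hsupp u)) ▸ h2
  have hbound : ∀ u : Fin N → Wiener ι,
      ‖ofVCoeff (fun k => R k (vcoeff (s k) u)) (hsum u)‖ ≤ |C| * N * ‖u‖ := by
    intro u
    refine (norm_ofVCoeff_le _ (hsum u)).trans ?_
    rw [← tsum_subtype_eq_of_support_subset (hsupp u)]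
    have h0 := (summable_vcoeff u).comp_injective hinj
    have h1 : ∑' k : K, ‖vcoeff (s k) u‖ ≤ N * ‖u‖ := by
      refine le_trans ?_ (tsum_norm_vcoeff_le u)
      exact h0.tsum_le_tsum_of_inj (fun k : K => s k) hinj (fun _ _ => norm_nonneg _)
        (fun _ => le_refl _) (summable_vcoeff u)
    have h4 := Summable.of_nonneg_of_le (fun _ => norm_nonneg _) (hle u) (hsk u)
    have h2 := h4.tsum_le_tsum (hle u) (hsk u)
    rw [tsum_mul_left] at h2
    have h3 : 0 ≤ ∑' k : K, ‖vcoeff (s k) u‖ := tsum_nonneg fun _ => norm_nonneg _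
    calc _ ≤ C * ∑' k : K, ‖vcoeff (s k) u‖ := h2
      _ ≤ |C| * ∑' k : K, ‖vcoeff (s k) u‖ := mul_le_mul_of_nonneg_right (le_abs_self C) h3
      _ ≤ |C| * (N * ‖u‖) := mul_le_mul_of_nonneg_left h1 (abs_nonneg C)
      _ = _ := by ring
  let L : (Fin N → Wiener ι) →ₗ[ℂ] (Fin N → Wiener ι) :=
    { toFun := fun u => ofVCoeff (fun k => R k (vcoeff (s k) u)) (hsum u)
      map_add' := fun u w => ext_vcoeff fun k => by simp
      map_smul' := fun c u => ext_vcoeff fun k => by simp }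
  exact ⟨L.mkContinuous (|C| * N) hbound, fun u k => rfl⟩

/-- Evaluation, as a map into `ℂ^N`. -/
noncomputable def veval (x : ι → ℂ) (hx : ∀ i, ‖x i‖ ≤ 1) :
    (Fin N → Wiener ι) →L[ℂ] (Fin N → ℂ) :=
  LinearMap.mkContinuous
    { toFun := fun u i => eval x hx (u i)
      map_add' := fun u w => by ext i; simp
      map_smul' := fun c u => by ext i; simp } 1 fun u => by
    rw [one_mul]
    exact (pi_norm_le_iff_of_nonneg (norm_nonneg _)).2 fun i =>
      (norm_eval_le x hx _).trans (norm_le_pi_norm u i)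

theorem norm_veval_le (x : ι → ℂ) (hx : ∀ i, ‖x i‖ ≤ 1) (u : Fin N → Wiener ι) :
    ‖veval x hx u‖ ≤ ‖u‖ :=
  (pi_norm_le_iff_of_nonneg (norm_nonneg _)).2 fun i =>
      (norm_eval_le x hx _).trans (norm_le_pi_norm u i)

theorem hasSum_veval (x : ι → ℂ) (hx : ∀ i, ‖x i‖ ≤ 1) (u : Fin N → Wiener ι) :
    HasSum (fun k => mono x k • vcoeff k u) (veval x hx u) := by
  rw [Pi.hasSum]
  intro i
  have h := (summable_eval hx (u i)).hasSum
  rw [← eval_apply x hx] at h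
  exact h.congr_fun fun k => mul_comm _ _

end Wiener

end Wiener

/-! ### Substitution of Wiener series into an entire vector field. -/

section Superposition

variable {N : ℕ}

theorem pseries_zero {𝒜 : Type*} [NormedCommRing 𝒜] [NormedAlgebra ℂ 𝒜]
    (c : (Fin N → ℕ) → ℂ) : pseries c (0 : Fin N → 𝒜) = algebraMap ℂ 𝒜 (c 0) := by
  rw [pseries, tsum_eq_single 0]
  · simp [Algebra.algebraMap_eq_smul_one]
  · intro k hk
    obtain ⟨i, hi⟩ : ∃ i, k i ≠ 0 := by
      by_contra! h
      exact hk (funext h)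
    rw [Finset.prod_eq_zero (Finset.mem_univ i) (by simp [hi]), smul_zero]

/-- The superposition operator of a vector of power series. -/
noncomputable def superpose {𝒜 : Type*} [NormedCommRing 𝒜] [NormedAlgebra ℂ 𝒜]
    (c : Fin N → (Fin N → ℕ) → ℂ) (u : Fin N → 𝒜) : Fin N → 𝒜 := fun i => pseries (c i) u

/-- The linear part of a vector of power series. -/
noncomputable def superposeLin (𝒜 : Type*) [NormedCommRing 𝒜] [NormedAlgebra ℂ 𝒜]
    (c : Fin N → (Fin N → ℕ) → ℂ) : (Fin N → 𝒜) →L[ℂ] (Fin N → 𝒜) :=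
  ContinuousLinearMap.pi fun i => linearPart 𝒜 (c i)

theorem hasStrictFDerivAt_superpose {𝒜 : Type*} [NormedCommRing 𝒜] [NormedAlgebra ℂ 𝒜]
    [CompleteSpace 𝒜] [NormOneClass 𝒜] {c : Fin N → (Fin N → ℕ) → ℂ}
    (hc : ∀ i, Summable fun k => ‖c i k‖) :
    HasStrictFDerivAt (superpose c) (superposeLin 𝒜 c) (0 : Fin N → 𝒜) :=
  hasStrictFDerivAt_pi.2 fun i => hasStrictFDerivAt_pseries (hc i)

/-- `c` is the vector of the power series of `f` at `z₀`. -/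
structure IsExpansion (f : Phase N → Phase N) (z₀ : Phase N)
    (c : Fin N → (Fin N → ℕ) → ℂ) : Prop where
  summable : ∀ i, Summable fun k => ‖c i k‖
  eq : ∀ z, ‖z‖ ≤ 1 → f (z₀ + z) = superpose c z

theorem exists_isExpansion {f : Phase N → Phase N} (hf : Differentiable ℂ f) (z₀ : Phase N) :
    ∃ c, IsExpansion f z₀ c := by
  have h : ∀ i, Differentiable ℂ fun z => f (z₀ + z) i := fun i =>
    (differentiable_pi.1 hf i).comp (differentiable_id.const_add z₀)
  choose c hc1 hc2 using fun i => exists_pseries_eq _ (h i)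
  exact ⟨c, hc1, fun z hz => funext fun i => hc2 i z hz⟩

namespace IsExpansion

variable {f : Phase N → Phase N} {z₀ : Phase N} {c : Fin N → (Fin N → ℕ) → ℂ}

theorem hasStrictFDerivAt (h : IsExpansion f z₀ c) :
    HasStrictFDerivAt f (superposeLin ℂ c) z₀ := by
  have h1 : HasStrictFDerivAt (superpose c) (superposeLin ℂ c) (z₀ - z₀) := by
    rw [sub_self]; exact hasStrictFDerivAt_superpose h.summable
  have h2 : HasStrictFDerivAt (fun z => superpose c (z - z₀)) (superposeLin ℂ c) z₀ := by
    exact HasStrictFDerivAt.comp (f := fun z => z - z₀) z₀ h1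
      ((hasStrictFDerivAt_id z₀).sub_const z₀)
  refine h2.congr_of_eventuallyEq ?_
  filter_upwards [Metric.closedBall_mem_nhds z₀ one_pos] with z hz
  rw [← h.eq _ (by rwa [← dist_eq_norm])]
  simp

theorem fderiv_eq (h : IsExpansion f z₀ c) : fderiv ℂ f z₀ = superposeLin ℂ c :=
  h.hasStrictFDerivAt.hasFDerivAt.fderiv

variable {ι : Type*}

open Wiener

theorem vcoeff_superposeLin (h : IsExpansion f z₀ c) (u : Fin N → Wiener ι) (k : ι →₀ ℕ) :
    vcoeff k (superposeLin (Wiener ι) c u) = fderiv ℂ f z₀ (vcoeff k u) := by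
  rw [h.fderiv_eq]
  ext i
  rw [vcoeff_apply]
  change coeffL k (linearPart (Wiener ι) (c i) u) = linearPart ℂ (c i) (vcoeff k u)
  simp [linearPart, sum_apply]

/-- Evaluation is a character, so it passes through the power series; the bound `‖u‖ ≤ 1` keeps the
evaluated point where the expansion represents `f`. -/
theorem veval_superpose (h : IsExpansion f z₀ c) {u : Fin N → Wiener ι} (hu : ‖u‖ ≤ 1)
    (x : ι → ℂ) (hx : ∀ i, ‖x i‖ ≤ 1) :
    veval x hx (superpose c u) = f (z₀ + veval x hx u) := by
  rw [h.eq _ ((norm_veval_le x hx u).trans hu)]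
  ext i
  exact map_pseries (h.summable i) u hu (eval x hx)

theorem superpose_zero_vcoeff (h : IsExpansion f z₀ c) (hf0 : f z₀ = 0) :
    superpose c (0 : Fin N → Wiener ι) = 0 := by
  have h0 := h.eq 0 (by simp)
  rw [add_zero, hf0] at h0
  ext i
  have := congrFun h0 i
  simp only [superpose, pseries_zero] at this ⊢
  rw [← show (0 : ℂ) = c i 0 from this]
  simp

/-- On the axis `x = s e_j` every monomial that is not a pure power of `x_j` vanishes, and the pure
powers of order at least two are at most `|s|²`. Consequently first-order coefficients are
derivatives of evaluations along the axes. -/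
theorem _root_.ConnectingOrbit.Wiener.norm_veval_single_sub_le [DecidableEq ι]
    (u : Fin N → Wiener ι) (j : ι) (s : ℂ)
    (hs : ‖s‖ ≤ 1) (hx : ∀ i, ‖(Pi.single j s : ι → ℂ) i‖ ≤ 1) :
    ‖veval (Pi.single j s) hx u - vcoeff 0 u - s • vcoeff (Finsupp.single j 1) u‖
      ≤ ‖s‖ ^ 2 * (N * ‖u‖) := by
  have hne : (Finsupp.single j 1 : ι →₀ ℕ) ≠ 0 := by simp
  have h0 : HasSum (fun k => (if k = 0 then (1 : ℂ) else 0) • vcoeff k u) (vcoeff 0 u) := by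
    have := hasSum_ite_eq (0 : ι →₀ ℕ) (vcoeff 0 u)
    refine this.congr_fun fun k => ?_
    split_ifs with hk <;> simp [hk]
  have h1 : HasSum (fun k => (if k = Finsupp.single j 1 then s else 0) • vcoeff k u)
      (s • vcoeff (Finsupp.single j 1) u) := by
    have := hasSum_ite_eq (Finsupp.single j 1 : ι →₀ ℕ) (s • vcoeff (Finsupp.single j 1) u)
    refine this.congr_fun fun k => ?_
    split_ifs with hk <;> simp [hk]
  have h2 := ((hasSum_veval (Pi.single j s) hx u).sub h0).sub h1
  simp only [← sub_smul] at h2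
  rw [← h2.tsum_eq]
  have hb : ∀ k : ι →₀ ℕ, ‖(mono (Pi.single j s) k - (if k = 0 then (1 : ℂ) else 0)
      - (if k = Finsupp.single j 1 then s else 0)) • vcoeff k u‖ ≤ ‖s‖ ^ 2 * ‖vcoeff k u‖ := by
    intro k
    rw [norm_smul]
    gcongr
    by_cases hk0 : k = 0
    · subst hk0
      simp [hne.symm]
    by_cases hk1 : k = Finsupp.single j 1
    · subst hk1
      simp [mono]
    rw [if_neg hk0, if_neg hk1, sub_zero, sub_zero]
    by_cases hj : k = Finsupp.single j (k j)
    · have hk2 : 2 ≤ k j := by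
        rcases Nat.lt_or_ge (k j) 2 with h | h
        · interval_cases hkj : k j
          · simp at hj; exact absurd hj hk0
          · exact absurd hj hk1
        · exact h
      rw [hj, mono, Finsupp.prod_single_index (by simp), norm_pow]
      simp only [Pi.single_eq_same]
      exact pow_le_pow_of_le_one (norm_nonneg _) hs hk2
    · obtain ⟨i, hij, hi⟩ : ∃ i, i ≠ j ∧ k i ≠ 0 := by
        by_contra! hcon
        apply hj
        ext i
        by_cases hi : i = j
        · subst hi; simp
        · rw [hcon i hi, Finsupp.single_apply, if_neg (Ne.symm hi)]
      rw [mono, Finsupp.prod, Finset.prod_eq_zero (Finsupp.mem_support_iff.2 hi)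
        (by simp [hij, hi])]
      simp
  refine (tsum_of_norm_bounded ((summable_vcoeff u).hasSum.mul_left _) hb).trans ?_
  gcongr
  exact tsum_norm_vcoeff_le u

theorem vcoeff_superpose_zero (h : IsExpansion f z₀ c) {u : Fin N → Wiener ι} (hu : ‖u‖ ≤ 1) :
    vcoeff 0 (superpose c u) = f (z₀ + vcoeff 0 u) := by
  classical
  have h0 : ∀ i : ι, ‖(0 : ι → ℂ) i‖ ≤ 1 := by simp
  have h1 : ∀ u : Fin N → Wiener ι, veval 0 h0 u = vcoeff 0 u := by
    intro u
    refine (hasSum_veval 0 h0 u).unique ?_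
    have := hasSum_ite_eq (0 : ι →₀ ℕ) (vcoeff 0 u)
    refine this.congr_fun fun k => ?_
    split_ifs with hk
    · simp [hk]
    · obtain ⟨i, hi⟩ : ∃ i, k i ≠ 0 := by
        by_contra! hcon
        exact hk (Finsupp.ext hcon)
      rw [mono, Finsupp.prod, Finset.prod_eq_zero (Finsupp.mem_support_iff.2 hi) (by simp [hi]),
        zero_smul]
  rw [← h1, ← h1, h.veval_superpose hu]

/-- Both sides are the derivative at `s = 0` of `f(z₀ + u(s e_j))`: the left through the evaluation
of the superposition, the right through the chain rule. -/
theorem vcoeff_superpose_single (h : IsExpansion f z₀ c) (hf : Differentiable ℂ f)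
    {u : Fin N → Wiener ι} (hu : ‖u‖ ≤ 1) (hu0 : vcoeff 0 u = 0) (j : ι) :
    vcoeff (Finsupp.single j 1) (superpose c u)
      = fderiv ℂ f z₀ (vcoeff (Finsupp.single j 1) u) := by
  classical
  -- Evaluation carries a proof that the point lies in the closed polydisc. The cut-off makes it
  -- defined for every `s` without changing it near `0`.
  set r : ℂ → ℂ := fun s => if ‖s‖ ≤ 1 then s else 0 with hr
  have hr1 : ∀ s i, ‖(Pi.single j (r s) : ι → ℂ) i‖ ≤ 1 := by
    intro s i
    by_cases hi : i = j
    · subst hi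
      simp only [Pi.single_eq_same, hr]
      split_ifs with hs
      · exact hs
      · simp
    · simp [hi]
  obtain ⟨e, he⟩ : ∃ e : ℂ → (Fin N → Wiener ι) →L[ℂ] (Fin N → ℂ),
      ∀ s, e s = veval (Pi.single j (r s)) (hr1 s) := ⟨_, fun _ => rfl⟩
  have hr0 : r 0 = 0 := by simp [hr]
  have key : ∀ s w, ‖s‖ ≤ 1 → ‖e s w - vcoeff 0 w - s • vcoeff (Finsupp.single j 1) w‖
      ≤ ‖s‖ ^ 2 * (N * ‖w‖) := by
    intro s w hs
    have hrs : r s = s := by simp [hr, hs]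
    have := norm_veval_single_sub_le w j (r s) (by rwa [hrs]) (hr1 s)
    rw [← he] at this
    rwa [hrs] at this
  have hz : ∀ w, e 0 w = vcoeff 0 w := by
    intro w
    have := key 0 w (by simp)
    rw [← sub_eq_zero, ← norm_le_zero_iff]
    simpa using this
  have hd : ∀ w : Fin N → Wiener ι, HasDerivAt (fun s => e s w)
      (vcoeff (Finsupp.single j 1) w) 0 := by
    intro w
    rw [hasDerivAt_iff_isLittleO_nhds_zero]
    refine Asymptotics.IsBigO.trans_isLittleO (g := fun s : ℂ => ‖s‖ ^ 2) ?_ ?_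
    · refine Asymptotics.IsBigO.of_bound (N * ‖w‖) ?_
      filter_upwards [Metric.closedBall_mem_nhds (0 : ℂ) one_pos] with s hs
      rw [mem_closedBall_zero_iff] at hs
      have := key s w hs
      rw [zero_add, hz]
      simp only [norm_pow, norm_norm]
      linarith
    · simpa using (Asymptotics.isLittleO_pow_id (𝕜 := ℂ) (n := 2) (by norm_num)).norm_left
  have h1 := hd (superpose c u)
  have h2 : HasDerivAt (fun s => f (z₀ + e s u))
      (fderiv ℂ f z₀ (vcoeff (Finsupp.single j 1) u)) 0 := by
    have h3 := (hd u).const_add z₀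
    have h4 : z₀ + e 0 u = z₀ := by rw [hz, hu0, add_zero]
    exact HasFDerivAt.comp_hasDerivAt_of_eq 0 (hf z₀).hasFDerivAt h3 h4.symm
  refine h1.unique (h2.congr_of_eventuallyEq (Eventually.of_forall fun s => ?_))
  change e s (superpose c u) = f (z₀ + e s u)
  rw [he]
  exact h.veval_superpose hu _ _

end IsExpansion

end Superposition

/-- Since `Q` has vanishing derivative at `0`, the map `u ↦ u - M (Q u)` has the identity as strict
derivative there; the inverse function theorem makes it open at `0`. It serves both the Dirichlet
series and local existence in complex time. -/
theorem eventually_solvable {E : Type*} [NormedAddCommGroup E] [NormedSpace ℂ E] [CompleteSpace E]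
    (M : E →L[ℂ] E) {Q : E → E} (hQ : HasStrictFDerivAt Q (0 : E →L[ℂ] E) 0) (hQ0 : Q 0 = 0)
    {U : Set E} (hU : U ∈ 𝓝 0) : ∀ᶠ y in 𝓝 0, ∃ u ∈ U, u - M (Q u) = y := by
  have h : HasStrictFDerivAt (fun u => u - M (Q u))
      ((ContinuousLinearEquiv.refl ℂ E : E ≃L[ℂ] E) : E →L[ℂ] E) 0 := by
    have := (hasStrictFDerivAt_id (0 : E)).sub (M.hasStrictFDerivAt.comp 0 hQ)
    refine this.congr_fderiv ?_
    ext x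
    simp
  have h2 := h.map_nhds_eq_of_equiv
  simp only [hQ0, map_zero, sub_zero] at h2
  have h3 : (fun u => u - M (Q u)) '' U ∈ 𝓝 (0 : E) := by
    rw [← h2]
    exact image_mem_map hU
  filter_upwards [h3] with y hy
  exact hy

/-! ### Poincaré's series: solutions as convergent Dirichlet series. -/

section Series

variable {N : ℕ} {ι : Type*} [Fintype ι]

open Wiener

/-- The frequency `∑ k_j λ_j`. -/
def wt (lam : ι → ℝ) (k : ι →₀ ℕ) : ℝ := ∑ j, (k j : ℝ) * lam j

@[simp] theorem wt_zero (lam : ι → ℝ) : wt lam 0 = 0 := by simp [wt]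

@[simp] theorem wt_single [DecidableEq ι] (lam : ι → ℝ) (j : ι) :
    wt lam (Finsupp.single j 1) = lam j := by
  rw [wt, Finset.sum_eq_single j]
  · simp
  · intro i _ hi; simp [Ne.symm hi]
  · simp

theorem wt_nonneg {lam : ι → ℝ} (hlam : ∀ j, 0 < lam j) (k : ι →₀ ℕ) : 0 ≤ wt lam k :=
  Finset.sum_nonneg fun j _ => mul_nonneg (Nat.cast_nonneg _) (hlam j).le

theorem exists_pos_le_of_finite {ι : Type*} [Finite ι] (r : ι → ℝ) (hr : ∀ i, 0 < r i) :
    ∃ δ > 0, ∀ i, δ ≤ r i := by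
  rcases isEmpty_or_nonempty ι with h | h
  · exact ⟨1, one_pos, fun i => isEmptyElim i⟩
  · obtain ⟨i, hi⟩ := Finite.exists_min r
    exact ⟨r i, hr i, hi⟩

/-- With all `λ_j ≥ δ > 0` the frequency is at least `δ` times the degree. This is the absence of
small divisors: only finitely many frequencies are comparable to the norm of the linearization. -/
theorem finite_wt_lt {lam : ι → ℝ} (hlam : ∀ j, 0 < lam j) (B : ℝ) :
    {k : ι →₀ ℕ | wt lam k < B}.Finite := by
  obtain ⟨δ, hδ, hle⟩ := exists_pos_le_of_finite lam hlam
  obtain ⟨n, hn⟩ := exists_nat_gt (B / δ)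
  refine (Finsupp.finite_of_degree_le n).subset fun k hk => ?_
  have h1 : δ * (k.degree : ℝ) ≤ wt lam k := by
    rw [wt, Finsupp.degree_eq_sum]
    push_cast
    rw [Finset.mul_sum]
    exact Finset.sum_le_sum fun j _ => by nlinarith [hle j, Nat.cast_nonneg (α := ℝ) (k j)]
  have h2 : (k.degree : ℝ) < n := by
    refine lt_of_le_of_lt ?_ hn
    rw [le_div_iff₀ hδ]
    have : wt lam k < B := hk
    linarith
  exact_mod_cast h2.le

/-- Inverses of `∑ k_j λ_j - A` are uniformly bounded. -/
theorem exists_bounded_resolvent {lam : ι → ℝ} (hlam : ∀ j, 0 < lam j) (A : Phase N →L[ℂ] Phase N)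
    (S : Set (ι →₀ ℕ)) (hS : ∀ k ∈ S, ∀ z, A z = (wt lam k : ℂ) • z → z = 0) :
    ∃ (R : (ι →₀ ℕ) → Phase N →ₗ[ℂ] Phase N) (C : ℝ), (∀ k z, ‖R k z‖ ≤ C * ‖z‖) ∧
      (∀ k ∈ S, ∀ z, (wt lam k : ℂ) • R k z - A (R k z) = z) ∧ ∀ k ∉ S, R k = 0 := by
  classical
  have hex : ∀ k, ∃ R : Phase N →ₗ[ℂ] Phase N,
      (k ∈ S → ∀ z, (wt lam k : ℂ) • R z - A (R z) = z) ∧ (k ∉ S → R = 0) := by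
    intro k
    by_cases hk : k ∈ S
    · set T : Phase N →ₗ[ℂ] Phase N := (wt lam k : ℂ) • LinearMap.id - (A : Phase N →ₗ[ℂ] Phase N)
        with hT
      have hinj : Function.Injective T := by
        rw [← LinearMap.ker_eq_bot, LinearMap.ker_eq_bot']
        intro z hz
        refine hS k hk z ?_
        simp only [hT, LinearMap.sub_apply, LinearMap.smul_apply, LinearMap.id_apply,
          ContinuousLinearMap.coe_coe] at hz
        exact (sub_eq_zero.1 hz).symm
      refine ⟨(LinearEquiv.ofInjectiveEndo T hinj).symm, fun _ z => ?_, fun h => absurd hk h⟩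
      have := (LinearEquiv.ofInjectiveEndo T hinj).apply_symm_apply z
      exact this
    · exact ⟨0, fun h => absurd h hk, fun _ => rfl⟩
  choose R hR1 hR2 using hex
  have hb1 : ∀ k, ∃ C, 0 ≤ C ∧ ∀ z, ‖R k z‖ ≤ C * ‖z‖ := fun k =>
    ⟨‖LinearMap.toContinuousLinearMap (R k)‖, norm_nonneg _, fun z =>
      (LinearMap.toContinuousLinearMap (R k)).le_opNorm z⟩
  choose C hC0 hC using hb1
  -- Once the frequency is at least `‖A‖ + 1`, the resolvent has norm at most one. The finitely many
  -- remaining indices are covered by the sum of their individual bounds.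
  have hfin := finite_wt_lt hlam (‖A‖ + 1)
  refine ⟨R, 1 + ∑ k ∈ hfin.toFinset, C k, fun k z => ?_, fun k hk => hR1 k hk,
    fun k hk => hR2 k hk⟩
  have hsum0 : 0 ≤ ∑ k ∈ hfin.toFinset, C k := Finset.sum_nonneg fun k _ => hC0 k
  by_cases hk : wt lam k < ‖A‖ + 1
  · refine (hC k z).trans ?_
    gcongr
    have := Finset.single_le_sum (f := C) (fun k _ => hC0 k)
      (show k ∈ hfin.toFinset by simpa using hk)
    linarith
  · by_cases hkS : k ∈ S
    · have h1 : ‖R k z‖ ≤ ‖z‖ := by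
        have h2 := hR1 k hkS z
        have h3 : ‖(wt lam k : ℂ) • R k z‖ - ‖A (R k z)‖ ≤ ‖z‖ := by
          exact (norm_sub_norm_le _ _).trans_eq (by rw [h2])
        rw [norm_smul, Complex.norm_real, Real.norm_eq_abs, abs_of_nonneg (wt_nonneg hlam k)] at h3
        have h4 := A.le_opNorm (R k z)
        nlinarith [norm_nonneg (R k z)]
      refine h1.trans ?_
      nlinarith [norm_nonneg z]
    · rw [hR2 k hkS]
      simp only [LinearMap.zero_apply, norm_zero]
      positivity

/-- A generalized Dirichlet series. -/
noncomputable def dirichlet (lam : ι → ℝ) (z₀ : Phase N) (a : (ι →₀ ℕ) → Phase N) (t : ℂ) :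
    Phase N := z₀ + ∑' k, Complex.exp (wt lam k * t) • a k

/-- The substitution `x_j = e^{λ_j t}` turns monomials into exponentials, hence power series on the
closed polydisc into Dirichlet series on `Re t ≤ 0`. -/
theorem mono_exp (lam : ι → ℝ) (t : ℂ) (k : ι →₀ ℕ) :
    mono (fun j => Complex.exp (lam j * t)) k = Complex.exp (wt lam k * t) := by
  rw [mono, Finsupp.prod_fintype _ _ (by simp), wt]
  push_cast
  rw [Finset.sum_mul, Complex.exp_sum]
  refine Finset.prod_congr rfl fun j _ => ?_
  rw [← Complex.exp_nat_mul]
  ring_nf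

theorem norm_exp_le {lam : ι → ℝ} (hlam : ∀ j, 0 < lam j) {t : ℂ} (ht : t.re ≤ 0) (j : ι) :
    ‖Complex.exp (lam j * t)‖ ≤ 1 := by
  rw [Complex.norm_exp, Real.exp_le_one_iff]
  simp only [Complex.mul_re, Complex.ofReal_re, Complex.ofReal_im, zero_mul, sub_zero]
  exact mul_nonpos_of_nonneg_of_nonpos (hlam j).le ht

theorem norm_exp_wt_le {lam : ι → ℝ} (hlam : ∀ j, 0 < lam j) {t : ℂ} (ht : t.re ≤ 0)
    (k : ι →₀ ℕ) : ‖Complex.exp (wt lam k * t)‖ ≤ 1 := by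
  rw [← mono_exp]
  exact norm_mono_le (norm_exp_le hlam ht) k

/-- Termwise differentiation multiplies by unbounded frequencies. The summability of `b` supplies
the majorant; in the application `b` is the coefficient sequence of `f` along the series, which lies
in the Wiener algebra. -/
theorem hasDerivAt_dirichlet {lam : ι → ℝ} (hlam : ∀ j, 0 < lam j) (z₀ : Phase N)
    {a b : (ι →₀ ℕ) → Phase N} (ha : Summable fun k => ‖a k‖) (hb : Summable fun k => ‖b k‖)
    (hab : ∀ k, (wt lam k : ℂ) • a k = b k) {t : ℂ} (ht : t.re < 0) :
    HasDerivAt (dirichlet lam z₀ a) (∑' k, Complex.exp (wt lam k * t) • b k) t := by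
  suffices h : HasDerivAt (fun t : ℂ => ∑' k, Complex.exp (wt lam k * t) • a k)
      (∑' k, Complex.exp (wt lam k * t) • b k) t from h.const_add z₀
  have hopen : IsOpen {t : ℂ | t.re < 0} := isOpen_lt Complex.continuous_re continuous_const
  refine hasDerivAt_tsum_of_isPreconnected (F := Phase N)
    (g := fun (k : ι →₀ ℕ) (t : ℂ) => Complex.exp (wt lam k * t) • a k)
    (g' := fun (k : ι →₀ ℕ) (t : ℂ) => Complex.exp (wt lam k * t) • b k)
    hb hopen (convex_halfSpace_re_lt 0).isPreconnected
    (fun k y _ => ?_) (fun k y hy => ?_) ht ?_ ht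
  · have h1 : HasDerivAt (fun y : ℂ => Complex.exp (wt lam k * y))
        (Complex.exp (wt lam k * y) * (wt lam k * 1)) y :=
      ((hasDerivAt_id y).const_mul _).cexp
    have h2 := h1.smul_const (a k)
    rwa [mul_one, mul_smul, hab] at h2
  · rw [norm_smul]
    exact mul_le_of_le_one_left (norm_nonneg _) (norm_exp_wt_le hlam hy.le k)
  · refine Summable.of_norm_bounded ha fun k => ?_
    rw [norm_smul]
    exact mul_le_of_le_one_left (norm_nonneg _) (norm_exp_wt_le hlam ht.le k)

theorem dirichlet_vcoeff {lam : ι → ℝ} (hlam : ∀ j, 0 < lam j) (z₀ : Phase N)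
    (u : Fin N → Wiener ι) {t : ℂ} (ht : t.re ≤ 0) :
    dirichlet lam z₀ (fun k => vcoeff k u) t
      = z₀ + veval (fun j => Complex.exp (lam j * t)) (norm_exp_le hlam ht) u := by
  rw [dirichlet, ← (hasSum_veval _ (norm_exp_le hlam ht) u).tsum_eq]
  simp only [mono_exp]

/-- Poincaré's linearization on the strong unstable manifold: all small solutions are given by
convergent Dirichlet series. -/
theorem exists_dirichlet_solution {f : Phase N → Phase N} (hf : Differentiable ℂ f) {z₀ : Phase N}
    (hf0 : f z₀ = 0) (v : ι → Phase N) {lam : ι → ℝ} (hlam : ∀ j, 0 < lam j)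
    (hv : ∀ j, fderiv ℂ f z₀ (v j) = (lam j : ℂ) • v j)
    (hres : ∀ k : ι →₀ ℕ, 2 ≤ k.degree → ∀ z, fderiv ℂ f z₀ z = (wt lam k : ℂ) • z → z = 0)
    (π : Phase N →L[ℂ] (ι → ℂ)) [DecidableEq ι] (hπ : ∀ j, π (v j) = Pi.single j 1)
    {ε : ℝ} (hε : 0 < ε) :
    ∀ᶠ ξ in 𝓝 (0 : ι → ℂ), ∃ a : (ι →₀ ℕ) → Phase N, (Summable fun k => ‖a k‖) ∧
      ∑' k, ‖a k‖ ≤ ε ∧ a 0 = 0 ∧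
      (∀ t : ℂ, t.re < 0 → HasDerivAt (dirichlet lam z₀ a) (f (dirichlet lam z₀ a t)) t) ∧
      π (dirichlet lam z₀ a 0 - z₀) = ξ := by
  obtain ⟨c, hc⟩ := exists_isExpansion hf z₀
  obtain ⟨R, C, hRb, hR1, hR0⟩ := exists_bounded_resolvent hlam (fderiv ℂ f z₀)
    {k : ι →₀ ℕ | 2 ≤ k.degree} hres
  obtain ⟨L, hL⟩ := exists_multiplier (N := N) R id C hRb (fun k l h _ _ => h)
  simp only [id] at hL
  have hsingle : ∀ j : ι, Summable fun k : ι →₀ ℕ =>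
      ‖(if k = Finsupp.single j 1 then v j else 0)‖ := by
    intro j
    refine summable_of_hasFiniteSupport
      ((Set.finite_singleton (Finsupp.single j 1 : ι →₀ ℕ)).subset fun k hk => ?_)
    by_contra hne
    apply hk
    simp only [if_neg (Set.mem_singleton_iff.not.1 hne), norm_zero]
  -- The linear series `∑ d_j x_j v_j`: the free part of the solution.
  set ℓ : (ι → ℂ) →L[ℂ] (Fin N → Wiener ι) := ∑ j, (ContinuousLinearMap.proj j :
    (ι → ℂ) →L[ℂ] ℂ).smulRight (ofVCoeff _ (hsingle j)) with hℓ
  have hℓk : ∀ d k, vcoeff k (ℓ d) = ∑ j, d j • (if k = Finsupp.single j 1 then v j else 0) := by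
    intro d k
    simp only [hℓ, sum_apply, ContinuousLinearMap.smulRight_apply, map_sum, map_smul,
      vcoeff_ofVCoeff, ContinuousLinearMap.proj_apply]
  -- The point `(1, …, 1)`, written as the value of the exponentials at time `t = 0`.
  set x₁ : ι → ℂ := fun j => Complex.exp (lam j * 0) with hx₁
  have hx1 : ∀ j, ‖x₁ j‖ ≤ 1 := norm_exp_le hlam (by simp)
  have hℓ1 : ∀ d, π (veval x₁ hx1 (ℓ d)) = d := by
    intro d
    have h1 : HasSum (fun k => ∑ j, d j • (if k = Finsupp.single j 1 then v j else 0))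
        (∑ j, d j • v j) := by
      refine hasSum_sum fun j _ => ?_
      exact (hasSum_ite_eq (Finsupp.single j 1) (v j)).const_smul (d j)
    have h2 := hasSum_veval x₁ hx1 (ℓ d)
    have h3 : ∀ k : ι →₀ ℕ, mono x₁ k = 1 := by intro k; rw [hx₁, mono_exp]; simp
    simp only [h3, one_smul, hℓk] at h2
    rw [h2.unique h1, map_sum]
    simp only [map_smul, hπ]
    ext i
    simp [Pi.single_apply]
  set Q : (Fin N → Wiener ι) → (Fin N → Wiener ι) := fun u =>
    superpose c u - superposeLin (Wiener ι) c u with hQ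
  have hQd : HasStrictFDerivAt Q (0 : (Fin N → Wiener ι) →L[ℂ] (Fin N → Wiener ι)) 0 := by
    have := (hasStrictFDerivAt_superpose (𝒜 := Wiener ι) hc.summable).sub
      (superposeLin (Wiener ι) c).hasStrictFDerivAt
    rwa [sub_self] at this
  have hQ0 : Q 0 = 0 := by
    simp only [hQ, map_zero, sub_zero]
    exact hc.superpose_zero_vcoeff hf0
  -- The coefficient equations read `u = ℓ d + L (Q u)`, with `Q` the nonlinear part and `L` the
  -- resolvents in degrees at least two. Requiring `π` of the value at time `0` to be `ξ` forces `d
  -- = ξ - π (L (Q u))(1, …, 1)`. Eliminating `d` leaves `u - M (Q u) = ℓ ξ`.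
  set M := L - ℓ.comp (π.comp ((veval x₁ hx1).comp L)) with hM
  -- Radius one allows substitution into the expansion of `f`; radius `ε / (N + 1)` gives the bound
  -- by `ε`, because the sum of the coefficient norms is at most `N ‖u‖`.
  have hU : Metric.ball (0 : Fin N → Wiener ι) (min 1 (ε / (N + 1))) ∈ 𝓝 0 :=
    Metric.ball_mem_nhds _ (by positivity)
  have hsolv := eventually_solvable M hQd hQ0 hU
  have hℓ0 : Tendsto ℓ (𝓝 0) (𝓝 0) := by simpa using ℓ.continuous.tendsto 0
  filter_upwards [hℓ0.eventually hsolv] with ξ hξ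
  obtain ⟨u, hu, hueq⟩ := hξ
  rw [mem_ball_zero_iff, lt_min_iff] at hu
  set d := ξ - π (veval x₁ hx1 (L (Q u))) with hd
  have hueq' : u = ℓ d + L (Q u) := by
    have h1 : u = M (Q u) + ℓ ξ := by rw [← hueq]; abel
    have h2 : M (Q u) = L (Q u) - ℓ (π (veval x₁ hx1 (L (Q u)))) := rfl
    rw [hd, map_sub]
    calc u = M (Q u) + ℓ ξ := h1
      _ = _ := by rw [h2]; abel
  have hcoef : ∀ k, vcoeff k u = ∑ j, d j • (if k = Finsupp.single j 1 then v j else 0)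
      + R k (vcoeff k (Q u)) := by
    intro k
    rw [← hℓk, ← hL, ← map_add, ← hueq']
  have hR0' : ∀ k : ι →₀ ℕ, k.degree < 2 → R k = 0 := fun k hk => hR0 k (by simpa using hk)
  have hu0 : vcoeff 0 u = 0 := by
    rw [hcoef, hR0' 0 (by simp)]
    simp only [LinearMap.zero_apply, add_zero]
    refine Finset.sum_eq_zero fun j _ => ?_
    rw [if_neg (by simp [eq_comm]), smul_zero]
  -- The differential equation coefficient by coefficient: degree zero is the equilibrium, degree
  -- one the eigenvector equation, and higher degrees are the defining property of the resolvents.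
  have hmain : ∀ k, (wt lam k : ℂ) • vcoeff k u = vcoeff k (superpose c u) := by
    intro k
    rcases Nat.lt_or_ge k.degree 2 with hlt | hge
    · rcases Nat.lt_or_ge k.degree 1 with hlt1 | hge1
      · have hk : k = 0 := by
          rw [← Finsupp.degree_eq_zero_iff]; omega
        subst hk
        rw [hc.vcoeff_superpose_zero hu.1.le, hu0, smul_zero, add_zero, hf0]
      · obtain ⟨i, rfl⟩ : ∃ i, k = Finsupp.single i 1 := by
          have h1 : k.degree = 1 := by omega
          have h2 : k ∈ {d : ι →₀ ℕ | d.degree = 1} := h1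
          rw [← Finsupp.range_single_one] at h2
          obtain ⟨i, hi⟩ := h2
          exact ⟨i, hi.symm⟩
        rw [hc.vcoeff_superpose_single hf hu.1.le hu0, wt_single]
        have : vcoeff (Finsupp.single i 1) u = d i • v i := by
          rw [hcoef, hR0' _ hlt]
          simp only [LinearMap.zero_apply, add_zero]
          rw [Finset.sum_eq_single i]
          · simp
          · intro j _ hj
            rw [if_neg, smul_zero]
            intro h
            exact hj ((Finsupp.single_left_injective one_ne_zero h).symm)
          · simp
        rw [this, map_smul, hv, smul_comm]
    · have h1 : vcoeff k u = R k (vcoeff k (Q u)) := by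
        rw [hcoef, add_eq_right]
        refine Finset.sum_eq_zero fun j _ => ?_
        rw [if_neg, smul_zero]
        rintro rfl
        simp at hge
      have h2 := hR1 k hge (vcoeff k (Q u))
      rw [← h1] at h2
      have h3 : vcoeff k (Q u) = vcoeff k (superpose c u) - fderiv ℂ f z₀ (vcoeff k u) := by
        rw [hQ, map_sub, hc.vcoeff_superposeLin]
      rw [h3] at h2
      exact sub_left_injective h2
  refine ⟨fun k => vcoeff k u, summable_vcoeff u, ?_, hu0, fun t ht => ?_, ?_⟩
  · refine (tsum_norm_vcoeff_le u).trans ?_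
    calc (N : ℝ) * ‖u‖ ≤ (N + 1) * (ε / (N + 1)) := by
          gcongr
          · linarith
          · exact hu.2.le
      _ = ε := by field_simp
  · have h1 := hasDerivAt_dirichlet hlam z₀ (summable_vcoeff u) (summable_vcoeff _) hmain ht
    rw [dirichlet_vcoeff hlam z₀ u ht.le, ← hc.veval_superpose hu.1.le,
      ← (hasSum_veval _ (norm_exp_le hlam ht.le) (superpose c u)).tsum_eq]
    simpa only [mono_exp] using h1
  · rw [dirichlet_vcoeff hlam z₀ u (by simp), add_sub_cancel_left]
    change π (veval x₁ hx1 u) = ξ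
    conv_lhs => rw [hueq']
    rw [map_add, map_add, hℓ1, hd]
    abel

end Series

/-! ### Uniqueness, local existence and extension of solutions in complex time. -/

section ComplexODE

variable {N : ℕ} {f : Phase N → Phase N}

theorem hasStrictFDerivAt_of_differentiable (hf : Differentiable ℂ f) (z : Phase N) :
    HasStrictFDerivAt f (fderiv ℂ f z) z := by
  obtain ⟨c, hc⟩ := exists_isExpansion hf z
  rw [hc.fderiv_eq]
  exact hc.hasStrictFDerivAt

theorem exists_lipschitzOnWith_closedBall (hf : Differentiable ℂ f) (C : ℝ) :
    ∃ K, LipschitzOnWith K f (Metric.closedBall 0 C) := by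
  refine LocallyLipschitzOn.exists_lipschitzOnWith_of_compact (isCompact_closedBall _ _) ?_
  intro z _
  obtain ⟨K, s, hs, hK⟩ := (hasStrictFDerivAt_of_differentiable hf z).exists_lipschitzOnWith
  exact ⟨K, s, mem_nhdsWithin_of_mem_nhds hs, hK⟩

/-- Solutions in complex time on a convex set are unique. -/
theorem solution_unique (hf : Differentiable ℂ f) {S : Set ℂ} (hS : Convex ℝ S) {G₁ G₂ : ℂ → Phase N}
    (h₁ : ∀ t ∈ S, HasDerivWithinAt G₁ (f (G₁ t)) S t)
    (h₂ : ∀ t ∈ S, HasDerivWithinAt G₂ (f (G₂ t)) S t)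
    {a b : ℂ} (ha : a ∈ S) (hb : b ∈ S) (hab : G₁ a = G₂ a) : G₁ b = G₂ b := by
  -- Convexity reduces uniqueness to the segment from `a` to `b`, where both functions solve a
  -- real-time equation; on a ball containing both compact curves the field is Lipschitz.
  set γ : ℝ → ℂ := fun s => a + s * (b - a) with hγ
  have hγS : Set.MapsTo γ (Set.Icc 0 1) S := by
    intro s hs
    have := hS.add_smul_sub_mem ha hb hs
    simpa [hγ] using this
  have hγd : ∀ s, HasDerivAt γ (b - a) s := by
    intro s
    have := ((Complex.ofRealCLM.hasDerivAt (x := s)).mul_const (b - a)).const_add a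
    simpa [hγ] using this
  have key : ∀ G : ℂ → Phase N, (∀ t ∈ S, HasDerivWithinAt G (f (G t)) S t) →
      ∀ s ∈ Set.Icc (0 : ℝ) 1, HasDerivWithinAt (G ∘ γ) ((b - a) • f (G (γ s))) (Set.Icc 0 1) s :=
    fun G hG s hs => (hG _ (hγS hs)).scomp s (hγd s).hasDerivWithinAt hγS
  have hc : ∀ G : ℂ → Phase N, (∀ t ∈ S, HasDerivWithinAt G (f (G t)) S t) →
      ContinuousOn (G ∘ γ) (Set.Icc 0 1) := fun G hG s hs => (key G hG s hs).continuousWithinAt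
  obtain ⟨C₁, hC₁⟩ := isCompact_Icc.exists_bound_of_continuousOn (hc G₁ h₁)
  obtain ⟨C₂, hC₂⟩ := isCompact_Icc.exists_bound_of_continuousOn (hc G₂ h₂)
  obtain ⟨K, hK⟩ := exists_lipschitzOnWith_closedBall hf (max C₁ C₂)
  have hr : ∀ G : ℂ → Phase N, (∀ t ∈ S, HasDerivWithinAt G (f (G t)) S t) →
      ∀ s ∈ Set.Ico (0 : ℝ) 1, HasDerivWithinAt (G ∘ γ) ((b - a) • f ((G ∘ γ) s)) (Set.Ici s) s := by
    intro G hG s hs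
    refine (key G hG s (Set.Ico_subset_Icc_self hs)).mono_of_mem_nhdsWithin ?_
    exact mem_nhdsWithin.2 ⟨Set.Iio 1, isOpen_Iio, hs.2, fun x hx => ⟨hs.1.trans hx.2, hx.1.le⟩⟩
  have hE := ODE_solution_unique_of_mem_Icc_right (v := fun _ z => (b - a) • f z)
    (s := fun _ => Metric.closedBall 0 (max C₁ C₂)) (K := ‖b - a‖₊ * K)
    (fun t _ => by
      have h := (lipschitzWith_smul (β := Phase N) (b - a)).comp_lipschitzOnWith hK
      exact h)
    (hc G₁ h₁) (hr G₁ h₁)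
    (fun t ht => mem_closedBall_zero_iff.2
      ((hC₁ t (Set.Ico_subset_Icc_self ht)).trans (le_max_left _ _)))
    (hc G₂ h₂) (hr G₂ h₂)
    (fun t ht => mem_closedBall_zero_iff.2
      ((hC₂ t (Set.Ico_subset_Icc_self ht)).trans (le_max_right _ _)))
    (by simpa [hγ] using hab)
  have := hE (Set.right_mem_Icc.2 zero_le_one)
  simpa [hγ] using this

open Wiener in
-- Picard's integral equation in the Wiener algebra of one variable, with time rescaled to `t / r`:
-- the unknown `u` satisfies `u = (w - z₀) + r ∫ f(z₀ + u)`. Adjoining `r` as a second unknown makes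
-- the nonlinearity have zero derivative, and yields one radius for all nearby initial values.
theorem eventually_local_solution (hf : Differentiable ℂ f) (z₀ : Phase N) :
    ∃ r > 0, ∀ᶠ w in 𝓝 z₀, ∃ Z : ℂ → Phase N, Z 0 = w ∧
      ∀ t ∈ Metric.ball (0 : ℂ) r, HasDerivAt Z (f (Z t)) t := by
  obtain ⟨c, hc⟩ := exists_isExpansion hf z₀
  set e : ℕ → Unit →₀ ℕ := fun n => Finsupp.single () n with he
  have he1 : ∀ k : Unit →₀ ℕ, k = e (k ()) := fun k => by
    ext; simp [he]
  -- Integration from `0`: divide by the order and shift by one. At order zero the convention `0⁻¹ =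
  -- 0` kills the constant term, so the truncated subtraction there is immaterial.
  obtain ⟨L, hL⟩ := exists_multiplier (N := N) (fun k : Unit →₀ ℕ => ((k () : ℂ)⁻¹) • LinearMap.id)
    (fun k => e (k () - 1)) 1 (fun k z => by
      rw [LinearMap.smul_apply, norm_smul, LinearMap.id_apply]
      gcongr
      rw [norm_inv, Complex.norm_natCast]
      exact Nat.cast_inv_le_one _)
    (fun k l h hk hl => by
      have hk' : k () ≠ 0 := by rintro h0; simp [h0] at hk
      have hl' : l () ≠ 0 := by rintro h0; simp [h0] at hl
      have h' := DFunLike.congr_fun h ()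
      simp only [he, Finsupp.single_eq_same] at h'
      rw [he1 k, he1 l]
      congr 1
      omega)
  set κ : Phase N →L[ℂ] (Fin N → Wiener Unit) := ContinuousLinearMap.pi fun i =>
    (Algebra.linearMap ℂ (Wiener Unit)).toContinuousLinearMap.comp (ContinuousLinearMap.proj i)
    with hκ
  have hκi : ∀ w i, κ w i = algebraMap ℂ (Wiener Unit) (w i) := fun w i => rfl
  have hκk : ∀ w n, vcoeff (e (n + 1)) (κ w) = 0 := by
    intro w n
    ext i
    rw [vcoeff_apply, hκi, Algebra.algebraMap_eq_smul_one, map_smul, coeff_one, if_neg, smul_zero]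
    · rfl
    · simp [he]
  have hκ0 : ∀ w, vcoeff 0 (κ w) = w := by
    intro w
    ext i
    rw [vcoeff_apply, hκi, Algebra.algebraMap_eq_smul_one, map_smul, coeff_one, if_pos rfl]
    simp
  set g : (Fin N → Wiener Unit) → (Fin N → Wiener Unit) := fun u =>
    L (superpose c u) - L (superpose c 0) with hg
  set E := (Fin N → Wiener Unit) × ℂ with hE
  -- The product of two quantities that vanish at the origin, as `g` has its constant removed; hence
  -- its derivative there is zero.
  set Q : E → E := fun p => (p.2 • g p.1, 0) with hQ
  have hgd : HasStrictFDerivAt g (L.comp (superposeLin (Wiener Unit) c)) 0 :=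
    (L.hasStrictFDerivAt.comp 0 (hasStrictFDerivAt_superpose hc.summable)).sub_const _
  have hQd : HasStrictFDerivAt Q (0 : E →L[ℂ] E) 0 := by
    have h1 : HasStrictFDerivAt (fun p : E => g p.1)
        ((L.comp (superposeLin (Wiener Unit) c)).comp (ContinuousLinearMap.fst ℂ _ _)) (0 : E) :=
      HasStrictFDerivAt.comp (0 : E) hgd hasStrictFDerivAt_fst
    have h2 : HasStrictFDerivAt (fun p : E => p.2) (ContinuousLinearMap.snd ℂ _ _) (0 : E) :=
      hasStrictFDerivAt_snd
    have h3 := (h2.smul h1).prodMk (hasStrictFDerivAt_const (𝕜 := ℂ) (0 : ℂ) (0 : E))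
    refine h3.congr_fderiv ?_
    ext p <;> simp [hg]
  have hQ0 : Q 0 = 0 := by
    change ((0 : E).2 • g (0 : E).1, (0 : ℂ)) = (0 : E)
    change ((0 : ℂ) • g 0, (0 : ℂ)) = ((0, 0) : E)
    rw [zero_smul]
  have hU : Metric.ball (0 : E) 1 ∈ 𝓝 0 := Metric.ball_mem_nhds _ one_pos
  have hsolv := eventually_solvable (ContinuousLinearMap.id ℂ E) hQd hQ0 hU
  have hcont : Tendsto (fun p : Phase N × ℂ => ((κ (p.1 - z₀) + p.2 • L (superpose c 0), p.2) : E))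
      (𝓝 (z₀, 0)) (𝓝 0) := by
    have : Continuous fun p : Phase N × ℂ =>
        ((κ (p.1 - z₀) + p.2 • L (superpose c 0), p.2) : E) := by fun_prop
    have h := this.tendsto (z₀, 0)
    rw [sub_self, map_zero, zero_smul, add_zero] at h
    exact h
  have hev := hcont.eventually hsolv
  rw [nhds_prod_eq] at hev
  -- Splitting the product neighborhood separates `w` from `r`, so that `r` is fixed before `w`.
  obtain ⟨pa, hpa, pb, hpb, hab⟩ := eventually_prod_iff.1 hev
  obtain ⟨r, hr, hrb⟩ : ∃ r : ℝ, 0 < r ∧ pb (r : ℂ) := by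
    obtain ⟨δ, hδ, hδb⟩ := Metric.eventually_nhds_iff.1 hpb
    refine ⟨δ / 2, by positivity, hδb ?_⟩
    rw [dist_zero_right, Complex.norm_real, Real.norm_eq_abs, abs_of_pos (by positivity)]
    linarith
  have hrC : (r : ℂ) ≠ 0 := by exact_mod_cast hr.ne'
  refine ⟨r, hr, hpa.mono fun w hw => ?_⟩
  obtain ⟨⟨u, q⟩, hu, hueq⟩ := hab hw hrb
  have hu1 : u - q • g u = κ (w - z₀) + (r : ℂ) • L (superpose c 0) := congrArg Prod.fst hueq
  have hqr : q - 0 = (r : ℂ) := congrArg Prod.snd hueq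
  rw [sub_zero] at hqr
  subst hqr
  have hun : ‖u‖ ≤ 1 := ((norm_fst_le _).trans (mem_ball_zero_iff.1 hu).le)
  have hu2 : u = κ (w - z₀) + (r : ℂ) • L (superpose c u) := by
    have : u = (r : ℂ) • g u + (κ (w - z₀) + (r : ℂ) • L (superpose c 0)) := by rw [← hu1]; abel
    rw [hg, smul_sub] at this
    calc u = _ := this
      _ = _ := by abel
  set a : ℕ → Phase N := fun n => vcoeff (e n) u with ha
  set b : ℕ → Phase N := fun n => vcoeff (e n) (superpose c u) with hb
  have heinj : Function.Injective e := Finsupp.single_injective ()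
  have hasum : Summable fun n => ‖a n‖ := (summable_vcoeff u).comp_injective heinj
  have hbsum : Summable fun n => ‖b n‖ := (summable_vcoeff (superpose c u)).comp_injective heinj
  have he0 : e 0 = 0 := by simp [he]
  have ha0 : a 0 = w - z₀ := by
    have h1 : vcoeff 0 (L (superpose c u)) = 0 := by rw [hL]; simp
    simp only [ha, he0]
    rw [hu2, map_add, hκ0, map_smul, h1, smul_zero, add_zero]
  have hab' : ∀ n : ℕ, ((n : ℂ) + 1) • a (n + 1) = (r : ℂ) • b n := by
    intro n
    simp only [ha, hb]
    conv_lhs => rw [hu2]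
    rw [map_add, hκk, zero_add, map_smul, hL]
    simp only [he, Finsupp.single_eq_same, Nat.add_sub_cancel, LinearMap.smul_apply,
      LinearMap.id_apply, Nat.cast_add, Nat.cast_one]
    have hn : (n : ℂ) + 1 ≠ 0 := Nat.cast_add_one_ne_zero n
    rw [smul_smul, smul_smul]
    congr 1
    field_simp
  have hval : ∀ (w : Fin N → Wiener Unit) (x : ℂ) (hx : ∀ i : Unit, ‖(fun _ => x : Unit → ℂ) i‖ ≤ 1),
      HasSum (fun n : ℕ => x ^ n • vcoeff (e n) w) (veval (fun _ => x) hx w) := by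
    intro w x hx
    have h1 := hasSum_veval (fun _ => x) hx w
    have hr : Set.range e = Set.univ := by
      rw [Set.range_eq_univ]; exact fun k => ⟨k (), (he1 k).symm⟩
    have h2 := (heinj.hasSum_iff (f := fun k => mono (fun _ => x) k • vcoeff k w) (by
      intro k hk; rw [hr] at hk; exact absurd (Set.mem_univ k) hk)).2 h1
    refine h2.congr_fun fun n => ?_
    simp [he, mono]
  have hball : ∀ t ∈ Metric.ball (0 : ℂ) r, ‖t / r‖ ≤ 1 := by
    intro t ht
    rw [mem_ball_zero_iff] at ht
    rw [norm_div, Complex.norm_real, Real.norm_eq_abs, abs_of_pos hr, div_le_one hr]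
    exact ht.le
  set Z : ℂ → Phase N := fun t => w + ∑' n : ℕ, (t / r) ^ (n + 1) • a (n + 1) with hZ
  have hsum1 : ∀ t ∈ Metric.ball (0 : ℂ) r, Summable fun n : ℕ => (t / r) ^ n • a n := by
    intro t ht
    refine Summable.of_norm_bounded hasum fun n => ?_
    rw [norm_smul, norm_pow]
    exact mul_le_of_le_one_left (norm_nonneg _) (pow_le_one₀ (norm_nonneg _) (hball t ht))
  have hZval : ∀ t (ht : t ∈ Metric.ball (0 : ℂ) r),
      Z t = z₀ + veval (fun _ => t / r) (fun _ => hball t ht) u := by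
    intro t ht
    rw [← (hval u (t / r) (fun _ => hball t ht)).tsum_eq]
    have h := (hsum1 t ht).tsum_eq_zero_add
    rw [pow_zero, one_smul, ha0] at h
    change w + ∑' n : ℕ, (t / r) ^ (n + 1) • a (n + 1) = z₀ + ∑' n : ℕ, (t / r) ^ n • a n
    rw [h]
    abel
  refine ⟨Z, by simp [hZ], fun t ht => ?_⟩
  have hd : HasDerivAt Z (∑' n : ℕ, (t / r) ^ n • b n) t := by
    suffices h : HasDerivAt (fun t : ℂ => ∑' n : ℕ, (t / r) ^ (n + 1) • a (n + 1))
      (∑' n : ℕ, (t / r) ^ n • b n) t from h.const_add w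
    refine hasDerivAt_tsum_of_isPreconnected (F := Phase N)
      (g := fun (n : ℕ) (t : ℂ) => (t / r) ^ (n + 1) • a (n + 1))
      (g' := fun (n : ℕ) (t : ℂ) => (t / r) ^ n • b n) hbsum Metric.isOpen_ball
      (convex_ball (0 : ℂ) r).isPreconnected (fun n y _ => ?_) (fun n y hy => ?_) ht
      ((summable_nat_add_iff 1).2 (hsum1 t ht)) ht
    · have h1 : HasDerivAt (fun y : ℂ => (y / r) ^ (n + 1))
          (((n + 1 : ℕ) : ℂ) * (y / r) ^ n * (1 / r)) y := ((hasDerivAt_id y).div_const _).pow _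
      have h2 := h1.smul_const (a (n + 1))
      have h3 : (((n + 1 : ℕ) : ℂ) * (y / r) ^ n * (1 / r)) • a (n + 1) = (y / r) ^ n • b n := by
        have h4 : (((n + 1 : ℕ) : ℂ) * (y / r) ^ n * (1 / r))
            = ((y / r) ^ n * (1 / r)) * ((n : ℂ) + 1) := by push_cast; ring
        rw [h4, mul_smul, hab', smul_smul]
        congr 1
        field_simp
      rwa [h3] at h2
    · rw [norm_smul, norm_pow]
      exact mul_le_of_le_one_left (norm_nonneg _) (pow_le_one₀ (norm_nonneg _) (hball y hy))
  rw [hZval t ht, ← hc.veval_superpose hun,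
    ← (hval (superpose c u) (t / r) (fun _ => hball t ht)).tsum_eq]
  exact hd

/-- On bounded sets of initial values, the solutions exist in discs of a uniform radius. -/
theorem exists_uniform_radius (hf : Differentiable ℂ f) (C : ℝ) :
    ∃ r > 0, ∀ w, ‖w‖ ≤ C → ∀ c : ℂ, ∃ Z : ℂ → Phase N, Z c = w ∧
      ∀ t ∈ Metric.ball c r, HasDerivAt Z (f (Z t)) t := by
  have h : ∃ r > 0, ∀ w ∈ Metric.closedBall (0 : Phase N) C, ∃ Z : ℂ → Phase N, Z 0 = w ∧
      ∀ t ∈ Metric.ball (0 : ℂ) r, HasDerivAt Z (f (Z t)) t := by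
    refine (isCompact_closedBall (0 : Phase N) C).induction_on
      (p := fun s => ∃ r > 0, ∀ w ∈ s, ∃ Z : ℂ → Phase N, Z 0 = w ∧
        ∀ t ∈ Metric.ball (0 : ℂ) r, HasDerivAt Z (f (Z t)) t) ?_ ?_ ?_ ?_
    · exact ⟨1, one_pos, fun w hw => absurd hw (Set.notMem_empty w)⟩
    · rintro s t hst ⟨r, hr, h⟩
      exact ⟨r, hr, fun w hw => h w (hst hw)⟩
    · rintro s t ⟨r, hr, h⟩ ⟨r', hr', h'⟩
      refine ⟨min r r', lt_min hr hr', fun w hw => ?_⟩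
      rcases hw with hw | hw
      · obtain ⟨Z, h0, hZ⟩ := h w hw
        exact ⟨Z, h0, fun t ht => hZ t (Metric.ball_subset_ball (min_le_left _ _) ht)⟩
      · obtain ⟨Z, h0, hZ⟩ := h' w hw
        exact ⟨Z, h0, fun t ht => hZ t (Metric.ball_subset_ball (min_le_right _ _) ht)⟩
    · intro z _
      obtain ⟨r, hr, h⟩ := eventually_local_solution hf z
      exact ⟨_, mem_nhdsWithin_of_mem_nhds h, r, hr, fun w hw => hw⟩
  obtain ⟨r, hr, h⟩ := h
  refine ⟨r, hr, fun w hw c => ?_⟩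
  obtain ⟨Z, h0, hZ⟩ := h w (mem_closedBall_zero_iff.2 hw)
  refine ⟨fun t => Z (t - c), by simpa using h0, fun t ht => ?_⟩
  refine HasDerivAt.comp_sub_const t c (hZ (t - c) ?_)
  rwa [mem_ball_zero_iff, ← dist_eq_norm]

/-- A solution on a convex set, with local solutions of a uniform radius at all of its points,
extends to a neighborhood. -/
theorem exists_extension (hf : Differentiable ℂ f) {S : Set ℂ} (hS : Convex ℝ S)
    {G₀ : ℂ → Phase N} (h₀ : ∀ t ∈ S, HasDerivWithinAt G₀ (f (G₀ t)) S t) {r : ℝ}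
    (hloc : ∀ c ∈ S, ∃ Z : ℂ → Phase N, Z c = G₀ c ∧
      ∀ t ∈ Metric.ball c r, HasDerivAt Z (f (Z t)) t) :
    ∃ G : ℂ → Phase N, (∀ t ∈ S, G t = G₀ t) ∧
      ∀ t ∈ Metric.thickening r S, HasDerivAt G (f (G t)) t := by
  classical
  rcases le_or_gt r 0 with hr | hr
  · exact ⟨G₀, fun _ _ => rfl, fun t ht => by
      rw [Metric.thickening_of_nonpos hr] at ht; exact absurd ht (Set.notMem_empty t)⟩
  have hloc' : ∀ c : ℂ, ∃ Z : ℂ → Phase N, c ∈ S → Z c = G₀ c ∧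
      ∀ t ∈ Metric.ball c r, HasDerivAt Z (f (Z t)) t := by
    intro c
    by_cases hc : c ∈ S
    · obtain ⟨Z, hZ⟩ := hloc c hc
      exact ⟨Z, fun _ => hZ⟩
    · exact ⟨0, fun h => absurd h hc⟩
  choose Z hZ using hloc'
  have hZG : ∀ c ∈ S, ∀ s ∈ S, s ∈ Metric.ball c r → Z c s = G₀ s := by
    intro c hc s hs hsr
    refine solution_unique hf (hS.inter (convex_ball c r))
      (fun t ht => ((hZ c hc).2 t ht.2).hasDerivWithinAt)
      (fun t ht => (h₀ t ht.1).mono Set.inter_subset_left)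
      (a := c) ⟨hc, Metric.mem_ball_self hr⟩ ⟨hs, hsr⟩ (hZ c hc).1
  have hZZ : ∀ c ∈ S, ∀ c' ∈ S, ∀ s, s ∈ Metric.ball c r → s ∈ Metric.ball c' r →
      Z c s = Z c' s := by
    intro c hc c' hc' s hs hs'
    -- Two overlapping balls with centers in `S` both contain the midpoint of the centers. It lies
    -- in `S` by convexity, and there both local solutions equal `G₀`.
    have hm : midpoint ℝ c c' ∈ S := hS.midpoint_mem hc hc'
    have hcc : dist c c' < 2 * r := by
      calc dist c c' ≤ dist s c + dist s c' := dist_triangle_left _ _ _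
        _ < 2 * r := by rw [Metric.mem_ball] at hs hs'; linarith
    have h1 : midpoint ℝ c c' ∈ Metric.ball c r := by
      rw [Metric.mem_ball, dist_comm, dist_left_midpoint]
      simp only [Real.norm_ofNat]
      linarith
    have h2 : midpoint ℝ c c' ∈ Metric.ball c' r := by
      rw [Metric.mem_ball, dist_midpoint_right]
      simp only [Real.norm_ofNat]
      linarith
    refine solution_unique hf ((convex_ball c r).inter (convex_ball c' r))
      (fun t ht => ((hZ c hc).2 t ht.1).hasDerivWithinAt)
      (fun t ht => ((hZ c' hc').2 t ht.2).hasDerivWithinAt)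
      (a := midpoint ℝ c c') ⟨h1, h2⟩ ⟨hs, hs'⟩ ?_
    rw [hZG c hc _ hm h1, hZG c' hc' _ hm h2]
  have hsel : ∀ t, ∃ c, t ∈ Metric.thickening r S → c ∈ S ∧ t ∈ Metric.ball c r := by
    intro t
    by_cases ht : t ∈ Metric.thickening r S
    · obtain ⟨c, hc, hd⟩ := Metric.mem_thickening_iff.1 ht
      exact ⟨c, fun _ => ⟨hc, hd⟩⟩
    · exact ⟨0, fun h => absurd h ht⟩
  choose c hc using hsel
  refine ⟨fun t => Z (c t) t, fun t ht => ?_, fun t ht => ?_⟩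
  · have ht' := hc t (Metric.self_subset_thickening hr S ht)
    exact hZG _ ht'.1 t ht ht'.2
  · obtain ⟨h1, h2⟩ := hc t ht
    refine ((hZ _ h1).2 t h2).congr_of_eventuallyEq ?_
    filter_upwards [Metric.isOpen_ball.mem_nhds h2] with s hs
    have hs' := hc s (Metric.mem_thickening_iff.2 ⟨c t, h1, hs⟩)
    exact hZZ _ hs'.1 _ h1 s hs'.2 hs

/-- A bound on the values gives local solutions of one radius at all points, so they can be glued.
Since `S` need not be open, this applies to the real axis as well as to strips. -/
theorem exists_extension_of_bounded (hf : Differentiable ℂ f) {S : Set ℂ} (hS : Convex ℝ S)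
    {G₀ : ℂ → Phase N} (h₀ : ∀ t ∈ S, HasDerivWithinAt G₀ (f (G₀ t)) S t) {C : ℝ}
    (hC : ∀ t ∈ S, ‖G₀ t‖ ≤ C) :
    ∃ r > 0, ∃ G : ℂ → Phase N, (∀ t ∈ S, G t = G₀ t) ∧
      ∀ t ∈ Metric.thickening r S, HasDerivAt G (f (G t)) t := by
  obtain ⟨r, hr, h⟩ := exists_uniform_radius hf C
  exact ⟨r, hr, exists_extension hf hS h₀ fun c hc => h _ (hC c hc) c⟩

end ComplexODE

/-! ### Bases adapted to the hyperbolic splitting. -/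

section SpectralBasis

open Module

/-- In a suitable basis, an endomorphism is a small perturbation of a diagonal one. -/
theorem exists_basis_near_diagonal {V : Type*} [AddCommGroup V] [Module ℂ V]
    [FiniteDimensional ℂ V] (T : End ℂ V) {δ : ℝ} (hδ : 0 < δ) :
    ∃ (n : ℕ) (b : Basis (Fin n) ℂ V) (μ : Fin n → ℂ), (∀ j, T.HasEigenvalue (μ j)) ∧
      ∀ i j, ‖b.repr (T (b j) - μ j • b j) i‖ ≤ δ := by
  induction hn : finrank ℂ V generalizing V with
  | zero =>
    have : Subsingleton V := finrank_zero_iff.1 hn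
    exact ⟨0, Basis.empty V, Fin.elim0, fun j => j.elim0, fun i => i.elim0⟩
  | succ n ih =>
    have : Nontrivial V := nontrivial_of_finrank_pos (R := ℂ) (by omega)
    obtain ⟨μ₀, hμ₀⟩ := End.exists_eigenvalue T
    -- The range of `T - μ₀` lies in a hyperplane `W`. Thus `W` is invariant and `T` acts as `μ₀` on
    -- the quotient, which drives the induction.
    have hlt : LinearMap.range (T - μ₀ • (1 : End ℂ V)) < ⊤ := by
      rw [lt_top_iff_ne_top]
      intro h
      have hker := LinearMap.ker_eq_bot_iff_range_eq_top.2 h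
      obtain ⟨x, hx⟩ := hμ₀.exists_hasEigenvector
      refine hx.2 (LinearMap.ker_eq_bot'.1 hker x ?_)
      simp [hx.apply_eq_smul]
    obtain ⟨φ, hφ, hle⟩ := Submodule.exists_le_ker_of_lt_top _ hlt
    set W := LinearMap.ker φ with hW
    have hTx : ∀ x, T x - μ₀ • x ∈ W := fun x => hle ⟨x, by simp⟩
    have hinv : ∀ x ∈ W, T x ∈ W := by
      intro x hx
      have h := W.add_mem (hTx x) (W.smul_mem μ₀ hx)
      rwa [sub_add_cancel] at h
    have hdim : finrank ℂ W = n := by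
      have h : finrank ℂ W + 1 = _ := Module.Dual.finrank_ker_add_one_of_ne_zero hφ
      omega
    obtain ⟨m, b', μ', hμ', hb'⟩ := ih (T.restrict hinv) hdim
    have hx : ∃ x, φ x ≠ 0 := by
      by_contra! h
      exact hφ (LinearMap.ext h)
    obtain ⟨x, hx⟩ := hx
    set y : W := ⟨T x - μ₀ • x, hTx x⟩ with hy
    -- Shrinking the vector outside `W` by `s` shrinks its off-diagonal entries, which are measured
    -- in the unchanged basis of `W`.
    have hs : ∃ s : ℝ, 0 < s ∧ ∀ i, s * ‖b'.repr y i‖ ≤ δ := by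
      refine ⟨δ / (1 + ∑ i, ‖b'.repr y i‖), by positivity, fun i => ?_⟩
      have h1 : ‖b'.repr y i‖ ≤ ∑ i, ‖b'.repr y i‖ :=
        Finset.single_le_sum (f := fun i => ‖b'.repr y i‖) (fun i _ => norm_nonneg _)
          (Finset.mem_univ i)
      rw [div_mul_eq_mul_div, div_le_iff₀ (by positivity)]
      gcongr
      linarith
    obtain ⟨s, hs0, hs⟩ := hs
    have hsC : (s : ℂ) ≠ 0 := by exact_mod_cast hs0.ne'
    have hφs : φ ((s : ℂ) • x) ≠ 0 := by
      rw [map_smul, smul_eq_mul]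
      exact mul_ne_zero hsC hx
    set b := Basis.mkFinCons ((s : ℂ) • x) b'
      (fun c z hz h => by
        have h' := congrArg φ h
        rw [map_add, LinearMap.mem_ker.1 hz, add_zero, map_smul, map_zero, smul_eq_mul] at h'
        exact (mul_eq_zero.1 h').resolve_right hφs)
      (fun z => ⟨-(φ z / φ ((s : ℂ) • x)), by
        rw [hW, LinearMap.mem_ker, map_add, map_smul φ (-(φ z / φ ((s : ℂ) • x))), smul_eq_mul,
          neg_mul, div_mul_cancel₀ _ hφs, add_neg_cancel]⟩) with hb
    have hb0 : b 0 = (s : ℂ) • x := by simp [hb]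
    have hbs : ∀ i, b (Fin.succ i) = (b' i : V) := fun i => by simp [hb]
    have hrepr : ∀ z : W, ∀ i, b.repr (z : V) i = Fin.cons (α := fun _ => ℂ) 0 (b'.repr z) i := by
      intro z i
      have h : (z : V) = ∑ j, (Fin.cons 0 (b'.repr z) : Fin (m + 1) → ℂ) j • b j := by
        rw [Fin.sum_univ_succ]
        simp only [Fin.cons_zero, zero_smul, Fin.cons_succ, zero_add, hbs]
        conv_lhs => rw [← b'.sum_repr z]
        simp only [Submodule.coe_sum, Submodule.coe_smul]
      conv_lhs => rw [h]
      rw [b.repr_sum_self]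
    refine ⟨m + 1, b, Fin.cons μ₀ μ', fun j => ?_, fun i j => ?_⟩
    · refine Fin.cases hμ₀ (fun j => ?_) j
      obtain ⟨z, hz⟩ := (hμ' j).exists_hasEigenvector
      refine End.hasEigenvalue_of_hasEigenvector (x := (z : V)) ⟨?_, ?_⟩
      · rw [End.mem_eigenspace_iff]
        exact congrArg Subtype.val hz.apply_eq_smul
      · simpa using hz.2
    · refine Fin.cases ?_ (fun j => ?_) j
      · have h : T (b 0) - (Fin.cons μ₀ μ' : Fin (m + 1) → ℂ) 0 • b 0
            = (((s : ℂ) • y : W) : V) := by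
          rw [hb0, Fin.cons_zero, map_smul, smul_comm μ₀, ← smul_sub]
          rfl
        rw [h, hrepr]
        refine Fin.cases (by simpa using hδ.le) (fun i => ?_) i
        rw [Fin.cons_succ, map_smul, Finsupp.smul_apply, norm_smul, Complex.norm_real,
          Real.norm_eq_abs, abs_of_pos hs0]
        exact hs i
      · have h : T (b j.succ) - (Fin.cons μ₀ μ' : Fin (m + 1) → ℂ) j.succ • b j.succ
            = ((T.restrict hinv (b' j) - μ' j • b' j : W) : V) := by
          rw [hbs, Fin.cons_succ]
          rfl
        rw [h, hrepr]
        refine Fin.cases (by simpa using hδ.le) (fun i => ?_) i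
        rw [Fin.cons_succ]
        exact hb' i j

variable {V : Type*} [AddCommGroup V] [Module ℂ V] {A : End ℂ V} {S S' : Set ℂ}

theorem eigenvector_spectralBlock {x : spectralSubspace A S} {μ : ℂ}
    (hx : (spectralBlock A S).HasEigenvector μ x) : A.HasEigenvector μ (x : V) := by
  refine ⟨?_, by simpa using hx.2⟩
  rw [End.mem_eigenspace_iff]
  exact congrArg Subtype.val hx.apply_eq_smul

theorem mem_of_hasEigenvalue_spectralBlock {μ : ℂ} (h : (spectralBlock A S).HasEigenvalue μ) :
    μ ∈ S := by
  by_contra hμ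
  obtain ⟨x, hx⟩ := h.exists_hasEigenvector
  have h1 := (eigenvector_spectralBlock hx)
  have hd := A.independent_maxGenEigenspace.disjoint_biSup hμ
  exact h1.2 (Submodule.disjoint_def.1 hd _ (End.eigenspace_le_maxGenEigenspace h1.1) x.2)

theorem hasEigenvalue_spectralBlock {μ : ℂ} (hμ : μ ∈ S) {x : V} (hx : A.HasEigenvector μ x) :
    (spectralBlock A S).HasEigenvalue μ := by
  have hmem : x ∈ spectralSubspace A S :=
    le_iSup₂ (f := fun μ (_ : μ ∈ S) => A.maxGenEigenspace μ) μ hμ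
      (End.eigenspace_le_maxGenEigenspace hx.1)
  refine End.hasEigenvalue_of_hasEigenvector (x := ⟨x, hmem⟩) ⟨?_, ?_⟩
  · rw [End.mem_eigenspace_iff]
    exact Subtype.ext hx.apply_eq_smul
  · exact fun h => hx.2 (congrArg Subtype.val h)

theorem isCompl_spectralSubspace [FiniteDimensional ℂ V] (hd : Disjoint S S')
    (hS : ∀ μ, A.HasEigenvalue μ → μ ∈ S ∪ S') :
    IsCompl (spectralSubspace A S) (spectralSubspace A S') := by
  refine ⟨A.independent_maxGenEigenspace.disjoint_biSup_biSup hd, codisjoint_iff.2 ?_⟩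
  rw [eq_top_iff, ← A.iSup_maxGenEigenspace_eq_top]
  refine iSup_le fun μ => ?_
  by_cases hμ : A.HasEigenvalue μ
  · rcases hS μ hμ with h | h
    · exact (le_iSup₂ (f := fun μ (_ : μ ∈ S) => A.maxGenEigenspace μ) μ h).trans le_sup_left
    · exact (le_iSup₂ (f := fun μ (_ : μ ∈ S') => A.maxGenEigenspace μ) μ h).trans le_sup_right
  · have h : A.maxGenEigenspace μ = ⊥ := by
      by_contra hne
      refine hμ ?_
      have : A.HasUnifEigenvalue μ ⊤ := hne
      exact this.lt (by simp)
    rw [h]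
    exact bot_le

theorem norm_equivFun_apply_sub_le {κ : Type*} [Fintype κ] (b : Basis κ ℂ V) (μ : κ → ℂ) {δ : ℝ}
    (h : ∀ i j, ‖b.repr (A (b j) - μ j • b j) i‖ ≤ δ) (z : V) (i : κ) :
    ‖b.equivFun (A z) i - μ i * b.equivFun z i‖ ≤ Fintype.card κ * δ * ‖b.equivFun z‖ := by
  have : DecidableEq κ := Classical.decEq κ
  have h1 : b.equivFun (A z) i = ∑ j, b.equivFun z j * b.repr (A (b j)) i := by
    conv_lhs => rw [← b.sum_equivFun z]
    simp only [map_sum, map_smul, Finset.sum_apply, Pi.smul_apply, smul_eq_mul,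
      Basis.equivFun_apply]
  have h2 : μ i * b.equivFun z i = ∑ j, b.equivFun z j * (b.repr (μ j • b j) i) := by
    rw [Finset.sum_eq_single i]
    · simp [mul_comm]
    · intro j _ hj
      simp [Finsupp.single_eq_of_ne hj.symm]
    · simp
  rw [h1, h2, ← Finset.sum_sub_distrib]
  calc _ ≤ ∑ j : κ, ‖b.equivFun z‖ * δ := by
        refine norm_sum_le_of_le _ fun j _ => ?_
        rw [← mul_sub, norm_mul]
        have := h i j
        rw [map_sub] at this
        gcongr
        · exact norm_le_pi_norm _ j
        · exact this
    _ = _ := by rw [Finset.sum_const, Finset.card_univ, nsmul_eq_mul]; ring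

/-- A basis adapted to the splitting into the spectral parts in `S` and in `S'`: diagonal on the
first one and nearly diagonal on the second one. -/
structure IsSplitBasis (A : End ℂ V) {ι κ : Type*} [Fintype ι] [Fintype κ]
    (b : Basis (ι ⊕ κ) ℂ V) (lam : ι → ℝ) (μ : κ → ℂ) (η : ℝ) : Prop where
  pos : 0 < η
  eigenvector : ∀ j, A (b (Sum.inl j)) = (lam j : ℂ) • b (Sum.inl j)
  lt_left : ∀ j, η < |lam j|
  lt_right : ∀ j, η < |(μ j).re|
  near : ∀ z i, ‖b.equivFun (A z) i - Sum.elim (fun j => (lam j : ℂ)) μ i * b.equivFun z i‖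
    ≤ η / 2 * ‖b.equivFun z‖
  nonresonant : ∀ k : ι →₀ ℕ, 2 ≤ k.degree → ∀ z, A z = (wt lam k : ℂ) • z → z = 0

theorem wt_pos {ι : Type*} [Fintype ι] {lam : ι → ℝ} (hlam : ∀ j, 0 < lam j) {k : ι →₀ ℕ}
    (hk : k ≠ 0) : 0 < wt lam k := by
  obtain ⟨j, hj⟩ := Finsupp.ne_iff.1 hk
  refine Finset.sum_pos' (fun i _ => mul_nonneg (Nat.cast_nonneg _) (hlam i).le)
    ⟨j, Finset.mem_univ j, mul_pos ?_ (hlam j)⟩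
  exact_mod_cast Nat.pos_of_ne_zero hj

/-- The signs `s = 1` and `s = -1` treat the unstable and the stable block at once. The selected
block is diagonalizable by hypothesis; the complementary block is only brought close to diagonal
form. -/
theorem exists_isSplitBasis [FiniteDimensional ℂ V] (s : ℝ) (hA : IsHyperbolic A) (hs : s ≠ 0)
    (hS : S = {μ | 0 < s * μ.re}) (hdiag : IsDiagonalizable (spectralBlock A S))
    (hspec : HasRealSpectrum (spectralBlock A S)) (hres : IsNonresonant (spectralBlock A S)) :
    ∃ (ι : Type) (_ : Fintype ι) (m : ℕ) (b : Basis (ι ⊕ Fin m) ℂ V) (lam : ι → ℝ)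
      (μ : Fin m → ℂ) (η : ℝ), IsSplitBasis A b lam μ η ∧ (∀ j, 0 < s * lam j) ∧
        ∀ i, s * (μ i).re < 0 := by
  set S' : Set ℂ := {μ | s * μ.re < 0} with hS'
  have hcompl : IsCompl (spectralSubspace A S) (spectralSubspace A S') := by
    refine isCompl_spectralSubspace ?_ fun μ hμ => ?_
    · rw [Set.disjoint_left, hS]
      intro μ h1 h2
      exact lt_asymm (show 0 < s * μ.re from h1) h2
    · rcases lt_or_gt_of_ne (mul_ne_zero hs (hA μ hμ)) with h | h
      · exact Or.inr h
      · exact Or.inl (by rw [hS]; exact h)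
  obtain ⟨ι, bu, lamC, hbu⟩ := hdiag
  have : Finite ι := Module.Finite.finite_basis bu
  have hfin : Fintype ι := Fintype.ofFinite ι
  have hlamE : ∀ j, (spectralBlock A S).HasEigenvalue (lamC j) := fun j =>
    End.hasEigenvalue_of_hasEigenvector (x := bu j) ⟨End.mem_eigenspace_iff.2 (hbu j), bu.ne_zero j⟩
  have hlam : ∀ j, (((lamC j).re : ℝ) : ℂ) = lamC j := fun j =>
    Complex.ext (by simp) (by simpa using (hspec _ (hlamE j)).symm)
  have hev : ∀ {S : Set ℂ} {μ}, (spectralBlock A S).HasEigenvalue μ → A.HasEigenvalue μ := by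
    intro S μ h
    obtain ⟨x, hx⟩ := h.exists_hasEigenvector
    exact End.hasEigenvalue_of_hasEigenvector (eigenvector_spectralBlock hx)
  obtain ⟨η, hη, hηA⟩ : ∃ η > 0, ∀ μ, A.HasEigenvalue μ → η < |μ.re| := by
    have hf : Finite {μ | A.HasEigenvalue μ} := A.finite_hasEigenvalue
    obtain ⟨δ, hδ, h⟩ := exists_pos_le_of_finite (fun μ : {μ | A.HasEigenvalue μ} => |(μ : ℂ).re|)
      (fun μ => abs_pos.2 (hA _ μ.2))
    refine ⟨δ / 2, by positivity, fun μ hμ => ?_⟩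
    have := h ⟨μ, hμ⟩
    dsimp only at this
    linarith
  -- Entries of size `δ` perturb a coordinate by at most `dim · δ` in the maximum norm. Half of the
  -- spectral gap `η` is spent here, the other half is kept for the nonlinearity.
  obtain ⟨δ, hδ, hδη⟩ : ∃ δ > 0, ∀ m : ℕ, m ≤ finrank ℂ V → (m : ℝ) * δ ≤ η / 2 := by
    refine ⟨η / (2 * (finrank ℂ V + 1)), by positivity, fun m hm => ?_⟩
    have hm' : (m : ℝ) ≤ finrank ℂ V := by exact_mod_cast hm
    rw [mul_div_assoc', div_le_div_iff₀ (by positivity) (by positivity)]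
    nlinarith
  obtain ⟨m, bs, μ, hμ, hbs⟩ := exists_basis_near_diagonal (spectralBlock A S') hδ
  set E := Submodule.prodEquivOfIsCompl _ _ hcompl with hE
  set b : Basis (ι ⊕ Fin m) ℂ V := (bu.prod bs).map E with hb
  have hbl : ∀ j, b (Sum.inl j) = bu j := fun j => by simp [hb, hE]
  have hbr : ∀ j, b (Sum.inr j) = bs j := fun j => by simp [hb, hE]
  have hAl : ∀ j, A (b (Sum.inl j)) = ((lamC j).re : ℂ) • b (Sum.inl j) := by
    intro j
    rw [hbl, hlam]
    exact congrArg Subtype.val (hbu j)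
  have hsl : ∀ j, 0 < s * (lamC j).re := fun j => by
    have := mem_of_hasEigenvalue_spectralBlock (hlamE j)
    rwa [hS] at this
  refine ⟨ι, hfin, m, b, fun j => (lamC j).re, μ, η, ⟨hη, hAl, fun j => hηA _ (hev (hlamE j)),
    fun j => hηA _ (hev (hμ j)), ?_, ?_⟩, hsl, fun i => mem_of_hasEigenvalue_spectralBlock (hμ i)⟩
  · intro z i
    refine (norm_equivFun_apply_sub_le b _ (δ := δ) ?_ z i).trans ?_
    · rintro i (j | j)
      · simp [hAl, hδ.le]
      · have h1 : A (b (Sum.inr j)) - μ j • b (Sum.inr j)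
            = ((spectralBlock A S' (bs j) - μ j • bs j : spectralSubspace A S') : V) := by
          rw [hbr]
          rfl
        rw [Sum.elim_inr, h1]
        rcases i with i | i
        · simpa [hb, hE] using hδ.le
        · simpa [hb, hE] using hbs i j
    · gcongr
      refine hδη _ ?_
      rw [← Module.finrank_eq_card_basis b]
  · intro k hk z hz
    by_contra hz0
    have hvec : A.HasEigenvector (wt (fun j => (lamC j).re) k : ℂ) z :=
      ⟨End.mem_eigenspace_iff.2 hz, hz0⟩
    have hwt : (wt (fun j => (lamC j).re) k : ℂ) ∈ S := by
      have h1 : s * wt (fun j => (lamC j).re) k = wt (fun j => s * (lamC j).re) k := by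
        simp only [wt, Finset.mul_sum]
        exact Finset.sum_congr rfl fun j _ => by ring
      have h2 : k ≠ 0 := by rintro rfl; simp at hk
      rw [hS, Set.mem_ofPred_eq, Complex.ofReal_re, h1]
      exact wt_pos hsl h2
    have hdeg : ((k.mapDomain lamC).sum fun _ n => n) = k.degree := by
      rw [Finsupp.sum_mapDomain_index (fun _ => rfl) (fun _ _ _ => rfl), Finsupp.degree_eq_sum,
        Finsupp.sum_fintype _ _ (fun _ => rfl)]
    refine hres _ (hasEigenvalue_spectralBlock hwt hvec) (k.mapDomain lamC) ?_ (hk.trans hdeg.ge) ?_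
    · intro μ hμ
      have : DecidableEq ℂ := Classical.decEq ℂ
      obtain ⟨j, -, rfl⟩ := Finset.mem_image.1 (Finsupp.mapDomain_support hμ)
      exact hlamE j
    · rw [Finsupp.sum_mapDomain_index (fun _ => by simp) (fun _ _ _ => by push_cast; ring),
        Finsupp.sum_fintype _ _ (fun _ => by simp)]
      simp only [wt, Complex.ofReal_sum, Complex.ofReal_mul, Complex.ofReal_natCast, hlam]

/-- Reversal of time. -/
theorem IsSplitBasis.neg {ι κ : Type*} [Fintype ι] [Fintype κ] {b : Basis (ι ⊕ κ) ℂ V}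
    {lam : ι → ℝ} {μ : κ → ℂ} {η : ℝ} (h : IsSplitBasis A b lam μ η) :
    IsSplitBasis (-A) b (-lam) (-μ) η where
  pos := h.pos
  eigenvector j := by simp [h.eigenvector]
  lt_left j := by simpa using h.lt_left j
  lt_right j := by simpa using h.lt_right j
  near z i := by
    have h1 : b.equivFun ((-A) z) i
        - Sum.elim (fun j => (((-lam) j : ℝ) : ℂ)) (-μ) i * b.equivFun z i
        = -(b.equivFun (A z) i - Sum.elim (fun j => (lam j : ℂ)) μ i * b.equivFun z i) := by
      rw [LinearMap.neg_apply, map_neg]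
      rcases i with i | i
      · simp only [Pi.neg_apply, Sum.elim_inl, Complex.ofReal_neg]
        ring
      · simp only [Pi.neg_apply, Sum.elim_inr]
        ring
    rw [h1, norm_neg]
    exact h.near z i
  nonresonant k hk z hz := by
    refine h.nonresonant k hk z ?_
    have h1 : wt (-lam) k = -wt lam k := by simp [wt]
    rw [h1] at hz
    simpa using hz

end SpectralBasis

/-! ### The orbit near an equilibrium: identification with a Dirichlet series, and recurrence. -/

section Ends

theorem hasDerivAt_comp_ofReal {E : Type*} [NormedAddCommGroup E] [NormedSpace ℂ E] {G : ℂ → E}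
    {G' : E} {σ : ℝ} (h : HasDerivAt G G' (σ : ℂ)) :
    HasDerivAt (fun σ : ℝ => G (σ : ℂ)) G' σ := by
  have h1 := h.scomp σ (Complex.ofRealCLM.hasDerivAt (x := σ))
  rw [Complex.ofRealCLM_apply, Complex.ofReal_one, one_smul] at h1
  exact h1

/-- A solution of a nearly diagonal linear system on `(-∞, 0]` which tends to `0` and whose unstable
components vanish at time `0` is zero. -/
theorem eq_zero_of_near_diagonal {κ : Type*} [Fintype κ] (M : κ → ℂ) {η : ℝ} (hη0 : 0 < η)
    (hη : ∀ i, η < |(M i).re|) {w d : ℝ → κ → ℂ} (hd : ∀ σ < 0, HasDerivAt w (d σ) σ)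
    (hc : ContinuousOn w (Set.Iic 0)) (hbd : ∀ σ < 0, ∀ i, ‖d σ i - M i * w σ i‖ ≤ η * ‖w σ‖)
    (h0 : ∀ i, 0 < (M i).re → w 0 i = 0) (hlim : Tendsto w atBot (𝓝 0)) {σ₁ : ℝ} (hσ₁ : σ₁ ≤ 0) :
    w σ₁ = 0 := by
  by_contra hne
  have hm : 0 < ‖w σ₁‖ := norm_pos_iff.2 hne
  -- As `w` tends to `0` at `-∞`, its norm attains a maximum over `(-∞, 0]` at some `s`, and some
  -- component `i` realizes this norm.
  obtain ⟨R, hR⟩ := eventually_atBot.1 ((tendsto_zero_iff_norm_tendsto_zero.1 hlim).eventually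
    (gt_mem_nhds hm))
  have hRmin : min R σ₁ ≤ 0 := (min_le_right _ _).trans hσ₁
  obtain ⟨s, hs, hmax⟩ := isCompact_Icc.exists_isMaxOn (Set.nonempty_Icc.2 hRmin)
    (hc.norm.mono (fun x hx => hx.2 : Set.Icc (min R σ₁) 0 ⊆ Set.Iic 0))
  have hle1 : ‖w σ₁‖ ≤ ‖w s‖ := hmax ⟨min_le_right _ _, hσ₁⟩
  have hle : ∀ σ ≤ 0, ‖w σ‖ ≤ ‖w s‖ := by
    intro σ hσ
    rcases le_or_gt (min R σ₁) σ with h | h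
    · exact hmax ⟨h, hσ⟩
    · exact (hR σ (h.le.trans (min_le_left _ _))).le.trans hle1
  have hpos : 0 < ‖w s‖ := hm.trans_le hle1
  obtain ⟨i, hi⟩ : ∃ i, ‖w s i‖ = ‖w s‖ := by
    by_contra! h
    exact lt_irrefl _ ((pi_norm_lt_iff hpos).2 fun i => lt_of_le_of_ne (norm_le_pi_norm _ i) (h i))
  set φ : ℝ → ℝ := fun σ => (w σ i).re * (w σ i).re + (w σ i).im * (w σ i).im with hφ
  set ψ : ℝ → ℝ := fun σ => (w σ i).re * (d σ i).re + (w σ i).im * (d σ i).im with hψ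
  have hφn : ∀ σ, φ σ = ‖w σ i‖ ^ 2 := fun σ => by
    rw [← Complex.normSq_eq_norm_sq, Complex.normSq_apply]
  have hφd : ∀ σ < 0, HasDerivAt φ (2 * ψ σ) σ := by
    intro σ hσ
    have h1 := hasDerivAt_pi.1 (hd σ hσ) i
    have h2 : HasDerivAt (fun σ => (w σ i).re) (d σ i).re σ :=
      Complex.reCLM.hasFDerivAt.comp_hasDerivAt σ h1
    have h3 : HasDerivAt (fun σ => (w σ i).im) (d σ i).im σ :=
      Complex.imCLM.hasFDerivAt.comp_hasDerivAt σ h1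
    refine ((h2.mul h2).add (h3.mul h3)).congr_deriv ?_
    simp only [hψ]
    ring
  have hψb : ∀ σ < 0, |ψ σ - (M i).re * ‖w σ i‖ ^ 2| ≤ ‖w σ i‖ * (η * ‖w s‖) := by
    intro σ hσ
    have h1 : ψ σ - (M i).re * ‖w σ i‖ ^ 2
        = ((starRingEnd ℂ) (w σ i) * (d σ i - M i * w σ i)).re := by
      rw [← hφn]
      simp only [hψ, hφ, Complex.mul_re, Complex.sub_re, Complex.sub_im, Complex.conj_re,
        Complex.conj_im, Complex.mul_im]
      ring
    rw [h1]
    refine (Complex.abs_re_le_norm _).trans ?_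
    rw [norm_mul, Complex.norm_conj]
    have h2 := hbd σ hσ i
    have h3 := hle σ hσ.le
    gcongr
    exact h2.trans (by gcongr)
  -- For `s < 0` the derivative of `|w_i|²` vanishes at `s`, although its leading term `|Re M_i|
  -- |w|²` exceeds the perturbation `η |w|²`. For `s = 0` the component `i` is stable, so `|w_i|²`
  -- strictly decreases just before `0`, against maximality.
  rcases hs.2.lt_or_eq with hs0 | hs0
  · have hloc : IsLocalMax φ s := by
      filter_upwards [Iio_mem_nhds hs0] with σ hσ
      rw [hφn, hφn, hi]
      have := (norm_le_pi_norm (w σ) i).trans (hle σ (le_of_lt hσ))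
      gcongr
    have hψ0 : ψ s = 0 := by
      have := hloc.hasDerivAt_eq_zero (hφd s hs0)
      linarith
    have h1 := hψb s hs0
    rw [hψ0, hi, zero_sub, abs_neg, abs_mul, abs_of_nonneg (sq_nonneg ‖w s‖)] at h1
    have h2 := hη i
    have h3 : 0 < ‖w s‖ ^ 2 := by positivity
    nlinarith
  · subst hs0
    have hM : (M i).re < 0 := by
      by_contra! h
      have h1 := hη i
      rw [abs_of_nonneg h] at h1
      have h2 := h0 i (hη0.trans h1)
      rw [h2, norm_zero] at hi
      exact hpos.ne hi
    have hηi := hη i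
    rw [abs_of_neg hM] at hηi
    have hci : ContinuousWithinAt (fun σ => ‖w σ i‖) (Set.Iic 0) 0 :=
      ((continuous_apply i).continuousAt.comp_continuousWithinAt (hc 0 Set.self_mem_Iic)).norm
    have hev : ∀ᶠ σ in 𝓝[≤] (0 : ℝ), η * ‖w 0‖ < -(M i).re * ‖w σ i‖ := by
      have h1 : Tendsto (fun σ => -(M i).re * ‖w σ i‖) (𝓝[≤] (0 : ℝ)) (𝓝 (-(M i).re * ‖w 0 i‖)) :=
        hci.tendsto.const_mul _
      refine h1.eventually (lt_mem_nhds ?_)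
      rw [hi]
      gcongr
    obtain ⟨l, hl, hlε⟩ := mem_nhdsLE_iff_exists_Icc_subset.1 hev
    have hcφ : ContinuousOn φ (Set.Icc l 0) := by
      have h1 : ContinuousOn (fun σ => ‖w σ i‖ ^ 2) (Set.Icc l 0) :=
        ((((continuous_apply i).comp_continuousOn hc).norm.pow 2).mono fun x hx => hx.2)
      exact h1.congr fun σ _ => hφn σ
    have hanti := strictAntiOn_of_deriv_neg (convex_Icc l 0) hcφ (by
      intro σ hσ
      rw [interior_Icc] at hσ
      rw [(hφd σ hσ.2).deriv]
      have h1 : η * ‖w 0‖ < -(M i).re * ‖w σ i‖ := hlε ⟨hσ.1.le, hσ.2.le⟩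
      have h2 := (abs_le.1 (hψb σ hσ.2)).2
      have h3 : 0 < ‖w σ i‖ := by
        by_contra! h
        have h4 : ‖w σ i‖ = 0 := le_antisymm h (norm_nonneg _)
        rw [h4, mul_zero] at h1
        exact absurd h1 (not_lt.2 (by positivity))
      nlinarith)
    have hl' : l ≤ 0 := le_of_lt hl
    have h1 := hanti (Set.left_mem_Icc.2 hl') (Set.right_mem_Icc.2 hl') hl
    rw [hφn, hφn, hi] at h1
    have h2 := (norm_le_pi_norm (w l) i).trans (hle l hl')
    have h3 := pow_le_pow_left₀ (norm_nonneg _) h2 2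
    linarith

variable {N : ℕ} {ι : Type*} [Fintype ι] {lam : ι → ℝ} {a : (ι →₀ ℕ) → Phase N}

theorem continuousOn_dirichlet (hlam : ∀ j, 0 < lam j) (z₀ : Phase N)
    (ha : Summable fun k => ‖a k‖) : ContinuousOn (dirichlet lam z₀ a) {t | t.re ≤ 0} := by
  refine continuousOn_const.add (continuousOn_tsum (fun k => by fun_prop) ha fun k t ht => ?_)
  rw [norm_smul]
  exact mul_le_of_le_one_left (norm_nonneg _) (norm_exp_wt_le hlam ht k)

theorem norm_dirichlet_sub_le (hlam : ∀ j, 0 < lam j) (z₀ : Phase N)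
    (ha : Summable fun k => ‖a k‖) {t : ℂ} (ht : t.re ≤ 0) :
    ‖dirichlet lam z₀ a t - z₀‖ ≤ ∑' k, ‖a k‖ := by
  rw [dirichlet, add_sub_cancel_left]
  refine tsum_of_norm_bounded ha.hasSum fun k => ?_
  rw [norm_smul]
  exact mul_le_of_le_one_left (norm_nonneg _) (norm_exp_wt_le hlam ht k)

theorem tendsto_dirichlet_atBot (hlam : ∀ j, 0 < lam j) (z₀ : Phase N)
    (ha : Summable fun k => ‖a k‖) (ha0 : a 0 = 0) :
    Tendsto (fun σ : ℝ => dirichlet lam z₀ a σ) atBot (𝓝 z₀) := by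
  have h : Tendsto (fun σ : ℝ => ∑' k, Complex.exp (wt lam k * σ) • a k) atBot
      (𝓝 (∑' _ : ι →₀ ℕ, (0 : Phase N))) := by
    refine tendsto_tsum_of_dominated_convergence ha (fun k => ?_) ?_
    · by_cases hk : k = 0
      · simp [hk, ha0]
      · have h1 : Tendsto (fun σ : ℝ => Complex.exp (wt lam k * σ)) atBot (𝓝 0) := by
          rw [tendsto_zero_iff_norm_tendsto_zero]
          have h2 : ∀ σ : ℝ, ‖Complex.exp (wt lam k * σ)‖ = Real.exp (wt lam k * σ) := fun σ => by
            rw [Complex.norm_exp]; simp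
          simp only [h2]
          exact Real.tendsto_exp_atBot.comp (tendsto_id.const_mul_atBot (wt_pos hlam hk))
        simpa using h1.smul_const (a k)
    · filter_upwards [eventually_le_atBot 0] with σ hσ k
      rw [norm_smul]
      exact mul_le_of_le_one_left (norm_nonneg _) (norm_exp_wt_le hlam (by simpa using hσ) k)
  simpa [dirichlet] using h.const_add z₀

/-- In the imaginary direction, Dirichlet series are recurrent. -/
theorem dirichlet_recurrent (hlam : ∀ j, 0 < lam j) (z₀ : Phase N)
    (ha : Summable fun k => ‖a k‖) {s : ℂ} (hs : s.re ≤ 0) (T : ℝ) {ε : ℝ} (hε : 0 < ε) :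
    ∃ τ ≥ T, ‖dirichlet lam z₀ a (s + τ * Complex.I) - dirichlet lam z₀ a s‖ < ε := by
  -- On a vertical line the series is a continuous function on a torus, evaluated along the
  -- one-parameter subgroup `τ ↦ (e^{i λ_j τ})`. Real frequencies are essential here.
  set Φ : (ι → Circle) → Phase N := fun x =>
    z₀ + ∑' k, ((∏ j, (x j : ℂ) ^ k j) * Complex.exp (wt lam k * s)) • a k with hΦ
  have hΦc : Continuous Φ := by
    refine continuous_const.add (continuous_tsum (fun k => by fun_prop) ha fun k x => ?_)
    rw [norm_smul, norm_mul, norm_prod]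
    simp only [norm_pow, Circle.norm_coe, one_pow, Finset.prod_const_one, one_mul]
    exact mul_le_of_le_one_left (norm_nonneg _) (norm_exp_wt_le hlam hs k)
  have hΦτ : ∀ τ : ℝ, Φ (fun j => Circle.exp (lam j * τ))
      = dirichlet lam z₀ a (s + τ * Complex.I) := by
    intro τ
    simp only [hΦ, dirichlet]
    congr 1
    refine tsum_congr fun k => ?_
    congr 1
    simp only [Circle.coe_exp, ← Complex.exp_nat_mul]
    rw [← Complex.exp_sum, ← Complex.exp_add]
    congr 1
    rw [mul_add, add_comm]
    congr 1
    simp only [wt, Complex.ofReal_sum, Complex.ofReal_mul, Complex.ofReal_natCast, Finset.sum_mul]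
    exact Finset.sum_congr rfl fun j _ => by ring
  set T' := max T 1 with hT'
  have hT1 : 1 ≤ T' := le_max_right _ _
  -- Powers of an element of a compact group accumulate at the identity. The time step is at least
  -- `T`, so any power with `n ≥ 1` meets the lower bound on `τ`.
  have hclus := mapClusterPt_one_atTop_pow (fun j => Circle.exp (lam j * T') : ι → Circle)
  have hU : {x | ‖Φ x - Φ 1‖ < ε} ∈ 𝓝 (1 : ι → Circle) := by
    have h1 : Tendsto (fun x => ‖Φ x - Φ 1‖) (𝓝 1) (𝓝 ‖Φ 1 - Φ 1‖) :=
      ((hΦc.sub continuous_const).norm).tendsto 1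
    rw [sub_self, norm_zero] at h1
    exact h1.eventually (gt_mem_nhds hε)
  obtain ⟨n, hn, hn1⟩ := ((hclus.frequently hU).and_eventually (eventually_ge_atTop 1)).exists
  have hpow : (fun j => Circle.exp (lam j * T') : ι → Circle) ^ n
      = fun j => Circle.exp (lam j * (n * T' : ℝ)) := by
    funext j
    rw [Pi.pow_apply]
    ext
    simp only [Circle.coe_pow, Circle.coe_exp, ← Complex.exp_nat_mul]
    congr 1
    push_cast
    ring
  have hn' : ‖Φ ((fun j => Circle.exp (lam j * T') : ι → Circle) ^ n) - Φ 1‖ < ε := hn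
  have h1 : Φ 1 = dirichlet lam z₀ a s := by
    have h2 := hΦτ 0
    have h3 : (fun j => Circle.exp (lam j * 0)) = (1 : ι → Circle) := by
      funext j
      simp
    rw [h3] at h2
    simpa using h2
  rw [hpow, hΦτ, h1] at hn'
  refine ⟨n * T', ?_, hn'⟩
  have hn2 : (1 : ℝ) ≤ n := by exact_mod_cast hn1
  calc T ≤ T' := le_max_left _ _
    _ = 1 * T' := (one_mul _).symm
    _ ≤ n * T' := by gcongr

variable {κ : Type*} [Fintype κ] {f : Phase N → Phase N}

/-- Far in the past `Γ` is so close to `v` that some small Dirichlet solution has the same unstable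
coordinates at that moment. The difference tends to `0` at `-∞` and solves a nearly diagonal system
with vanishing unstable part at the final time, so it is zero. No unstable manifold theorem is
needed. -/
theorem exists_dirichlet_eq (hf : Differentiable ℂ f) {v : Phase N} (hv : f v = 0)
    {b : Module.Basis (ι ⊕ κ) ℂ (Phase N)} {μ : κ → ℂ} {η : ℝ}
    (hb : IsSplitBasis (linearization f v) b lam μ η) (hlam : ∀ j, 0 < lam j)
    (hμ : ∀ i, (μ i).re < 0) {Γ : ℝ → Phase N} (hΓ : ∀ σ, HasDerivAt Γ (f (Γ σ)) σ)
    (hlim : Tendsto Γ atBot (𝓝 v)) :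
    ∃ (R : ℝ) (a : (ι →₀ ℕ) → Phase N), (Summable fun k => ‖a k‖) ∧
      (∀ t, t.re < 0 → HasDerivAt (dirichlet lam v a) (f (dirichlet lam v a t)) t) ∧
      ∀ σ ≤ 0, dirichlet lam v a (σ : ℝ) = Γ (σ + R) := by
  have : DecidableEq ι := Classical.decEq ι
  set e : Phase N ≃L[ℂ] (ι ⊕ κ → ℂ) := b.equivFun.toContinuousLinearEquiv with he
  have hee : ∀ z, e z = b.equivFun z := fun z => rfl
  set eL : Phase N →L[ℂ] (ι ⊕ κ → ℂ) := e.toContinuousLinearMap with heL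
  set eS : (ι ⊕ κ → ℂ) →L[ℂ] Phase N := e.symm.toContinuousLinearMap with heS
  -- The tolerance for the nonlinear remainder, chosen such that it costs at most `η / 2` after
  -- passing to the coordinates `e`.
  set c : ℝ := η / 2 / (‖eL‖ * ‖eS‖ + 1) with hcdef
  have hη := hb.pos
  have hc : 0 < c := by positivity
  have hcle : ‖eL‖ * c * ‖eS‖ ≤ η / 2 := by
    rw [hcdef, mul_div_assoc', div_mul_eq_mul_div, div_le_iff₀ (by positivity)]
    nlinarith
  obtain ⟨ρ, hρ, hρf⟩ : ∃ ρ > 0, ∀ x ∈ Metric.ball v ρ, ∀ y ∈ Metric.ball v ρ,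
      ‖f x - f y - fderiv ℂ f v (x - y)‖ ≤ c * ‖x - y‖ := by
    have h := (hasStrictFDerivAt_of_differentiable hf v).isLittleO.bound hc
    rw [nhds_prod_eq] at h
    obtain ⟨ρ, hρ, h⟩ := Metric.eventually_nhds_iff_ball.1 (nhds_prod_eq (x := v) (y := v) ▸ h)
    refine ⟨ρ, hρ, fun x hx y hy => h (x, y) ?_⟩
    rw [← ball_prod_same]
    exact ⟨hx, hy⟩
  set π : Phase N →L[ℂ] (ι → ℂ) := ContinuousLinearMap.pi fun j =>
    (ContinuousLinearMap.proj (Sum.inl j)).comp eL with hπ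
  have hπa : ∀ z j, π z j = b.equivFun z (Sum.inl j) := fun z j => rfl
  have hsol := exists_dirichlet_solution hf hv (fun j => b (Sum.inl j)) hlam hb.eigenvector
    hb.nonresonant π (fun j => by
      funext i
      rw [hπa, Module.Basis.equivFun_apply, Module.Basis.repr_self]
      by_cases hij : j = i
      · subst hij; simp
      · rw [Pi.single_eq_of_ne (Ne.symm hij), Finsupp.single_eq_of_ne]
        simpa using Ne.symm hij) (ε := ρ / 2) (by positivity)
  have hξ : Tendsto (fun R => π (Γ R - v)) atBot (𝓝 0) := by
    have h1 := (π.continuous.tendsto (v - v)).comp (hlim.sub_const v)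
    rwa [sub_self, map_zero] at h1
  obtain ⟨R₀, hR₀⟩ := eventually_atBot.1 (hlim.eventually (Metric.ball_mem_nhds v hρ))
  obtain ⟨R, ⟨a, ha, haε, ha0, hode, hξa⟩, hR⟩ :=
    ((hξ.eventually hsol).and (eventually_le_atBot R₀)).exists
  refine ⟨R, a, ha, hode, ?_⟩
  set D : ℝ → Phase N := fun σ => dirichlet lam v a (σ : ℝ) with hD
  have hDball : ∀ σ ≤ 0, D σ ∈ Metric.ball v ρ := by
    intro σ hσ
    rw [mem_ball_iff_norm]
    refine ((norm_dirichlet_sub_le hlam v ha (by simpa using hσ)).trans haε).trans_lt ?_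
    linarith
  have hΓball : ∀ σ ≤ 0, Γ (σ + R) ∈ Metric.ball v ρ := fun σ hσ => hR₀ _ (by linarith)
  have hΓd : ∀ σ, HasDerivAt (fun σ => Γ (σ + R)) (f (Γ (σ + R))) σ :=
    fun σ => (hΓ (σ + R)).comp_add_const σ R
  have hDd : ∀ σ < 0, HasDerivAt D (f (D σ)) σ := fun σ hσ =>
    hasDerivAt_comp_ofReal (hode (σ : ℂ) (by simpa using hσ))
  have heR : ∀ (g : ℝ → Phase N) g' σ, HasDerivAt g g' σ →
      HasDerivAt (fun σ => e (g σ)) (e g') σ := fun g g' σ h =>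
    (eL.restrictScalars ℝ).hasFDerivAt.comp_hasDerivAt σ h
  have hDc : ContinuousOn D (Set.Iic 0) :=
    (continuousOn_dirichlet hlam v ha).comp Complex.continuous_ofReal.continuousOn
      fun σ hσ => by simpa using hσ
  have key := fun σ (hσ : σ ≤ 0) => eq_zero_of_near_diagonal
    (Sum.elim (fun j => (lam j : ℂ)) μ) hη
    (w := fun σ => e (Γ (σ + R) - D σ)) (d := fun σ => e (f (Γ (σ + R)) - f (D σ)))
    (by rintro (j | i)
        · simpa using hb.lt_left j
        · exact hb.lt_right i)
    (fun σ hσ => heR _ _ _ ((hΓd σ).sub (hDd σ hσ)))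
    (e.continuous.comp_continuousOn
      (((continuous_iff_continuousAt.2 fun σ => (hΓd σ).continuousAt).continuousOn).sub hDc))
    (by
      intro σ hσ i
      set z := Γ (σ + R) - D σ with hz
      have h1 := hb.near z i
      have h2 := hρf _ (hΓball σ hσ.le) _ (hDball σ hσ.le)
      have h3 : ‖e (f (Γ (σ + R)) - f (D σ) - fderiv ℂ f v z)‖ ≤ η / 2 * ‖e z‖ := by
        have h4 : ‖z‖ ≤ ‖eS‖ * ‖e z‖ := by
          have := eS.le_opNorm (e z)
          rwa [heS, ContinuousLinearEquiv.coe_coe, ContinuousLinearEquiv.symm_apply_apply] at this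
        calc _ ≤ ‖eL‖ * ‖f (Γ (σ + R)) - f (D σ) - fderiv ℂ f v z‖ := eL.le_opNorm _
          _ ≤ ‖eL‖ * (c * (‖eS‖ * ‖e z‖)) := by
            refine mul_le_mul_of_nonneg_left (h2.trans ?_) (norm_nonneg _)
            exact mul_le_mul_of_nonneg_left h4 hc.le
          _ = (‖eL‖ * c * ‖eS‖) * ‖e z‖ := by ring
          _ ≤ _ := by gcongr
      have h5 := (norm_le_pi_norm _ i).trans h3
      have h6 : e (f (Γ (σ + R)) - f (D σ)) i
          - Sum.elim (fun j => (lam j : ℂ)) μ i * e z i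
          = e (f (Γ (σ + R)) - f (D σ) - fderiv ℂ f v z) i + (b.equivFun (linearization f v z) i
            - Sum.elim (fun j => (lam j : ℂ)) μ i * e z i) := by
        rw [map_sub e _ (fderiv ℂ f v z), Pi.sub_apply, hee (fderiv ℂ f v z)]
        have h7 : linearization f v z = fderiv ℂ f v z := rfl
        rw [h7]
        ring
      rw [h6]
      refine (norm_add_le _ _).trans ?_
      rw [← hee z] at h1
      linarith)
    (by
      rintro (j | i) hi
      · have h1 := congrFun hξa j
        rw [hπa, hπa] at h1
        have h2 : Γ (0 + R) - D 0 = (Γ R - v) - (dirichlet lam v a 0 - v) := by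
          simp only [hD, zero_add, Complex.ofReal_zero]
          abel
        rw [h2, hee, map_sub, Pi.sub_apply, h1, sub_self]
      · exact absurd hi (hμ i).not_gt)
    (by
      have h1 : Tendsto (fun σ => Γ (σ + R) - D σ) atBot (𝓝 (v - v)) :=
        (hlim.comp (tendsto_atBot_add_const_right _ R tendsto_id)).sub
          (tendsto_dirichlet_atBot hlam v ha ha0)
      rw [sub_self] at h1
      have h2 := (e.continuous.tendsto 0).comp h1
      rwa [map_zero] at h2)
    hσ
  intro σ hσ
  have h := key σ hσ
  rw [EmbeddingLike.map_eq_zero_iff, sub_eq_zero] at h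
  exact h.symm

end Ends

/-! ### Schwarz reflection, continuation to strips and a priori bounds. -/

section Continuation

variable {N : ℕ} {f : Phase N → Phase N}

theorem isRealPoint_iff_star_eq {z : Phase N} : IsRealPoint z ↔ star z = z := by
  simp only [IsRealPoint, funext_iff, Pi.star_apply, ← Complex.conj_eq_iff_im]
  rfl

/-- Schwarz reflection. -/
theorem map_star_of_real (hf : Differentiable ℂ f)
    (hfreal : ∀ z, IsRealPoint z → IsRealPoint (f z)) (z : Phase N) : f (star z) = star (f z) := by
  set x : Phase N := fun i => ((z i).re : ℂ) with hx
  set y : Phase N := fun i => ((z i).im : ℂ) with hy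
  have hxs : star x = x := isRealPoint_iff_star_eq.1 fun i => by simp [hx]
  have hys : star y = y := isRealPoint_iff_star_eq.1 fun i => by simp [hy]
  have hz : z = x + Complex.I • y := by
    funext i
    simp only [hx, hy, Pi.add_apply, Pi.smul_apply, smul_eq_mul]
    rw [mul_comm]
    exact (Complex.re_add_im (z i)).symm
  -- With `z = x + i y` and real `x`, `y`, restrict `f` to the complex line `s ↦ x + s y`. The
  -- reflected restriction agrees with it on real `s`, hence everywhere; `s = -i` gives the claim.
  set g : ℂ → Phase N := fun s => f (x + s • y) with hg
  have hgd : Differentiable ℂ g := hf.comp ((differentiable_id.smul_const y).const_add x)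
  set h : ℂ → Phase N := star ∘ g ∘ (starRingEnd ℂ) with hh
  have hhd : Differentiable ℂ h := fun s =>
    differentiableAt_star_conj_iff.2 (hgd _)
  have hreal : ∀ s : ℝ, h s = g s := by
    intro s
    have h1 : IsRealPoint (x + (s : ℂ) • y) := fun i => by simp [hx, hy]
    have h2 := isRealPoint_iff_star_eq.1 (hfreal _ h1)
    simp only [hh, hg, Function.comp_apply, Complex.conj_ofReal]
    exact h2
  have heq : h = g := by
    refine AnalyticOnNhd.eq_of_frequently_eq (z₀ := 0) (fun s _ => hhd.analyticAt s)
      (fun s _ => hgd.analyticAt s) ?_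
    have ht : Tendsto (fun s : ℝ => (s : ℂ)) (𝓝[≠] 0) (𝓝[≠] 0) := by
      refine tendsto_nhdsWithin_iff.2 ⟨?_, ?_⟩
      · have := Complex.continuous_ofReal.tendsto 0
        rw [Complex.ofReal_zero] at this
        exact this.mono_left nhdsWithin_le_nhds
      · filter_upwards [self_mem_nhdsWithin] with s hs
        simpa using hs
    exact ht.frequently (Frequently.of_forall hreal)
  have h1 := congrFun heq (-Complex.I)
  simp only [hh, hg, Function.comp_apply, map_neg, Complex.conj_I, neg_neg] at h1
  rw [← hz] at h1
  rw [h1]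
  congr 1
  conv_lhs => rw [hz]
  rw [star_add, star_smul, hxs, hys, Complex.star_def, Complex.conj_I]

/-- The strip of width `2η` about the real axis. -/
def strip (η : ℝ) : Set ℂ := {t | |t.im| < η}

theorem isOpen_strip (η : ℝ) : IsOpen (strip η) :=
  isOpen_lt (Complex.continuous_im.abs) continuous_const

theorem convex_strip (η : ℝ) : Convex ℝ (strip η) := by
  have : strip η = Complex.imLm ⁻¹' Metric.ball (0 : ℝ) η := by
    ext t
    simp [strip]
  rw [this]
  exact (convex_ball (0 : ℝ) η).linear_preimage _

theorem ofReal_mem_strip {η : ℝ} (hη : 0 < η) (σ : ℝ) : (σ : ℂ) ∈ strip η := by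
  simpa [strip] using hη

theorem strip_mono {η η' : ℝ} (h : η ≤ η') : strip η ⊆ strip η' := fun _ ht => lt_of_lt_of_le ht h

theorem conj_mem_strip {η : ℝ} {t : ℂ} (ht : t ∈ strip η) : (starRingEnd ℂ) t ∈ strip η := by
  simpa [strip] using ht

/-- Scaling the imaginary part by `η / (η + r)` moves a point of the wider strip into the narrower
one, by a distance less than `r`. -/
theorem strip_subset_thickening {η r : ℝ} (hη : 0 < η) (hr : 0 < r) :
    strip (η + r) ⊆ Metric.thickening r (strip η) := by
  intro t ht
  have ht : |t.im| < η + r := ht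
  refine Metric.mem_thickening_iff.2
    ⟨(t.re : ℂ) + ((t.im * (η / (η + r)) : ℝ) : ℂ) * Complex.I, ?_, ?_⟩
  · have h1 : ((t.re : ℂ) + ((t.im * (η / (η + r)) : ℝ) : ℂ) * Complex.I).im
        = t.im * (η / (η + r)) := by
      simp only [Complex.add_im, Complex.ofReal_im, Complex.mul_im, Complex.ofReal_re,
        Complex.I_im, Complex.I_re]
      ring
    change |_| < η
    rw [h1, abs_mul, abs_of_pos (by positivity : 0 < η / (η + r)), mul_div_assoc',
      div_lt_iff₀ (by positivity), mul_comm]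
    gcongr
  · have h1 : t - ((t.re : ℂ) + ((t.im * (η / (η + r)) : ℝ) : ℂ) * Complex.I)
        = ((t.im * (r / (η + r)) : ℝ) : ℂ) * Complex.I := by
      have h2 : (η : ℂ) + r ≠ 0 := by exact_mod_cast (by positivity : η + r ≠ 0)
      conv_lhs => rw [← Complex.re_add_im t]
      simp only [Complex.add_re, Complex.ofReal_re, Complex.mul_re, Complex.I_re, Complex.ofReal_im,
        Complex.I_im, Complex.add_im, Complex.mul_im]
      push_cast
      field_simp
      ring
    rw [dist_eq_norm, h1, norm_mul, Complex.norm_I, mul_one, Complex.norm_real, Real.norm_eq_abs,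
      abs_mul, abs_of_pos (by positivity : 0 < r / (η + r)), mul_div_assoc',
      div_lt_iff₀ (by positivity), mul_comm]
    gcongr

/-- `G` is a solution on `S` which continues `Γ`. -/
structure Continues (f : Phase N → Phase N) (Γ : ℝ → Phase N) (S : Set ℂ) (G : ℂ → Phase N) :
    Prop where
  solution : ∀ t ∈ S, HasDerivAt G (f (G t)) t
  eq_on_real : ∀ σ : ℝ, (σ : ℂ) ∈ S → G σ = Γ σ

variable {Γ : ℝ → Phase N}

theorem Continues.eqOn (hf : Differentiable ℂ f) {S S' : Set ℂ} {G G' : ℂ → Phase N}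
    (h : Continues f Γ S G) (h' : Continues f Γ S' G') (hS : Convex ℝ S) (hS' : Convex ℝ S')
    {σ : ℝ} (hσ : (σ : ℂ) ∈ S) (hσ' : (σ : ℂ) ∈ S') {t : ℂ} (ht : t ∈ S) (ht' : t ∈ S') :
    G t = G' t :=
  solution_unique hf (hS.inter hS') (fun s hs => (h.solution s hs.1).hasDerivWithinAt)
    (fun s hs => (h'.solution s hs.2).hasDerivWithinAt) ⟨hσ, hσ'⟩ ⟨ht, ht'⟩
    ((h.eq_on_real σ hσ).trans (h'.eq_on_real σ hσ').symm)

theorem Continues.mono {S S' : Set ℂ} {G : ℂ → Phase N} (h : Continues f Γ S G) (hS : S' ⊆ S) :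
    Continues f Γ S' G :=
  ⟨fun t ht => h.solution t (hS ht), fun σ hσ => h.eq_on_real σ (hS hσ)⟩

/-- Continuations to strips of different widths have a common extension. -/
theorem exists_common_continuation (hf : Differentiable ℂ f) {I : Set ℝ}
    (hI : ∀ η ∈ I, 0 < η ∧ ∃ G, Continues f Γ (strip η) G) :
    ∃ G, ∀ η ∈ I, Continues f Γ (strip η) G := by
  have h1 : ∀ η : ℝ, ∃ G, η ∈ I → Continues f Γ (strip η) G := by
    intro η
    by_cases hη : η ∈ I
    · obtain ⟨G, hG⟩ := (hI η hη).2
      exact ⟨G, fun _ => hG⟩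
    · exact ⟨0, fun h => absurd h hη⟩
  choose Gs hGs using h1
  have h2 : ∀ t : ℂ, ∃ η : ℝ, (∃ η' ∈ I, t ∈ strip η') → η ∈ I ∧ t ∈ strip η := by
    intro t
    by_cases ht : ∃ η' ∈ I, t ∈ strip η'
    · obtain ⟨η, hη⟩ := ht
      exact ⟨η, fun _ => hη⟩
    · exact ⟨0, fun h => absurd h ht⟩
  choose w hw using h2
  have h3 : ∀ η ∈ I, ∀ t ∈ strip η, Gs (w t) t = Gs η t := by
    intro η hη t ht
    obtain ⟨h4, h5⟩ := hw t ⟨η, hη, ht⟩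
    exact (hGs _ h4).eqOn hf (hGs _ hη) (convex_strip _) (convex_strip _)
      (ofReal_mem_strip (hI _ h4).1 0) (ofReal_mem_strip (hI _ hη).1 0) h5 ht
  refine ⟨fun t => Gs (w t) t, fun η hη => ⟨fun t ht => ?_, fun σ hσ => ?_⟩⟩
  · rw [h3 η hη t ht]
    refine ((hGs η hη).solution t ht).congr_of_eventuallyEq ?_
    filter_upwards [(isOpen_strip η).mem_nhds ht] with s hs
    exact h3 η hη s hs
  · rw [h3 η hη _ hσ]
    exact (hGs η hη).eq_on_real σ hσ

/-- Reflection of solutions. -/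
theorem Continues.conj (hf : Differentiable ℂ f) (hconj : ∀ z, f (star z) = star (f z))
    (hΓ : ∀ σ, IsRealPoint (Γ σ)) {η : ℝ} (hη : 0 < η) {G : ℂ → Phase N}
    (h : Continues f Γ (strip η) G) {t : ℂ} (ht : t ∈ strip η) :
    G ((starRingEnd ℂ) t) = star (G t) := by
  -- The reflected function is again a continuation of the real orbit, so uniqueness applies.
  have h' : Continues f Γ (strip η) (star ∘ G ∘ (starRingEnd ℂ)) := by
    refine ⟨fun t ht => ?_, fun σ hσ => ?_⟩
    · rw [hasDerivAt_star_conj_iff]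
      simp only [Function.comp_apply]
      rw [hconj, star_star]
      exact h.solution _ (conj_mem_strip ht)
    · simp only [Function.comp_apply, Complex.conj_ofReal]
      rw [h.eq_on_real σ hσ]
      exact isRealPoint_iff_star_eq.1 (hΓ σ)
  have h1 := h.eqOn hf h' (convex_strip η) (convex_strip η) (ofReal_mem_strip hη 0)
    (ofReal_mem_strip hη 0) (conj_mem_strip ht) (conj_mem_strip ht)
  simpa using h1

/-- The real axis is a convex set in `ℂ`, on which `Γ ∘ re` solves the equation relative to that
set. Boundedness of `Γ` gives an extension to a uniform neighborhood, which is a strip. -/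
theorem exists_initial_continuation (hf : Differentiable ℂ f)
    (hΓ : ∀ σ, HasDerivAt Γ (f (Γ σ)) σ) {C : ℝ} (hC : ∀ σ, ‖Γ σ‖ ≤ C) :
    ∃ η > 0, ∃ G, Continues f Γ (strip η) G := by
  set S : Set ℂ := {t | t.im = 0} with hS
  have hconv : Convex ℝ S := by
    have : S = Complex.imLm ⁻¹' {(0 : ℝ)} := by
      ext t
      simp [hS]
    rw [this]
    exact (convex_singleton (0 : ℝ)).linear_preimage _
  have hd : ∀ t ∈ S, HasDerivWithinAt (fun t : ℂ => Γ t.re) (f (Γ t.re)) S t := by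
    intro t ht
    have h1 := (hasDerivAt_iff_isLittleO.1 (hΓ t.re)).comp_tendsto
      ((Complex.continuous_re.tendsto t).mono_left (nhdsWithin_le_nhds (s := S)))
    have hre : ∀ s ∈ S, s - t = ((s.re - t.re : ℝ) : ℂ) := fun s hs =>
      Complex.ext (by simp) (by
        have hs : s.im = 0 := hs
        have ht : t.im = 0 := ht
        simp [hs, ht])
    rw [hasDerivWithinAt_iff_isLittleO]
    have h2 : (fun s : ℂ => s - t) =ᶠ[𝓝[S] t] fun s => ((s.re - t.re : ℝ) : ℂ) := by
      filter_upwards [self_mem_nhdsWithin] with s hs using hre s hs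
    refine Asymptotics.IsLittleO.congr' ?_ ?_ h2.symm
      (f₁ := fun s : ℂ => Γ s.re - Γ t.re - (s.re - t.re) • f (Γ t.re))
    · refine (Asymptotics.isLittleO_norm_right.1 ?_)
      have h3 := Asymptotics.isLittleO_norm_right.2 h1
      refine h3.congr_right fun s => ?_
      rw [Complex.norm_real]
      rfl
    · filter_upwards [self_mem_nhdsWithin] with s hs
      rw [hre s hs]
      rfl
  obtain ⟨r, hr, G, hGeq, hG⟩ := exists_extension_of_bounded hf hconv hd (fun t _ => hC t.re)
  refine ⟨r, hr, G, fun t ht => hG t ?_, fun σ _ => by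
    rw [hGeq σ (by simp [hS]), Complex.ofReal_re]⟩
  refine Metric.mem_thickening_iff.2 ⟨t.re, by simp [hS], ?_⟩
  rw [dist_eq_norm]
  have h1 : t - t.re = (t.im : ℂ) * Complex.I := Complex.ext (by simp) (by simp)
  rw [h1, norm_mul, Complex.norm_I, mul_one, Complex.norm_real]
  exact ht

/-- `Γ` has a bounded continuation to `D`. -/
def HasBoundedContinuation (f : Phase N → Phase N) (Γ : ℝ → Phase N) (D : Set ℂ) : Prop :=
  ∃ (H : ℂ → Phase N) (C : ℝ), Continues f Γ D H ∧ ∀ t ∈ D, ‖H t‖ ≤ C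

/-- A continuation to a strip is bounded outside a compact interval of real parts. -/
theorem exists_bound_of_ends (hf : Differentiable ℂ f) {R₁ R₂ : ℝ}
    (h₁ : HasBoundedContinuation f Γ {t | t.re < R₁})
    (h₂ : HasBoundedContinuation f Γ {t | R₂ < t.re}) :
    ∃ C, ∀ η > 0, ∀ G, Continues f Γ (strip η) G → ∀ t ∈ strip η, t.re < R₁ ∨ R₂ < t.re →
      ‖G t‖ ≤ C := by
  obtain ⟨H₁, C₁, hH₁, hC₁⟩ := h₁
  obtain ⟨H₂, C₂, hH₂, hC₂⟩ := h₂
  refine ⟨max C₁ C₂, fun η hη G hG t ht hR => ?_⟩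
  rcases hR with hR | hR
  -- The strip and the half-plane are convex and share the real time `R₁ - 1`, so `G` coincides with
  -- `H₁` on the overlap. The bound therefore depends neither on `η` nor on `G`.
  · rw [hG.eqOn hf hH₁ (convex_strip η) (convex_halfSpace_re_lt R₁) (ofReal_mem_strip hη (R₁ - 1))
      (by simp) ht hR]
    exact (hC₁ t hR).trans (le_max_left _ _)
  · rw [hG.eqOn hf hH₂ (convex_strip η) (convex_halfSpace_re_gt R₂) (ofReal_mem_strip hη (R₂ + 1))
      (by simp) ht hR]
    exact (hC₂ t hR).trans (le_max_right _ _)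

theorem exists_bound_real (hΓ : ∀ σ, HasDerivAt Γ (f (Γ σ)) σ) {R₁ R₂ : ℝ}
    (h₁ : HasBoundedContinuation f Γ {t | t.re < R₁})
    (h₂ : HasBoundedContinuation f Γ {t | R₂ < t.re}) : ∃ C, ∀ σ, ‖Γ σ‖ ≤ C := by
  obtain ⟨H₁, C₁, hH₁, hC₁⟩ := h₁
  obtain ⟨H₂, C₂, hH₂, hC₂⟩ := h₂
  have hc : Continuous Γ := continuous_iff_continuousAt.2 fun σ => (hΓ σ).continuousAt
  obtain ⟨C₃, hC₃⟩ := (isCompact_Icc (a := R₁) (b := R₂)).exists_bound_of_continuousOn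
    hc.continuousOn
  refine ⟨max C₁ (max C₂ C₃), fun σ => ?_⟩
  rcases lt_or_ge σ R₁ with h | h
  · rw [← hH₁.eq_on_real σ (by simpa using h)]
    exact (hC₁ _ (by simpa using h)).trans (le_max_left _ _)
  rcases lt_or_ge R₂ σ with h' | h'
  · rw [← hH₂.eq_on_real σ (by simpa using h')]
    exact (hC₂ _ (by simpa using h')).trans ((le_max_left _ _).trans (le_max_right _ _))
  · exact (hC₃ σ ⟨h, h'⟩).trans ((le_max_right _ _).trans (le_max_right _ _))

/-- Solutions which start near `Γ σ₁` are bounded on `[σ₁, σ₂]`. -/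
theorem exists_bound_of_near (hf : Differentiable ℂ f) (hΓ : ∀ σ, HasDerivAt Γ (f (Γ σ)) σ)
    (σ₁ σ₂ : ℝ) :
    ∃ ε > 0, ∃ C, ∀ g : ℝ → Phase N, (∀ σ, HasDerivAt g (f (g σ)) σ) → ‖g σ₁ - Γ σ₁‖ ≤ ε →
      ∀ σ ∈ Set.Icc σ₁ σ₂, ‖g σ‖ ≤ C := by
  have hc : Continuous Γ := continuous_iff_continuousAt.2 fun σ => (hΓ σ).continuousAt
  obtain ⟨C, hC⟩ := (isCompact_Icc (a := σ₁) (b := σ₂)).exists_bound_of_continuousOn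
    hc.continuousOn
  obtain ⟨K, hK⟩ := exists_lipschitzOnWith_closedBall hf (C + 1)
  -- Exceeding the Lipschitz constant makes the barrier `B` grow strictly faster than the difference
  -- at contact. The choice of `ε` keeps `B ≤ 1` up to `σ₂`, hence `g` stays in the ball where `K`
  -- is valid.
  set L : ℝ := K + 1 with hL
  have hL0 : 0 < L := by positivity
  set ε : ℝ := Real.exp (-(L * (σ₂ - σ₁))) with hε
  set B : ℝ → ℝ := fun σ => ε * Real.exp (L * (σ - σ₁)) with hB
  have hB1 : ∀ σ ≤ σ₂, B σ ≤ 1 := by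
    intro σ hσ
    rw [hB, hε]
    dsimp only
    rw [← Real.exp_add, Real.exp_le_one_iff]
    nlinarith
  have hB0 : ∀ σ, 0 < B σ := fun σ => by positivity
  refine ⟨ε, Real.exp_pos _, C + 1, fun g hg hg1 => ?_⟩
  have hd : ∀ σ, HasDerivAt (fun σ => g σ - Γ σ) (f (g σ) - f (Γ σ)) σ :=
    fun σ => (hg σ).sub (hΓ σ)
  have hBd : ∀ σ, HasDerivAt B (L * B σ) σ := by
    intro σ
    have h1 : HasDerivAt (fun σ => L * (σ - σ₁)) L σ := by
      simpa using ((hasDerivAt_id σ).sub_const σ₁).const_mul L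
    refine (h1.exp.const_mul ε).congr_deriv ?_
    simp only [hB]
    ring
  have key := image_norm_le_of_norm_deriv_right_lt_deriv_boundary
    (f := fun σ => g σ - Γ σ) (a := σ₁) (b := σ₂)
    (fun σ _ => (hd σ).continuousAt.continuousWithinAt) (fun σ _ => (hd σ).hasDerivWithinAt)
    (B := B) (B' := fun σ => L * B σ) (by simpa [hB] using hg1) hBd (by
      intro σ hσ heq
      have hσ' := hC σ ⟨hσ.1, hσ.2.le⟩
      have hg2 : ‖g σ‖ ≤ C + 1 := by
        calc ‖g σ‖ = ‖Γ σ + (g σ - Γ σ)‖ := by rw [add_sub_cancel]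
          _ ≤ ‖Γ σ‖ + ‖g σ - Γ σ‖ := norm_add_le _ _
          _ ≤ C + 1 := by
            have := hB1 σ hσ.2.le
            linarith
      have h1 := hK.dist_le_mul (g σ) (mem_closedBall_zero_iff.2 hg2) (Γ σ)
        (mem_closedBall_zero_iff.2 (by linarith))
      rw [dist_eq_norm, dist_eq_norm, heq] at h1
      have := hB0 σ
      nlinarith)
  intro σ hσ'
  have h1 := key hσ'
  calc ‖g σ‖ = ‖Γ σ + (g σ - Γ σ)‖ := by rw [add_sub_cancel]
    _ ≤ ‖Γ σ‖ + ‖g σ - Γ σ‖ := norm_add_le _ _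
    _ ≤ C + 1 := by
      have := hB1 σ hσ'.2
      have := hC σ hσ'
      linarith

end Continuation

/-! ### Liouville's theorem against global continuation, and the blow-up. -/

section Blowup

variable {N : ℕ} {f : Phase N → Phase N} {Γ : ℝ → Phase N}

/-- If `Γ` continues to all strips, then it is stationary. -/
theorem eq_of_entire (hf : Differentiable ℂ f) (hconj : ∀ z, f (star z) = star (f z))
    (hΓ : ∀ σ, HasDerivAt Γ (f (Γ σ)) σ) (hreal : ∀ σ, IsRealPoint (Γ σ)) {R₁ R₂ : ℝ}
    (h₁ : HasBoundedContinuation f Γ {t | t.re < R₁})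
    (h₂ : HasBoundedContinuation f Γ {t | R₂ < t.re}) {σ₁ : ℝ} (hσ₁ : σ₁ < R₁)
    {G : ℂ → Phase N} (hG : ∀ η > 0, Continues f Γ (strip η) G)
    (hrec : ∀ (T ε : ℝ), 0 < ε → ∃ τ ≥ T, ‖G (σ₁ + τ * Complex.I) - G σ₁‖ < ε) (σ σ' : ℝ) :
    Γ σ = Γ σ' := by
  have hmem : ∀ t : ℂ, ∃ η > 0, t ∈ strip η := fun t =>
    ⟨|t.im| + 1, by positivity, lt_add_one |t.im|⟩
  have hd : ∀ t, HasDerivAt G (f (G t)) t := fun t => by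
    obtain ⟨η, hη, ht⟩ := hmem t
    exact (hG η hη).solution t ht
  have hGd : Differentiable ℂ G := fun t => (hd t).differentiableAt
  have hGr : ∀ σ : ℝ, G σ = Γ σ := fun σ =>
    (hG 1 one_pos).eq_on_real σ (ofReal_mem_strip one_pos σ)
  have hGc : ∀ t, G ((starRingEnd ℂ) t) = star (G t) := fun t => by
    obtain ⟨η, hη, ht⟩ := hmem t
    exact (hG η hη).conj hf hconj hreal hη ht
  obtain ⟨C₁, hC₁⟩ := exists_bound_of_ends hf h₁ h₂
  have hends : ∀ t : ℂ, t.re < R₁ ∨ R₂ < t.re → ‖G t‖ ≤ C₁ := fun t ht' => by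
    obtain ⟨η, hη, ht⟩ := hmem t
    exact hC₁ η hη G (hG η hη) t ht ht'
  set σ₂ : ℝ := max R₁ R₂ + 1 with hσ₂
  have h12 : σ₁ < σ₂ := by
    have := le_max_left R₁ R₂
    linarith
  have hR₂ : R₂ < σ₂ := by
    have := le_max_right R₁ R₂
    linarith
  obtain ⟨ε, hε, C₂, hC₂⟩ := exists_bound_of_near hf hΓ σ₁ σ₂
  have hbd : ∀ t, ‖G t‖ ≤ max C₁ C₂ := by
    intro t
    by_cases hre : t.re < R₁ ∨ R₂ < t.re
    · exact (hends t hre).trans (le_max_left _ _)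
    push Not at hre
    -- A return time above the height of `t`. The line at height `τ` is a real-time solution
    -- starting near `Γ σ₁`, with a bound on `[σ₁, σ₂]` independent of `τ`.
    obtain ⟨τ, hτ, hτε⟩ := hrec (|t.im| + 1) ε hε
    have hτ0 : 0 < τ := by
      have := abs_nonneg t.im
      linarith
    have hline : ∀ σ ∈ Set.Icc σ₁ σ₂, ‖G (σ + τ * Complex.I)‖ ≤ C₂ := by
      refine hC₂ (fun σ : ℝ => G (σ + τ * Complex.I)) (fun σ => ?_) ?_
      · exact hasDerivAt_comp_ofReal
          ((hd ((σ : ℂ) + τ * Complex.I)).comp_add_const (σ : ℂ) (τ * Complex.I))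
      · rw [← hGr]
        exact hτε.le
    -- Maximum principle on a rectangle around `t`: its top is bounded by continuous dependence, its
    -- bottom by reflection, and its vertical sides lie in the end half-planes.
    refine Complex.norm_le_of_forall_mem_frontier_norm_le
      (U := Set.Ioo σ₁ σ₂ ×ℂ Set.Ioo (-τ) τ)
      ((Metric.isBounded_Ioo _ _).reProdIm (Metric.isBounded_Ioo _ _)) hGd.diffContOnCl
      (fun z hz => ?_) ?_
    · rw [Complex.frontier_reProdIm, closure_Ioo h12.ne, closure_Ioo (by linarith),
        frontier_Ioo h12, frontier_Ioo (by linarith)] at hz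
      rcases hz with ⟨hz1, hz2⟩ | ⟨hz1, hz2⟩
      · refine le_trans ?_ (le_max_right C₁ C₂)
        rcases hz2 with hz2 | hz2
        · have h3 : z = (starRingEnd ℂ) ((z.re : ℂ) + τ * Complex.I) := by
            have hz2 : z.im = -τ := hz2
            exact Complex.ext (by simp) (by simp [hz2])
          rw [h3, hGc, norm_star]
          exact hline _ hz1
        · have h3 : z = (z.re : ℂ) + τ * Complex.I := by
            have hz2 : z.im = τ := hz2
            exact Complex.ext (by simp) (by simp [hz2])
          rw [h3]
          exact hline _ hz1
      · refine le_trans (hends z ?_) (le_max_left C₁ C₂)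
        rcases hz1 with hz1 | hz1
        · left
          have hz1 : z.re = σ₁ := hz1
          rw [hz1]
          exact hσ₁
        · right
          have hz1 : z.re = σ₂ := hz1
          rw [hz1]
          exact hR₂
    · rw [Complex.closure_reProdIm, closure_Ioo h12.ne, closure_Ioo (by linarith)]
      have h3 := abs_le.1 (show |t.im| ≤ τ by linarith)
      exact ⟨⟨(hσ₁.trans_le hre.1).le, hre.2.trans hR₂.le⟩, h3⟩
  have hb : Bornology.IsBounded (Set.range G) := by
    refine isBounded_iff_forall_norm_le.2 ⟨max C₁ C₂, ?_⟩
    rintro _ ⟨t, rfl⟩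
    exact hbd t
  rw [← hGr, ← hGr]
  exact hGd.apply_eq_apply_of_bounded hb _ _

/-- If a continuation to a strip does not blow up at a boundary point, then it is bounded near this
point. -/
theorem exists_bound_near_boundary (hf : Differentiable ℂ f) {T : ℝ} (hT : 0 < T)
    {G : ℂ → Phase N} (hG : Continues f Γ (strip T) G) {σ₀ : ℝ}
    (h : ¬ Tendsto (fun τ : ℝ => ‖G (σ₀ + τ * Complex.I)‖) (𝓝[<] T) atTop) :
    ∃ C, ∃ V ∈ 𝓝 ((σ₀ : ℂ) + T * Complex.I), ∀ t ∈ V ∩ strip T, ‖G t‖ ≤ C := by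
  -- Without blow-up some bound `C` is met at heights arbitrarily close to `T`. The radius `r`
  -- depends only on `C`, so a local solution started at such a height within `r / 2` of `T` reaches
  -- past the boundary point; the ball of radius `r / 4` around that point lies within `3 r / 4` of
  -- the start.
  rw [tendsto_atTop] at h
  push Not at h
  obtain ⟨C, hC⟩ := h
  obtain ⟨r, hr, hloc⟩ := exists_uniform_radius hf C
  have hev : ∀ᶠ τ in 𝓝[<] T, max 0 (T - r / 2) < τ ∧ τ < T := by
    filter_upwards [Ioo_mem_nhdsLT (show max 0 (T - r / 2) < T from
      max_lt hT (by linarith))] with τ hτ using hτ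
  obtain ⟨τ, hτC, hτ1, hτ2⟩ := (hC.and_eventually hev).exists
  rw [max_lt_iff] at hτ1
  set c : ℂ := σ₀ + τ * Complex.I with hc
  have him : c.im = τ := by simp [hc]
  have hcT : c ∈ strip T := by
    change |c.im| < T
    rw [him, abs_of_pos hτ1.1]
    exact hτ2
  obtain ⟨Z, hZc, hZ⟩ := hloc (G c) hτC.le c
  have hZc' : ContinuousOn Z (Metric.closedBall c (3 * r / 4)) := fun t ht =>
    (hZ t (Metric.closedBall_subset_ball (by linarith) ht)).continuousAt.continuousWithinAt
  obtain ⟨C', hC'⟩ := (isCompact_closedBall c (3 * r / 4)).exists_bound_of_continuousOn hZc'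
  refine ⟨C', Metric.ball (σ₀ + T * Complex.I) (r / 4), Metric.ball_mem_nhds _ (by linarith), ?_⟩
  rintro t ⟨ht, htT⟩
  have hdist : dist ((σ₀ : ℂ) + T * Complex.I) c < r / 2 := by
    have h1 : (σ₀ : ℂ) + T * Complex.I - c = ((T - τ : ℝ) : ℂ) * Complex.I := by
      rw [hc]
      push_cast
      ring
    rw [dist_eq_norm, h1, norm_mul, Complex.norm_I, mul_one, Complex.norm_real, Real.norm_eq_abs,
      abs_of_pos (by linarith)]
    linarith
  have htc : dist t c ≤ 3 * r / 4 := by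
    have := dist_triangle t ((σ₀ : ℂ) + T * Complex.I) c
    rw [Metric.mem_ball] at ht
    linarith
  have hGZ : G t = Z t := by
    refine solution_unique hf ((convex_strip T).inter (convex_ball c r))
      (fun s hs => (hG.solution s hs.1).hasDerivWithinAt)
      (fun s hs => (hZ s hs.2).hasDerivWithinAt) (a := c) ⟨hcT, Metric.mem_ball_self hr⟩
      ⟨htT, ?_⟩ hZc.symm
    rw [Metric.mem_ball]
    linarith
  rw [hGZ]
  exact hC' t htc

/-- A continuation to a strip which nowhere blows up at the upper boundary is bounded. -/
theorem exists_bound_of_no_blowup (hf : Differentiable ℂ f)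
    (hconj : ∀ z, f (star z) = star (f z)) (hreal : ∀ σ, IsRealPoint (Γ σ)) {R₁ R₂ : ℝ}
    (h₁ : HasBoundedContinuation f Γ {t | t.re < R₁})
    (h₂ : HasBoundedContinuation f Γ {t | R₂ < t.re}) {T : ℝ} (hT : 0 < T)
    {G : ℂ → Phase N} (hG : Continues f Γ (strip T) G)
    (h : ∀ σ₀ : ℝ, ¬ Tendsto (fun τ : ℝ => ‖G (σ₀ + τ * Complex.I)‖) (𝓝[<] T) atTop) :
    ∃ C, ∀ t ∈ strip T, ‖G t‖ ≤ C := by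
  obtain ⟨C₁, hC₁⟩ := exists_bound_of_ends hf h₁ h₂
  -- Only a compact rectangle in the closed upper half of the strip needs local bounds: the ends are
  -- uniformly bounded and the lower half follows by reflection.
  obtain ⟨C₂, hC₂⟩ : ∃ C, ∀ t ∈ (Set.Icc R₁ R₂ ×ℂ Set.Icc 0 T) ∩ strip T, ‖G t‖ ≤ C := by
    refine (isCompact_Icc.reProdIm isCompact_Icc).induction_on
      (p := fun s => ∃ C, ∀ t ∈ s ∩ strip T, ‖G t‖ ≤ C) ?_ ?_ ?_ ?_
    · exact ⟨0, fun t ht => absurd ht.1 (Set.notMem_empty t)⟩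
    · rintro s s' hss ⟨C, hC⟩
      exact ⟨C, fun t ht => hC t ⟨hss ht.1, ht.2⟩⟩
    · rintro s s' ⟨C, hC⟩ ⟨C', hC'⟩
      refine ⟨max C C', fun t ht => ?_⟩
      rcases ht.1 with h3 | h3
      · exact (hC t ⟨h3, ht.2⟩).trans (le_max_left _ _)
      · exact (hC' t ⟨h3, ht.2⟩).trans (le_max_right _ _)
    · rintro p ⟨-, hp0, hpT⟩
      rcases hpT.lt_or_eq with hlt | heq
      · have hpm : p ∈ strip T := by
          change |p.im| < T
          rwa [abs_of_nonneg hp0]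
        have hev := (hG.solution p hpm).continuousAt.norm.eventually
          (gt_mem_nhds (lt_add_one ‖G p‖))
        exact ⟨_, mem_nhdsWithin_of_mem_nhds hev, ‖G p‖ + 1, fun t ht => le_of_lt ht.1⟩
      · obtain ⟨C, V, hV, hC⟩ := exists_bound_near_boundary hf hT hG (h p.re)
        rw [← heq, Complex.re_add_im] at hV
        exact ⟨V, mem_nhdsWithin_of_mem_nhds hV, C, hC⟩
  have hup : ∀ t ∈ strip T, 0 ≤ t.im → ‖G t‖ ≤ max C₁ C₂ := by
    intro t ht h0
    by_cases hre : t.re < R₁ ∨ R₂ < t.re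
    · exact (hC₁ T hT G hG t ht hre).trans (le_max_left _ _)
    push Not at hre
    have h3 : |t.im| < T := ht
    exact (hC₂ t ⟨⟨hre, h0, (abs_lt.1 h3).2.le⟩, ht⟩).trans (le_max_right _ _)
  refine ⟨max C₁ C₂, fun t ht => ?_⟩
  rcases le_total 0 t.im with h0 | h0
  · exact hup t ht h0
  · have h3 := hup _ (conj_mem_strip ht) (by simpa using h0)
    rwa [hG.conj hf hconj hreal hT ht, norm_star] at h3

/-- A nonstationary connecting orbit, with bounded continuations near both ends which are recurrent
at one end, blows up in imaginary time. -/
theorem exists_blowup (hf : Differentiable ℂ f) (hconj : ∀ z, f (star z) = star (f z))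
    (hΓ : ∀ σ, HasDerivAt Γ (f (Γ σ)) σ) (hreal : ∀ σ, IsRealPoint (Γ σ))
    (hne : ∃ σ, Γ σ ≠ Γ 0) {R₁ R₂ : ℝ}
    (h₁ : HasBoundedContinuation f Γ {t | t.re < R₁})
    (h₂ : HasBoundedContinuation f Γ {t | R₂ < t.re})
    (hrec : ∀ G, (∀ η > 0, Continues f Γ (strip η) G) → ∃ σ₁ < R₁, ∀ (T ε : ℝ), 0 < ε →
      ∃ τ ≥ T, ‖G (σ₁ + τ * Complex.I) - G (σ₁ : ℝ)‖ < ε) :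
    ∃ σ₀ T : ℝ, 0 < T ∧ BlowsUpInImaginaryTime f Γ σ₀ T := by
  set I : Set ℝ := {η | 0 < η ∧ ∃ G, Continues f Γ (strip η) G} with hI
  obtain ⟨C, hC⟩ := exists_bound_real hΓ h₁ h₂
  obtain ⟨η₀, hη₀, hη₀I⟩ := exists_initial_continuation hf hΓ hC
  have hη₀I : η₀ ∈ I := ⟨hη₀, hη₀I⟩
  obtain ⟨G, hG⟩ := exists_common_continuation hf (I := I) (fun η hη => hη)
  by_cases hbdd : BddAbove I
  · set T := sSup I with hTdef
    have hT : 0 < T := hη₀.trans_le (le_csSup hbdd hη₀I)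
    have hGT : Continues f Γ (strip T) G := by
      have hmem : ∀ t ∈ strip T, ∃ η ∈ I, t ∈ strip η := fun t ht =>
        exists_lt_of_lt_csSup ⟨η₀, hη₀I⟩ ht
      refine ⟨fun t ht => ?_, fun σ _ => (hG η₀ hη₀I).eq_on_real σ (ofReal_mem_strip hη₀ σ)⟩
      obtain ⟨η, hη, ht'⟩ := hmem t ht
      exact (hG η hη).solution t ht'
    have hblow : ∃ σ₀ : ℝ, Tendsto (fun τ : ℝ => ‖G (σ₀ + τ * Complex.I)‖) (𝓝[<] T) atTop := by
      by_contra! hno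
      obtain ⟨C', hC'⟩ := exists_bound_of_no_blowup hf hconj hreal h₁ h₂ hT hGT hno
      -- A bounded continuation would extend to the strip of half-width `T + r`, beyond the
      -- supremum.
      obtain ⟨r, hr, G', hG'eq, hG'⟩ := exists_extension_of_bounded hf (convex_strip T)
        (fun t ht => (hGT.solution t ht).hasDerivWithinAt) hC'
      have hmem : T + r ∈ I := by
        refine ⟨by positivity, G', fun t ht => hG' t (strip_subset_thickening hT hr ht),
          fun σ _ => ?_⟩
        rw [hG'eq _ (ofReal_mem_strip hT σ)]
        exact hGT.eq_on_real σ (ofReal_mem_strip hT σ)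
      have := le_csSup hbdd hmem
      linarith
    obtain ⟨σ₀, hσ₀⟩ := hblow
    refine ⟨σ₀, T, hT, strip T, G, ⟨isOpen_strip T, ?_, ofReal_mem_strip hT,
      fun σ => hGT.eq_on_real σ (ofReal_mem_strip hT σ), hGT.solution⟩, fun τ hτ => ?_, hσ₀, ?_⟩
    · exact ⟨⟨_, ofReal_mem_strip hT 0⟩, (convex_strip T).isPreconnected⟩
    · simpa [strip] using hτ
    · have hneg : Tendsto (fun τ : ℝ => -τ) (𝓝[>] (-T)) (𝓝[<] T) := by
        simpa using tendsto_neg_nhdsGT (a := -T)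
      refine (hσ₀.comp hneg).congr' ?_
      filter_upwards [Ioo_mem_nhdsGT (show -T < 0 by linarith)] with τ hτ
      have ht : (σ₀ : ℂ) + τ * Complex.I ∈ strip T := by
        have : |τ| < T := abs_lt.2 ⟨hτ.1, hτ.2.trans hT⟩
        simpa [strip] using this
      have h3 := hGT.conj hf hconj hreal hT ht
      rw [Function.comp_apply, ← norm_star (G (σ₀ + τ * Complex.I)), ← h3]
      congr 2
      simp
  · exfalso
    have hall : ∀ η > 0, Continues f Γ (strip η) G := by
      intro η hη
      obtain ⟨η', hη', hlt⟩ := not_bddAbove_iff.1 hbdd η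
      exact (hG η' hη').mono (strip_mono hlt.le)
    obtain ⟨σ₁, hσ₁, hr⟩ := hrec G hall
    obtain ⟨σ, hσ⟩ := hne
    exact hσ (eq_of_entire hf hconj hΓ hreal h₁ h₂ hσ₁ hall hr σ 0)

theorem linearization_neg (f : Phase N → Phase N) (v : Phase N) :
    linearization (fun z => -f z) v = -linearization f v := by
  ext1
  simp [linearization, fderiv_fun_neg]

/-- The continuation of an orbit which tends to a hyperbolic equilibrium in backward time. -/
theorem exists_end_continuation (hf : Differentiable ℂ f) {v : Phase N} (hv : f v = 0)
    {ι κ : Type*} [Fintype ι] [Fintype κ] {b : Module.Basis (ι ⊕ κ) ℂ (Phase N)}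
    {lam : ι → ℝ} {μ : κ → ℂ} {η : ℝ} (hb : IsSplitBasis (linearization f v) b lam μ η)
    (hlam : ∀ j, 0 < lam j) (hμ : ∀ i, (μ i).re < 0)
    (hΓ : ∀ σ, HasDerivAt Γ (f (Γ σ)) σ) (hlim : Tendsto Γ atBot (𝓝 v)) :
    ∃ (R C : ℝ) (H : ℂ → Phase N), Continues f Γ {t | t.re < R} H ∧
      (∀ t : ℂ, t.re < R → ‖H t‖ ≤ C) ∧ ∀ σ < R, ∀ (T ε : ℝ), 0 < ε →
        ∃ τ ≥ T, ‖H (σ + τ * Complex.I) - H (σ : ℝ)‖ < ε := by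
  obtain ⟨R, a, ha, hode, heq⟩ := exists_dirichlet_eq hf hv hb hlam hμ hΓ hlim
  refine ⟨R, ‖v‖ + ∑' k, ‖a k‖, fun t => dirichlet lam v a (t - R), ⟨fun t ht => ?_, fun σ hσ => ?_⟩,
    fun t ht => ?_, fun σ hσ T ε hε => ?_⟩
  · have ht : t.re < R := ht
    exact (hode (t - R) (by simpa using ht)).comp_sub_const t R
  · have hσ : σ < R := hσ
    have h1 := heq (σ - R) (by linarith)
    rw [sub_add_cancel] at h1
    rw [← h1]
    push_cast
    rfl
  · have h1 := norm_dirichlet_sub_le hlam v ha (t := t - R) (by simpa using ht.le)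
    have h2 := norm_le_norm_add_norm_sub' (dirichlet lam v a (t - R)) v
    linarith
  · obtain ⟨τ, hτ, h⟩ := dirichlet_recurrent hlam v ha (s := (σ : ℂ) - R) (by simpa using hσ.le) T hε
    refine ⟨τ, hτ, ?_⟩
    rw [sub_add_eq_add_sub] at h
    exact h

theorem blowsUpInImaginaryTime_of_nonresonant (N : ℕ)
    (f : Phase N → Phase N)
    (hf : Differentiable ℂ f)
    (hfreal : ∀ z, IsRealPoint z → IsRealPoint (f z))
    (vminus vplus : Phase N)
    (hvminus : IsHyperbolicEquilibrium f vminus)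
    (hvplus : IsHyperbolicEquilibrium f vplus)
    (hdiag_minus : IsDiagonalizable
      (unstableBlock (linearization f vminus)))
    (hspec_minus : HasRealSpectrum
      (unstableBlock (linearization f vminus)))
    (hres_minus : IsNonresonant
      (unstableBlock (linearization f vminus)))
    (hdiag_plus : IsDiagonalizable
      (stableBlock (linearization f vplus)))
    (hspec_plus : HasRealSpectrum
      (stableBlock (linearization f vplus)))
    (hres_plus : IsNonresonant
      (stableBlock (linearization f vplus)))
    (Γ : ℝ → Phase N)
    (hΓ : IsRealConnectingOrbit f vminus vplus Γ) :
    ∃ σ₀ T : ℝ, 0 < T ∧ BlowsUpInImaginaryTime f Γ σ₀ T := by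
  obtain ⟨ι, _, m, b, lam, μ, η, hb, hlam, hμ⟩ := exists_isSplitBasis
    (A := linearization f vminus) 1 hvminus.2 one_ne_zero (by simp)
    hdiag_minus hspec_minus hres_minus
  obtain ⟨ι', _, m', b', lam', μ', η', hb', hlam', hμ'⟩ := exists_isSplitBasis
    (A := linearization f vplus) (-1) hvplus.2 (by norm_num) (by simp)
    hdiag_plus hspec_plus hres_plus
  obtain ⟨R₁, C₁, H₁, hH₁, hC₁, hrec⟩ := exists_end_continuation hf hvminus.1 hb
    (by simpa using hlam) (by simpa using hμ) hΓ.solution hΓ.tendsto_bot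
  have hb'' := hb'.neg
  rw [← linearization_neg] at hb''
  -- Time reversal turns the stable end at `+∞` into an unstable end at `-∞` for the field `-f`.
  -- Recurrence is discarded here: one recurrent end suffices.
  obtain ⟨R₂, C₂, H₂, hH₂, hC₂, -⟩ := exists_end_continuation (Γ := fun σ => Γ (-σ)) hf.fun_neg
    (by simp [hvplus.1]) hb'' (by simpa using hlam') (by simpa using hμ')
    (fun σ => by
      have h1 := (hΓ.solution (-σ)).scomp σ (hasDerivAt_neg σ)
      rw [neg_one_smul] at h1
      exact h1)
    (hΓ.tendsto_top.comp tendsto_neg_atBot_atTop)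
  have h₁ : HasBoundedContinuation f Γ {t | t.re < R₁} := ⟨H₁, C₁, hH₁, hC₁⟩
  have h₂ : HasBoundedContinuation f Γ {t | -R₂ < t.re} := by
    refine ⟨fun t => H₂ (-t), C₂, ⟨fun t ht => ?_, fun σ hσ => ?_⟩, fun t ht => ?_⟩
    · have ht : -R₂ < t.re := ht
      have h1 := (hH₂.solution (-t) (by simpa using neg_lt.1 ht)).scomp t (hasDerivAt_neg t)
      rw [neg_one_smul, neg_neg] at h1
      exact h1
    · have hσ : -R₂ < σ := hσ
      have h1 := hH₂.eq_on_real (-σ) (by simpa using neg_lt.1 hσ)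
      rw [neg_neg, Complex.ofReal_neg] at h1
      exact h1
    · have ht : -R₂ < t.re := ht
      exact hC₂ (-t) (by simpa using neg_lt.1 ht)
  refine exists_blowup hf (map_star_of_real hf hfreal) hΓ.solution hΓ.real hΓ.nonstationary h₁ h₂
    fun G hG => ⟨R₁ - 1, by linarith, fun T ε hε => ?_⟩
  obtain ⟨τ, hτ, h⟩ := hrec (R₁ - 1) (by linarith) T ε hε
  refine ⟨τ, hτ, ?_⟩
  -- Recurrence is known for the end continuation `H₁`; uniqueness transfers it to any continuation
  -- to all strips.
  have heq : ∀ t : ℂ, t.re < R₁ → G t = H₁ t := fun t ht => by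
    have hη : 0 < |t.im| + 1 := by positivity
    exact (hG _ hη).eqOn hf hH₁ (convex_strip _) (convex_halfSpace_re_lt R₁)
      (ofReal_mem_strip hη (R₁ - 1)) (by simp) (lt_add_one |t.im|) ht
  rw [heq _ (by simp), heq _ (by simp)]
  exact h

end Blowup

end ConnectingOrbit

theorem corollary1p3 (N : ℕ)
    (f : ConnectingOrbit.Phase N → ConnectingOrbit.Phase N)
    (hf : Differentiable ℂ f)
    (hfreal : ∀ z, ConnectingOrbit.IsRealPoint z → ConnectingOrbit.IsRealPoint (f z))
    (vminus vplus : ConnectingOrbit.Phase N)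
    (hvminus : ConnectingOrbit.IsHyperbolicEquilibrium f vminus)
    (hvplus : ConnectingOrbit.IsHyperbolicEquilibrium f vplus)
    (hdiag_minus : ConnectingOrbit.IsDiagonalizable
      (ConnectingOrbit.unstableBlock (ConnectingOrbit.linearization f vminus)))
    (hspec_minus : ConnectingOrbit.HasRealSpectrum
      (ConnectingOrbit.unstableBlock (ConnectingOrbit.linearization f vminus)))
    (hres_minus : ConnectingOrbit.IsNonresonant
      (ConnectingOrbit.unstableBlock (ConnectingOrbit.linearization f vminus)))
    (hdiag_plus : ConnectingOrbit.IsDiagonalizable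
      (ConnectingOrbit.stableBlock (ConnectingOrbit.linearization f vplus)))
    (hspec_plus : ConnectingOrbit.HasRealSpectrum
      (ConnectingOrbit.stableBlock (ConnectingOrbit.linearization f vplus)))
    (hres_plus : ConnectingOrbit.IsNonresonant
      (ConnectingOrbit.stableBlock (ConnectingOrbit.linearization f vplus)))
    (Γ : ℝ → ConnectingOrbit.Phase N)
    (hΓ : ConnectingOrbit.IsRealConnectingOrbit f vminus vplus Γ) :
    ∃ σ₀ T : ℝ, 0 < T ∧ ConnectingOrbit.BlowsUpInImaginaryTime f Γ σ₀ T := by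
  exact ConnectingOrbit.blowsUpInImaginaryTime_of_nonresonant N f hf hfreal vminus vplus hvminus hvplus
    hdiag_minus hspec_minus hres_minus hdiag_plus hspec_plus hres_plus Γ hΓ
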